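/- Let $\mathbb F$ be a field of characteristic $0$ and let $\mathcal V$ be a unital associative (not necessarily commutative) $\mathbb F$-algebra with a derivation $\partial$; $\otimes$ is over $\mathbb F$, $\partial$ acts on tensor powers as a derivation, $(a\otimes b)^\sigma=b\otimes a$, and $\mathcal V\otimes\mathcal V$ carries the product $(a\otimes b)\bullet(c\otimes d)=ac\otimes db$. Powers $(\lambda+\partial)^n$, $n\in\mathbb Z$, are expanded in non-negative powers of $\partial$. **Definitions.** A *non-local 2-fold $\lambda$-bracket* on $\mathcal V$ is a linear map $\{\!\{-_\lambda-\}\!\}:\mathcal V\otimes\mathcal V\to(\mathcal V\otimes\mathcal V)((\lambda^{-1}))$ such that, for all $a,b,c\in\mathcal V$, $$\{\!\{\partial a_\lambda b\}\!\}=-\lambda\{\!\{a_\lambda b\}\!\},\quad \{\!\{a_\lambda\partial b\}\!\}=(\lambda+\partial)\{\!\{a_\lambda b\}\!\},\quad \{\!\{a_\lambda bc\}\!\}=\{\!\{a_\lambda b\}\!\}c+b\{\!\{a_\lambda c\}\!\},$$ $$\{\!\{ab_\lambda c\}\!\}=\sum_n h_n\star_1(\lambda+\partial)^nb+\sum_n\big((\lambda+\partial)^na\big)\star_1k_n,$$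 where $\{\!\{a_\lambda c\}\!\}=\sum_nh_n\lambda^n$, $\{\!\{b_\lambda c\}\!\}=\sum_nk_n\lambda^n$, $b(x\otimes y)c=bx\otimes yc$, $(x\otimes y)\star_1b=xb\otimes y$, $a\star_1(x\otimes y)=x\otimes ay$, and $\partial$ acts on $b$, resp. $a$, only. For a vector space $M$ let $M_{\lambda,\mu}=M[[\lambda^{-1},\mu^{-1},\nu^{-1}]][\lambda,\mu,\nu]/(\nu-\lambda-\mu)$. It embeds in $M((\lambda^{-1}))((\mu^{-1}))$ and in $M((\mu^{-1}))((\lambda^{-1}))$ (expanding $\nu=\lambda+\mu$ for large $\mu$, resp. large $\lambda$) and in $M((\nu^{-1}))((\lambda^{-1}))$ (expanding $\mu=\nu-\lambda$ for large $\lambda$); elements of $M_{\lambda,\mu}$ are identified with their images. Put $$\{\!\{a_\lambda(b\otimes c)\}\!\}_L=\{\!\{a_\lambda b\}\!\}\otimes c,\qquad \{\!\{a_\lambda(b\otimes c)\}\!\}_R=b\otimes\{\!\{a_\lambda c\}\!\},$$ $$\{\!\{(a\otimes b)_\lambda c\}\!\}_L=\sum_n h_n'\otimes(\lambda+\partial)^nb\otimes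 h_n''\quad\text{if } \{\!\{a_\lambda c\}\!\}=\sum_n (h_n'\otimes h_n'')\lambda^n .$$ $\mathcal V$ with such a bracket is a *non-local double Poisson vertex algebra* (non-local double PVA) if, for all $a,b,c\in\mathcal V$, 1. (skewsymmetry) $\{\!\{a_\lambda b\}\!\}=-\{\!\{b_{-\lambda-\partial}a\}\!\}^\sigma$, with $-\lambda-\partial$ moved to the left, $\partial$ acting on the coefficients; 2. (admissibility) $\{\!\{a_\lambda\{\!\{b_\mu c\}\!\}\}\!\}_L\in\mathcal V^{\otimes3}_{\lambda,\mu}$; 3. (Jacobi identity) all three terms of $\{\!\{a_\lambda\{\!\{b_\mu c\}\!\}\}\!\}_L-\{\!\{b_\mu\{\!\{a_\lambda c\}\!\}\}\!\}_R=\{\!\{\{\!\{a_\lambda b\}\!\}_{\lambda+\mu}c\}\!\}_L$ lie in $\mathcal V^{\otimes3}_{\lambda,\mu}$, and the identity holds there. **Theorem.** Let $\mathcal V$ be a non-local double PVA with bracket $\{\!\{-_\lambda-\}\!\}$, and let $\theta_1,\dots,\theta_m\in\mathcal V$ be such that the $m\times m$ matrix pseudodifferential operator $C(\partial)$ over $(\mathcal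 V\otimes\mathcal V,\bullet)$ with symbols $C_{\alpha\beta}(\lambda)=\{\!\{{\theta_\beta}_\lambda\theta_\alpha\}\!\}$ has a two-sided inverse $C^{-1}(\partial)$ in $\mathrm{Mat}_{m\times m}(\mathcal V\otimes\mathcal V)((\partial^{-1}))$. Define the Dirac modification $$\{\!\{a_\lambda b\}\!\}^D=\{\!\{a_\lambda b\}\!\}-\sum_{\alpha,\beta=1}^m\{\!\{{\theta_\beta}_{\lambda+\partial}b\}\!\}_\to\bullet(C^{-1})_{\beta\alpha}(\lambda+\partial)\bullet\{\!\{a_\lambda\theta_\alpha\}\!\},$$ where $\partial$ acts on the coefficients of everything to its right. Then: (a) $\{\!\{-_\lambda-\}\!\}^D$ is a non-local 2-fold $\lambda$-bracket on $\mathcal V$, and it makes $\mathcal V$ a non-local double PVA. (b) $\{\!\{a_\lambda\theta_i\}\!\}^D=\{\!\{{\theta_i}_\lambda a\}\!\}^D=0$ for all $a\in\mathcal V$ and $i=1,\dots,m$. (c) Let $\mathcal I$ be the two-sided differential ideal generated by $\theta_1,\dots,\theta_m$. All coefficients of $\{\!\{a_\lambda x\}\!\}^D$ and $\{\!\{x_\lambda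 a\}\!\}^D$, for $a\in\mathcal V$, $x\in\mathcal I$, lie in $\mathcal V\otimes\mathcal I+\mathcal I\otimes\mathcal V$, and $\partial$ and $\{\!\{-_\lambda-\}\!\}^D$ induce on $\mathcal V/\mathcal I$ a structure of non-local double PVA. -/

import Mathlib

open scoped TensorProduct

noncomputable section

namespace NonlocalDoublePVA

/-! ### Laurent series and pseudodifferential symbols -/

section LaurentSeries

variable (F : Type*) [Field F]
variable (M : Type*) [AddCommGroup M] [Module F M]

/-- The subspace of all `f : ℤ → M` with `f n = 0` for all large `n`. -/
def invLaurentSubmodule : Submodule F (ℤ → M) where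
  carrier := {f | ∃ N : ℤ, ∀ n, N < n → f n = 0}
  zero_mem' := ⟨0, fun _ _ => rfl⟩
  add_mem' := by
    rintro f g ⟨N, hN⟩ ⟨K, hK⟩
    refine ⟨max N K, fun n hn => ?_⟩
    rw [Pi.add_apply, hN n (lt_of_le_of_lt (le_max_left _ _) hn),
      hK n (lt_of_le_of_lt (le_max_right _ _) hn), add_zero]
  smul_mem' := by
    rintro c f ⟨N, hN⟩
    exact ⟨N, fun n hn => by rw [Pi.smul_apply, hN n hn, smul_zero]⟩

/-- `M((z⁻¹))`: formal series `∑ₙ fₙ zⁿ` (`n ∈ ℤ`) with `fₙ = 0` for all large `n`.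
The value `f.1 n` is the coefficient of `zⁿ`. -/
def InvLaurent : Type _ := invLaurentSubmodule F M

instance instAddCommGroupInvLaurent : AddCommGroup (InvLaurent F M) :=
  Submodule.addCommGroup (invLaurentSubmodule F M)

instance instModuleInvLaurent : Module F (InvLaurent F M) :=
  Submodule.module (invLaurentSubmodule F M)

variable {F M} in
@[simp]
lemma InvLaurent.add_coeff (f g : InvLaurent F M) (n : ℤ) : (f + g).1 n = f.1 n + g.1 n := rfl

variable {F M} in
@[simp]
lemma InvLaurent.smul_coeff (c : F) (f : InvLaurent F M) (n : ℤ) :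
    (c • f).1 n = c • f.1 n := rfl

variable {F M} in
@[simp]
lemma InvLaurent.zero_coeff (n : ℤ) : (0 : InvLaurent F M).1 n = 0 := rfl

variable {M}
variable {N : Type*} [AddCommGroup N] [Module F N]
variable {P : Type*} [AddCommGroup P] [Module F P]
variable {F}

/-- Apply a linear map to all coefficients. -/
def mapCoeff (φ : M →ₗ[F] N) : InvLaurent F M →ₗ[F] InvLaurent F N where
  toFun f := ⟨fun n => φ (f.1 n), by
    obtain ⟨K, hK⟩ := f.2
    exact ⟨K, fun n hn => (congrArg φ (hK n hn)).trans (map_zero φ)⟩⟩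
  map_add' f g := Subtype.ext (funext fun n => map_add φ (f.1 n) (g.1 n))
  map_smul' c f := Subtype.ext (funext fun n => map_smul φ c (f.1 n))

/-- Apply a bilinear map to all coefficients of the first argument: `∑ₙ β(fₙ, x) zⁿ`. -/
def mapCoeff₂ (β : M →ₗ[F] N →ₗ[F] P) : InvLaurent F M →ₗ[F] N →ₗ[F] InvLaurent F P :=
  LinearMap.mk₂ F (fun f x => mapCoeff (β.flip x) f)
    (fun f g _ => map_add _ f g)
    (fun c f _ => map_smul _ c f)
    (fun f x y => Subtype.ext (funext fun n => map_add (β (f.1 n)) x y))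
    (fun c f x => Subtype.ext (funext fun n => map_smul (β (f.1 n)) c x))

/-- The constant series `x z⁰`. -/
def const : N →ₗ[F] InvLaurent F N where
  toFun x := ⟨fun n => if n = 0 then x else 0,
    ⟨0, fun n hn => if_neg (ne_of_gt hn)⟩⟩
  map_add' x y := Subtype.ext (funext fun n => by
    change (if n = 0 then x + y else 0) = (if n = 0 then x else 0) + (if n = 0 then y else 0)
    by_cases h : n = 0 <;> simp [h])
  map_smul' c x := Subtype.ext (funext fun n => by
    change (if n = 0 then c • x else 0) = c • (if n = 0 then x else 0)
    by_cases h : n = 0 <;> simp [h])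

/-- Multiplication by the variable: `z f(z)`. -/
def mulVar (f : InvLaurent F M) : InvLaurent F M :=
  ⟨fun n => f.1 (n - 1), by
    obtain ⟨K, hK⟩ := f.2
    exact ⟨K + 1, fun n hn => hK _ (by omega)⟩⟩

lemma finite_symComp (β : M →ₗ[F] N →ₗ[F] P) (D : N →ₗ[F] N)
    (f : InvLaurent F M) (g : InvLaurent F N) (m : ℤ) :
    (Function.support fun x : ℕ × ℤ =>
      Ring.choose x.2 x.1 • β (f.1 x.2) ((D ^ x.1) (g.1 (m - x.2 + x.1)))).Finite := by
  obtain ⟨A, hA⟩ := f.2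
  obtain ⟨B, hB⟩ := g.2
  refine (((Finset.range ((A + B - m).toNat + 1)) ×ˢ
    (Finset.Icc (m - B) A)).finite_toSet).subset ?_
  rintro ⟨j, n⟩ hx
  rw [Function.mem_support] at hx
  have h1 : n ≤ A := by
    by_contra h
    exact hx (by simp [hA n (by omega)])
  have h2 : m - n + j ≤ B := by
    by_contra h
    exact hx (by simp [hB (m - n + j) (by omega)])
  simp only [Finset.coe_product, Set.mem_prod, Finset.mem_coe, Finset.mem_range, Finset.mem_Icc]
  omega

/-- `f(z + D) g(z)`, where the coefficients are multiplied by means of the bilinear map `β`,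
the powers `(z + D)ⁿ` are expanded in non-negative powers of `D`, and `D` acts on the
coefficients of `g`:
`∑_{n, k} ∑_{j ≥ 0} (n choose j) β(fₙ, Dʲ gₖ) z^(n - j + k)`. -/
def symComp (β : M →ₗ[F] N →ₗ[F] P) (D : N →ₗ[F] N) :
    InvLaurent F M →ₗ[F] InvLaurent F N →ₗ[F] InvLaurent F P :=
  LinearMap.mk₂ F
    (fun f g => ⟨fun m => ∑ᶠ x : ℕ × ℤ,
        Ring.choose x.2 x.1 • β (f.1 x.2) ((D ^ x.1) (g.1 (m - x.2 + x.1))), by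
      obtain ⟨A, hA⟩ := f.2
      obtain ⟨B, hB⟩ := g.2
      refine ⟨A + B, fun m hm => finsum_eq_zero_of_forall_eq_zero fun x => ?_⟩
      by_cases h : A < x.2
      · simp [hA _ h]
      · simp [hB (m - x.2 + x.1) (by omega)]⟩)
    (fun f f' g => Subtype.ext (funext fun m => by
      refine Eq.trans (finsum_congr fun x => ?_)
        (finsum_add_distrib (finite_symComp β D f g m) (finite_symComp β D f' g m))
      simp))
    (fun c f g => Subtype.ext (funext fun m => by
      refine Eq.trans (finsum_congr fun x => ?_)
        (smul_finsum' c (finite_symComp β D f g m)).symm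
      simp [smul_comm c]))
    (fun f g g' => Subtype.ext (funext fun m => by
      refine Eq.trans (finsum_congr fun x => ?_)
        (finsum_add_distrib (finite_symComp β D f g m) (finite_symComp β D f g' m))
      simp))
    (fun c f g => Subtype.ext (funext fun m => by
      refine Eq.trans (finsum_congr fun x => ?_)
        (smul_finsum' c (finite_symComp β D f g m)).symm
      simp [smul_comm c]))

/-- `f(z + D)_→ x` for a single element `x`: the derivation `D` acts on `x`. -/
def arrow (β : M →ₗ[F] N →ₗ[F] P) (D : N →ₗ[F] N) :
    InvLaurent F M →ₗ[F] N →ₗ[F] InvLaurent F P :=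
  (symComp β D).compl₂ const

/-- `f(-z - D)`, with `-z - D` moved to the left: its powers are expanded in non-negative
powers of `D`, acting on the coefficients of `f`:
`∑ₙ ∑_{j ≥ 0} (-1)ⁿ (n choose j) Dʲ(fₙ) z^(n - j)`. -/
def substNeg (D : M →ₗ[F] M) (f : InvLaurent F M) : InvLaurent F M :=
  ⟨fun m => ∑ᶠ j : ℕ, (((m + j).negOnePow : ℤˣ) : ℤ) •
      Ring.choose (m + j : ℤ) j • (D ^ j) (f.1 (m + j)), by
    obtain ⟨K, hK⟩ := f.2
    refine ⟨K, fun m hm => finsum_eq_zero_of_forall_eq_zero fun j => ?_⟩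
    simp [hK (m + j) (by omega)]⟩

end LaurentSeries

/-! ### The space `M_{λ,μ} = M[[λ⁻¹, μ⁻¹, (λ+μ)⁻¹]][λ, μ]` and its embeddings -/

section TwoVariables

variable (F : Type*) [Field F]
variable (M : Type*) [AddCommGroup M] [Module F M]

/-- The subspace of all `f : ℤ³ → M` supported on triples of integers bounded above. -/
def laurent₃Submodule : Submodule F (ℤ → ℤ → ℤ → M) where
  carrier := {f | ∃ N : ℤ, ∀ i j k, N < i ∨ N < j ∨ N < k → f i j k = 0}
  zero_mem' := ⟨0, fun _ _ _ _ => rfl⟩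
  add_mem' := by
    rintro f g ⟨N, hN⟩ ⟨K, hK⟩
    refine ⟨max N K, fun i j k h => ?_⟩
    rw [Pi.add_apply, Pi.add_apply, Pi.add_apply, hN i j k (by omega), hK i j k (by omega),
      add_zero]
  smul_mem' := by
    rintro c f ⟨N, hN⟩
    exact ⟨N, fun i j k h => by
      rw [Pi.smul_apply, Pi.smul_apply, Pi.smul_apply, hN i j k h, smul_zero]⟩

/-- `M[[λ⁻¹, μ⁻¹, ν⁻¹]][λ, μ, ν]`; the value `f.1 i j k` is the coefficient of `λⁱ μʲ νᵏ`. -/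
def Laurent₃ : Type _ := laurent₃Submodule F M

instance instAddCommGroupLaurent₃ : AddCommGroup (Laurent₃ F M) :=
  Submodule.addCommGroup (laurent₃Submodule F M)

instance instModuleLaurent₃ : Module F (Laurent₃ F M) :=
  Submodule.module (laurent₃Submodule F M)

variable {F M} in
@[simp]
lemma Laurent₃.add_coeff (f g : Laurent₃ F M) (i j k : ℤ) :
    (f + g).1 i j k = f.1 i j k + g.1 i j k := rfl

variable {F M} in
@[simp]
lemma Laurent₃.smul_coeff (c : F) (f : Laurent₃ F M) (i j k : ℤ) :
    (c • f).1 i j k = c • f.1 i j k := rfl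

variable {F M} in
@[simp]
lemma Laurent₃.neg_coeff (f : Laurent₃ F M) (i j k : ℤ) : (-f).1 i j k = -f.1 i j k := rfl

variable {M}

/-- Multiplication by `ν - λ - ε μ`, for a sign `ε`. -/
def mulRel (ε : ℤˣ) : Laurent₃ F M →ₗ[F] Laurent₃ F M where
  toFun f := ⟨fun i j k => f.1 i j (k - 1) - f.1 (i - 1) j k - (ε : ℤ) • f.1 i (j - 1) k, by
    obtain ⟨N, hN⟩ := f.2
    refine ⟨N + 1, fun i j k h => ?_⟩
    beta_reduce
    rw [hN i j (k - 1) (by omega), hN (i - 1) j k (by omega), hN i (j - 1) k (by omega)]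
    simp⟩
  map_add' f g := Subtype.ext (funext fun i => funext fun j => funext fun k => by
    change (f.1 i j (k - 1) + g.1 i j (k - 1)) - (f.1 (i - 1) j k + g.1 (i - 1) j k) -
        (ε : ℤ) • (f.1 i (j - 1) k + g.1 i (j - 1) k) =
      (f.1 i j (k - 1) - f.1 (i - 1) j k - (ε : ℤ) • f.1 i (j - 1) k) +
        (g.1 i j (k - 1) - g.1 (i - 1) j k - (ε : ℤ) • g.1 i (j - 1) k)
    rw [smul_add]
    abel)
  map_smul' c f := Subtype.ext (funext fun i => funext fun j => funext fun k => by
    change c • f.1 i j (k - 1) - c • f.1 (i - 1) j k - (ε : ℤ) • c • f.1 i (j - 1) k =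
      c • (f.1 i j (k - 1) - f.1 (i - 1) j k - (ε : ℤ) • f.1 i (j - 1) k)
    rw [smul_sub, smul_sub, smul_comm c (ε : ℤ)])

variable {F} in
lemma mulRel_coeff (ε : ℤˣ) (f : Laurent₃ F M) (i j k : ℤ) :
    (mulRel F ε f).1 i j k = f.1 i j (k - 1) - f.1 (i - 1) j k - (ε : ℤ) • f.1 i (j - 1) k := rfl

variable (M) in
/-- `M_{λ,μ}`: the quotient of `M[[λ⁻¹, μ⁻¹, ν⁻¹]][λ, μ, ν]` by the multiples of `ν - λ - μ`. -/
abbrev LamMu : Type _ := Laurent₃ F M ⧸ LinearMap.range (mulRel F (M := M) 1)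

/-- Interchange of the first two variables. -/
def swapVars : Laurent₃ F M →ₗ[F] Laurent₃ F M where
  toFun f := ⟨fun i j k => f.1 j i k, by
    obtain ⟨N, hN⟩ := f.2
    exact ⟨N, fun i j k h => hN _ _ _ (by omega)⟩⟩
  map_add' _ _ := rfl
  map_smul' _ _ := rfl

/-- Cyclic permutation of the variables: the exponents of `λ, μ, ν` become the exponents of the
second, third and first variable. -/
def rotVars : Laurent₃ F M →ₗ[F] Laurent₃ F M where
  toFun f := ⟨fun i j k => f.1 j k i, by
    obtain ⟨N, hN⟩ := f.2
    exact ⟨N, fun i j k h => hN _ _ _ (by omega)⟩⟩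
  map_add' _ _ := rfl
  map_smul' _ _ := rfl

/-- The `(l, k)` contribution to the coefficient of `x^p y^q` in `f(x, y, x + ε y)`, where
`(x + ε y)ᵏ = ∑_{l ≥ 0} (k choose l) x^l (ε y)^(k - l)`. -/
def expandTerm {M : Type*} [AddCommGroup M] (ε : ℤˣ) (f : ℤ → ℤ → ℤ → M) (q p : ℤ) (x : ℕ × ℤ) : M :=
  ((ε ^ (x.2 - x.1) : ℤˣ) : ℤ) • Ring.choose x.2 x.1 • f (p - x.1) (q - x.2 + x.1) x.2

variable {F} in
lemma finite_expandTerm (ε : ℤˣ) (f : Laurent₃ F M) (q p : ℤ) :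
    (Function.support (expandTerm ε f.1 q p)).Finite := by
  obtain ⟨N, hN⟩ := f.2
  refine (((Finset.range ((2 * N - q).toNat + 1)) ×ˢ
    (Finset.Icc (q - N) N)).finite_toSet).subset ?_
  rintro ⟨l, k⟩ hx
  rw [Function.mem_support] at hx
  have h : ¬ (N < q - k + l ∨ N < k) := by
    intro h
    exact hx (by simp [expandTerm, hN (p - l) (q - k + l) k (by omega)])
  simp only [Finset.coe_product, Set.mem_prod, Finset.mem_coe, Finset.mem_range, Finset.mem_Icc]
  omega

variable {F}

/-- The substitution `f(x, y, z) ↦ f(x, y, x + ε y) ∈ M((x⁻¹))((y⁻¹))`, with all powers of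
`x + ε y` expanded for large `y`, i.e. in non-negative powers of `x`. In the value, the outer
series is in `y` and the inner one in `x`. -/
def expand (ε : ℤˣ) : Laurent₃ F M →ₗ[F] InvLaurent F (InvLaurent F M) where
  toFun f := ⟨fun q => ⟨fun p => ∑ᶠ x, expandTerm ε f.1 q p x, by
      obtain ⟨N, hN⟩ := f.2
      refine ⟨3 * N - q, fun p hp => finsum_eq_zero_of_forall_eq_zero fun x => ?_⟩
      simp [expandTerm, hN (p - x.1) (q - x.2 + x.1) x.2 (by omega)]⟩, by
    obtain ⟨N, hN⟩ := f.2
    refine ⟨2 * N, fun q hq => Subtype.ext (funext fun p =>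
      finsum_eq_zero_of_forall_eq_zero fun x => ?_)⟩
    simp [expandTerm, hN (p - x.1) (q - x.2 + x.1) x.2 (by omega)]⟩
  map_add' f g := Subtype.ext (funext fun q => Subtype.ext (funext fun p => by
    refine Eq.trans (finsum_congr fun x => ?_)
      (finsum_add_distrib (finite_expandTerm ε f q p) (finite_expandTerm ε g q p))
    simp [expandTerm]))
  map_smul' c f := Subtype.ext (funext fun q => Subtype.ext (funext fun p => by
    refine Eq.trans (finsum_congr fun x => ?_)
      (smul_finsum' c (finite_expandTerm ε f q p)).symm
    simp [expandTerm, smul_comm c]))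

lemma expand_mulRel (ε : ℤˣ) (f : Laurent₃ F M) : expand ε (mulRel F ε f) = 0 := by
  refine Subtype.ext (funext fun q => Subtype.ext (funext fun p => ?_))
  change ∑ᶠ x, expandTerm ε (mulRel F ε f).1 q p x = 0
  obtain ⟨N, hN⟩ := f.2
  -- the weights of the expansion of `(x + ε y)^(k+1)` in terms of those of `(x + ε y)^k`
  let G : ℕ → ℤ → M := fun l k => f.1 (p - l) (q - k - 1 + l) k
  let w : ℕ → ℤ → ℤ := fun l k => ((ε ^ (k - l) : ℤˣ) : ℤ) * Ring.choose k l
  let w' : ℕ → ℤ → ℤ := fun l k => match l with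
    | 0 => 0
    | l' + 1 => w l' k
  have hfin : ∀ v : ℕ → ℤ → ℤ,
      (Function.support fun x : ℕ × ℤ => v x.1 x.2 • G x.1 x.2).Finite := by
    intro v
    refine (((Finset.range ((2 * N - q + 1).toNat + 1)) ×ˢ
      (Finset.Icc (q - N - 1) N)).finite_toSet).subset ?_
    rintro ⟨l, k⟩ hx
    rw [Function.mem_support] at hx
    have h : ¬ (N < q - k - 1 + l ∨ N < k) := by
      intro h
      exact hx (by simp [G, hN (p - l) (q - k - 1 + l) k (by omega)])
    simp only [Finset.coe_product, Set.mem_prod, Finset.mem_coe, Finset.mem_range, Finset.mem_Icc]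
    omega
  have hw : ∀ l k, w l (k + 1) = w' l k + ε * w l k := by
    intro l k
    cases l with
    | zero =>
      simp only [w, w', Ring.choose_zero_right, Nat.cast_zero, sub_zero, zpow_add_one]
      push_cast
      ring
    | succ l =>
      have e1 : ε ^ (k + 1 - ((l + 1 : ℕ) : ℤ)) = ε ^ (k - l) := by
        congr 1; push_cast; ring
      have e2 : ε * ε ^ (k - ((l + 1 : ℕ) : ℤ)) = ε ^ (k - l) := by
        rw [← zpow_one_add]; congr 1; push_cast; ring
      have e3 : (ε : ℤ) * ((ε ^ (k - ((l + 1 : ℕ) : ℤ)) : ℤˣ) : ℤ) = ((ε ^ (k - l) : ℤˣ) : ℤ) := by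
        rw [← Units.val_mul, e2]
      simp only [w, w']
      rw [e1, Ring.choose_succ_succ, ← mul_assoc (ε : ℤ), e3]
      ring
  have hA : (fun x : ℕ × ℤ => w x.1 (x.2 + 1) • G x.1 x.2) =
      fun x => w' x.1 x.2 • G x.1 x.2 + (ε * w x.1 x.2) • G x.1 x.2 := by
    funext x
    rw [hw, add_smul]
  have hinj : Function.Injective fun x : ℕ × ℤ => (x.1 + 1, x.2) := by
    rintro ⟨a, b⟩ ⟨c, e⟩ h
    simpa using h
  have hB : ∑ᶠ x : ℕ × ℤ, w' x.1 x.2 • G x.1 x.2 =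
      ∑ᶠ x : ℕ × ℤ, w x.1 x.2 • G (x.1 + 1) x.2 := by
    have h := finsum_mem_range (f := fun x : ℕ × ℤ => w' x.1 x.2 • G x.1 x.2) hinj
    rw [finsum_mem_def, Set.indicator_eq_self.2] at h
    · exact h
    · rintro ⟨l, k⟩ hx
      cases l with
      | zero => exact absurd (zero_smul ℤ (G 0 k)) hx
      | succ l => exact ⟨(l, k), rfl⟩
  have hC : ∑ᶠ x : ℕ × ℤ, w x.1 x.2 • f.1 (p - x.1) (q - x.2 + x.1) (x.2 - 1) =
      ∑ᶠ x : ℕ × ℤ, w x.1 (x.2 + 1) • G x.1 x.2 := by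
    rw [← finsum_comp_equiv ((Equiv.refl ℕ).prodCongr (Equiv.addRight (1 : ℤ)))]
    refine finsum_congr fun x => ?_
    simp only [Equiv.prodCongr_apply, Prod.map, Equiv.refl_apply, Equiv.coe_addRight, G]
    rw [add_sub_cancel_right, sub_add_eq_sub_sub]
  rw [hA, finsum_add_distrib (hfin w') (hfin fun l k => ε * w l k), hB] at hC
  have hfB : (Function.support fun x : ℕ × ℤ => w x.1 x.2 • G (x.1 + 1) x.2).Finite := by
    have h := (hfin w').preimage hinj.injOn
    exact h
  have hfC : (Function.support fun x : ℕ × ℤ =>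
      w x.1 x.2 • f.1 (p - x.1) (q - x.2 + x.1) (x.2 - 1)).Finite := by
    have h := (hfin fun l k => w l (k + 1)).preimage
      ((Equiv.refl ℕ).prodCongr (Equiv.addRight (-1 : ℤ))).injective.injOn
    refine h.subset fun x hx => ?_
    rw [Function.mem_support] at hx
    simp only [Set.mem_preimage, Function.mem_support, Equiv.prodCongr_apply, Prod.map,
      Equiv.refl_apply, Equiv.coe_addRight, G]
    convert hx using 3 <;> ring
  have key : ∀ x, expandTerm ε (mulRel F ε f).1 q p x =
      w x.1 x.2 • f.1 (p - x.1) (q - x.2 + x.1) (x.2 - 1) - w x.1 x.2 • G (x.1 + 1) x.2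
        - (ε * w x.1 x.2) • G x.1 x.2 := by
    rintro ⟨l, k⟩
    have h1 : p - (l : ℤ) - 1 = p - ((l + 1 : ℕ) : ℤ) := by push_cast; ring
    have h2 : q - k - 1 + ((l + 1 : ℕ) : ℤ) = q - k + l := by push_cast; ring
    have h3 : q - k + (l : ℤ) - 1 = q - k - 1 + l := by ring
    simp only [expandTerm, mulRel_coeff, G, w, h1, h2, h3, smul_sub, smul_smul]
    congr 2
    ring
  rw [finsum_congr key, finsum_sub_distrib ((hfC.union hfB).subset (Function.support_sub _ _)) (hfin fun l k => ε * w l k),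
    finsum_sub_distrib hfC hfB, hC]
  abel

variable (F M)

/-- `i_μ : M_{λ,μ} → M((λ⁻¹))((μ⁻¹))` (`ν = λ + μ` expanded for large `μ`). -/
def iMu : LamMu F M →ₗ[F] InvLaurent F (InvLaurent F M) :=
  Submodule.liftQ (LinearMap.range (mulRel F (M := M) 1)) (expand (M := M) 1) (by
    rintro _ ⟨f, rfl⟩
    exact LinearMap.mem_ker.2 (expand_mulRel 1 f))

/-- `i_λ : M_{λ,μ} → M((μ⁻¹))((λ⁻¹))` (`ν = λ + μ` expanded for large `λ`). -/
def iLam : LamMu F M →ₗ[F] InvLaurent F (InvLaurent F M) :=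
  Submodule.liftQ (LinearMap.range (mulRel F (M := M) 1)) (expand (M := M) 1 ∘ₗ swapVars F) (by
    rintro _ ⟨f, rfl⟩
    have h : swapVars F (mulRel F 1 f) = mulRel F 1 (swapVars F f) :=
      Subtype.ext (funext fun i => funext fun j => funext fun k => by
        change (mulRel F 1 f).1 j i k = (mulRel F 1 (swapVars F f)).1 i j k
        simp only [mulRel_coeff, Units.val_one, one_smul]
        exact sub_right_comm _ _ _)
    rw [LinearMap.mem_ker, LinearMap.comp_apply, h, expand_mulRel])

/-- `i_λ : M_{λ,μ} → M((ν⁻¹))((λ⁻¹))`, `ν = λ + μ` (`μ = ν - λ` expanded for large `λ`). -/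
def iLamNu : LamMu F M →ₗ[F] InvLaurent F (InvLaurent F M) :=
  Submodule.liftQ (LinearMap.range (mulRel F (M := M) 1)) (expand (M := M) (-1) ∘ₗ rotVars F) (by
    rintro _ ⟨f, rfl⟩
    have h : rotVars F (mulRel F 1 f) = - mulRel F (-1) (rotVars F f) :=
      Subtype.ext (funext fun i => funext fun j => funext fun k => by
        change (mulRel F 1 f).1 j k i = -(mulRel F (-1) (rotVars F f)).1 i j k
        simp only [mulRel_coeff, Units.val_one, one_smul, Units.val_neg, neg_smul]
        change f.1 j k (i - 1) - f.1 (j - 1) k i - f.1 j (k - 1) i =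
          -(f.1 j (k - 1) i - f.1 j k (i - 1) - -f.1 (j - 1) k i)
        abel)
    rw [LinearMap.mem_ker, LinearMap.comp_apply, h, map_neg, expand_mulRel, neg_zero])

end TwoVariables

/-! ### Operations on `V ⊗ V` and `V ⊗ V ⊗ V` -/

section Tensor

variable (F : Type*) [Field F]
variable (V : Type*) [Ring V] [Algebra F V]

/-- `(a ⊗ b) • (c ⊗ d) = ac ⊗ db`. -/
def bullet : V ⊗[F] V →ₗ[F] V ⊗[F] V →ₗ[F] V ⊗[F] V :=
  TensorProduct.map₂ (LinearMap.mul F V) (LinearMap.mul F V).flip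

/-- `(x ⊗ y) ⋆₁ b = xb ⊗ y`. -/
def starRight : V ⊗[F] V →ₗ[F] V →ₗ[F] V ⊗[F] V :=
  (LinearMap.rTensorHom V ∘ₗ (LinearMap.mul F V).flip).flip

/-- `a ⋆₁ (x ⊗ y) = x ⊗ ay`, as a function of `x ⊗ y` and `a`. -/
def starLeft : V ⊗[F] V →ₗ[F] V →ₗ[F] V ⊗[F] V :=
  (LinearMap.lTensorHom V ∘ₗ LinearMap.mul F V).flip

/-- `X ⊗ c`, i.e. `(u ⊗ v), c ↦ u ⊗ v ⊗ c`. -/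
def tensorRight : V ⊗[F] V →ₗ[F] V →ₗ[F] V ⊗[F] (V ⊗[F] V) :=
  (TensorProduct.mk F (V ⊗[F] V) V).compr₂ (TensorProduct.assoc F V V V).toLinearMap

/-- `b ⊗ X`, as a function of `X` and `b`, i.e. `(u ⊗ v), b ↦ b ⊗ u ⊗ v`. -/
def tensorLeft : V ⊗[F] V →ₗ[F] V →ₗ[F] V ⊗[F] (V ⊗[F] V) :=
  (TensorProduct.mk F V (V ⊗[F] V)).flip

/-- `X ⊗₁ y`, i.e. `(u ⊗ v), y ↦ u ⊗ y ⊗ v`. -/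
def tensorMid : V ⊗[F] V →ₗ[F] V →ₗ[F] V ⊗[F] (V ⊗[F] V) :=
  (LinearMap.lTensorHom V ∘ₗ TensorProduct.mk F V V).flip

variable {F V}

/-- The outer action `b (x ⊗ y) = bx ⊗ y`. -/
def outerLeft (b : V) : V ⊗[F] V →ₗ[F] V ⊗[F] V := (LinearMap.mulLeft F b).rTensor V

/-- The outer action `(x ⊗ y) c = x ⊗ yc`. -/
def outerRight (c : V) : V ⊗[F] V →ₗ[F] V ⊗[F] V := (LinearMap.mulRight F c).lTensor V

/-- The action of `∂` on `V ⊗ V`: `∂(x ⊗ y) = ∂x ⊗ y + x ⊗ ∂y`. -/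
def tensorDer (d : V →ₗ[F] V) : V ⊗[F] V →ₗ[F] V ⊗[F] V := d.rTensor V + d.lTensor V

end Tensor

/-! ### Non-local double Poisson vertex algebras -/

section Brackets

variable {F : Type*} [Field F]
variable {V : Type*} [Ring V] [Algebra F V]

/-- A bilinear map `(a, b) ↦ {{a_λ b}} ∈ (V ⊗ V)((λ⁻¹))`. -/
abbrev LambdaMap (F V : Type*) [Field F] [Ring V] [Algebra F V] : Type _ :=
  V →ₗ[F] V →ₗ[F] InvLaurent F (V ⊗[F] V)

/-- `{{a_λ (b ⊗ c)}}_L = {{a_λ b}} ⊗ c`. -/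
def brL (br : LambdaMap F V) (a : V) : V ⊗[F] V →ₗ[F] InvLaurent F (V ⊗[F] (V ⊗[F] V)) :=
  TensorProduct.lift (mapCoeff₂ (tensorRight F V) ∘ₗ br a)

/-- `{{a_λ (b ⊗ c)}}_R = b ⊗ {{a_λ c}}`. -/
def brR (br : LambdaMap F V) (a : V) : V ⊗[F] V →ₗ[F] InvLaurent F (V ⊗[F] (V ⊗[F] V)) :=
  TensorProduct.lift (mapCoeff₂ (tensorLeft F V) ∘ₗ br a).flip

/-- `{{(a ⊗ b)_λ c}}_L = {{a_{λ+∂} c}}_→ ⊗₁ b`. -/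
def brFst (d : V →ₗ[F] V) (br : LambdaMap F V) (c : V) :
    V ⊗[F] V →ₗ[F] InvLaurent F (V ⊗[F] (V ⊗[F] V)) :=
  TensorProduct.lift (arrow (tensorMid F V) d ∘ₗ br.flip c)

/-- `{{a_λ {{b_μ c}}}}_L ∈ V^{⊗3}((λ⁻¹))((μ⁻¹))`. -/
def nestedL (br : LambdaMap F V) (a b c : V) :
    InvLaurent F (InvLaurent F (V ⊗[F] (V ⊗[F] V))) :=
  mapCoeff (brL br a) (br b c)

/-- `{{b_μ {{a_λ c}}}}_R ∈ V^{⊗3}((μ⁻¹))((λ⁻¹))`. -/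
def nestedR (br : LambdaMap F V) (a b c : V) :
    InvLaurent F (InvLaurent F (V ⊗[F] (V ⊗[F] V))) :=
  mapCoeff (brR br b) (br a c)

/-- `{{{{a_λ b}}_{λ+μ} c}}_L ∈ V^{⊗3}(((λ+μ)⁻¹))((λ⁻¹))`. -/
def nestedFst (d : V →ₗ[F] V) (br : LambdaMap F V) (a b c : V) :
    InvLaurent F (InvLaurent F (V ⊗[F] (V ⊗[F] V))) :=
  mapCoeff (brFst d br c) (br a b)

/-- Non-local 2-fold `λ`-brackets on the differential algebra `(V, ∂)`, `∂ = d`. -/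
structure IsLambdaBracket (d : V →ₗ[F] V) (br : LambdaMap F V) : Prop where
  /-- `{{∂a_λ b}} = -λ {{a_λ b}}` -/
  sesqui_left : ∀ a b, br (d a) b = - mulVar (br a b)
  /-- `{{a_λ ∂b}} = (λ + ∂) {{a_λ b}}` -/
  sesqui_right : ∀ a b, br a (d b) = mulVar (br a b) + mapCoeff (tensorDer d) (br a b)
  /-- `{{a_λ bc}} = {{a_λ b}} c + b {{a_λ c}}` -/
  leibniz_right : ∀ a b c,
    br a (b * c) = mapCoeff (outerRight c) (br a b) + mapCoeff (outerLeft b) (br a c)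
  /-- `{{ab_λ c}} = {{a_{λ+∂} c}}_→ ⋆₁ b + (e^{∂ ∂_λ} a) ⋆₁ {{b_λ c}}` -/
  leibniz_left : ∀ a b c,
    br (a * b) c = arrow (starRight F V) d (br a c) b + arrow (starLeft F V) d (br b c) a

/-- `{{a_λ b}} = -{{b_{-λ-∂} a}}^σ`, with `-λ-∂` acting from the left. -/
def IsSkew (d : V →ₗ[F] V) (br : LambdaMap F V) : Prop :=
  ∀ a b, br a b = - mapCoeff (TensorProduct.comm F V V).toLinearMap
    (substNeg (tensorDer d) (br b a))

/-- `{{a_λ {{b_μ c}}}}_L ∈ V^{⊗3}_{λ,μ}` for all `a, b, c`. -/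
def IsAdmissible (br : LambdaMap F V) : Prop :=
  ∀ a b c, nestedL br a b c ∈ LinearMap.range (iMu F (V ⊗[F] (V ⊗[F] V)))

/-- The Jacobi identity
`{{a_λ {{b_μ c}}}}_L - {{b_μ {{a_λ c}}}}_R = {{{{a_λ b}}_{λ+μ} c}}_L`, as an identity in
`V^{⊗3}_{λ,μ}`: the three terms are the images of elements `X, Y, Z` of `V^{⊗3}_{λ,μ}` under the
respective embeddings, and `X - Y = Z`. -/
def IsJacobi (d : V →ₗ[F] V) (br : LambdaMap F V) : Prop :=
  ∀ a b c, ∃ X Y Z : LamMu F (V ⊗[F] (V ⊗[F] V)),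
    iMu F _ X = nestedL br a b c ∧ iLam F _ Y = nestedR br a b c ∧
      iLamNu F _ Z = nestedFst d br a b c ∧ X - Y = Z

/-- `(V, ∂, {{-_λ-}})` is a non-local double Poisson vertex algebra. -/
structure IsNonlocalDoublePVA (d : V →ₗ[F] V) (br : LambdaMap F V) : Prop where
  derivation : ∀ a b, d (a * b) = d a * b + a * d b
  bracket : IsLambdaBracket d br
  skew : IsSkew d br
  admissible : IsAdmissible br
  jacobi : IsJacobi d br

/-! ### Matrix pseudodifferential operators and the Dirac modification -/

/-- The product of pseudodifferential operators over `(V ⊗ V, •)`, in terms of symbols: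
`A(λ + ∂) • B(λ)`. -/
def symMul (d : V →ₗ[F] V) : InvLaurent F (V ⊗[F] V) →ₗ[F] InvLaurent F (V ⊗[F] V) →ₗ[F]
    InvLaurent F (V ⊗[F] V) :=
  symComp (bullet F V) (tensorDer d)

/-- The product of matrix pseudodifferential operators (given by their symbols). -/
def matMul (d : V →ₗ[F] V) {m : ℕ} (A B : Matrix (Fin m) (Fin m) (InvLaurent F (V ⊗[F] V))) :
    Matrix (Fin m) (Fin m) (InvLaurent F (V ⊗[F] V)) :=
  fun i j => ∑ k, symMul d (A i k) (B k j)

/-- The identity matrix operator, with entries `δ_{ij} (1 ⊗ 1)`. -/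
def matOne (F V : Type*) [Field F] [Ring V] [Algebra F V] (m : ℕ) :
    Matrix (Fin m) (Fin m) (InvLaurent F (V ⊗[F] V)) :=
  fun i j => if i = j then const (1 ⊗ₜ[F] 1) else 0

/-- `B` is the (two-sided) inverse of `A`. -/
def IsInverse (d : V →ₗ[F] V) {m : ℕ}
    (A B : Matrix (Fin m) (Fin m) (InvLaurent F (V ⊗[F] V))) : Prop :=
  matMul d A B = matOne F V m ∧ matMul d B A = matOne F V m

/-- The matrix `C(∂)`, with symbols `C_{αβ}(λ) = {{θ_β _λ θ_α}}`. -/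
def constraintMatrix (br : LambdaMap F V) {m : ℕ} (θ : Fin m → V) :
    Matrix (Fin m) (Fin m) (InvLaurent F (V ⊗[F] V)) :=
  fun α β => br (θ β) (θ α)

/-- The Dirac modification
`{{a_λ b}}^D = {{a_λ b}} - ∑_{α,β} {{θ_β _{λ+∂} b}}_→ • (C⁻¹)_{βα}(λ+∂) • {{a_λ θ_α}}`,
where `E` is the matrix of symbols of `C⁻¹(∂)`. -/
def dirac (d : V →ₗ[F] V) (br : LambdaMap F V) {m : ℕ} (θ : Fin m → V)
    (E : Matrix (Fin m) (Fin m) (InvLaurent F (V ⊗[F] V))) : LambdaMap F V :=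
  br - (∑ α, ∑ β,
    ((symMul d).compl₁₂ (br (θ β)) (symMul d (E β α) ∘ₗ br.flip (θ α))).flip : LambdaMap F V)

lemma dirac_apply (d : V →ₗ[F] V) (br : LambdaMap F V) {m : ℕ} (θ : Fin m → V)
    (E : Matrix (Fin m) (Fin m) (InvLaurent F (V ⊗[F] V))) (a b : V) :
    dirac d br θ E a b = br a b -
      ∑ α, ∑ β, symMul d (br (θ β) b) (symMul d (E β α) (br a (θ α))) := by
  simp [dirac, LinearMap.sum_apply]

/-! ### Double PVA ideals and the reduction -/

/-- The two-sided differential ideal `⟨θ₁, …, θ_m⟩` generated by the `θᵢ`. -/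
def diffIdeal (d : V →ₗ[F] V) {m : ℕ} (θ : Fin m → V) : Ideal V :=
  sInf {J : Ideal V | J.IsTwoSided ∧ (∀ x ∈ J, d x ∈ J) ∧ ∀ i, θ i ∈ J}

instance diffIdeal_isTwoSided (d : V →ₗ[F] V) {m : ℕ} (θ : Fin m → V) :
    (diffIdeal d θ).IsTwoSided :=
  ⟨fun b ha => Submodule.mem_sInf.2 fun J hJ =>
    hJ.1.mul_mem_of_left b (Submodule.mem_sInf.1 ha J hJ)⟩

/-- `V ⊗ I + I ⊗ V ⊆ V ⊗ V`. -/
def idealTensor (F : Type*) {V : Type*} [Field F] [Ring V] [Algebra F V] (I : Ideal V) :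
    Submodule F (V ⊗[F] V) :=
  LinearMap.range ((I.restrictScalars F).subtype.lTensor V) ⊔
    LinearMap.range ((I.restrictScalars F).subtype.rTensor V)

/-- `I` is a double PVA ideal: a two-sided differential ideal such that `{{V_λ I}}` and
`{{I_λ V}}` have all their coefficients in `V ⊗ I + I ⊗ V`. -/
structure IsDoublePVAIdeal (d : V →ₗ[F] V) (br : LambdaMap F V) (I : Ideal V) : Prop where
  twoSided : I.IsTwoSided
  differential : ∀ x ∈ I, d x ∈ I
  bracket_right : ∀ a, ∀ x ∈ I, ∀ n, (br a x).1 n ∈ idealTensor F I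
  bracket_left : ∀ x ∈ I, ∀ a, ∀ n, (br x a).1 n ∈ idealTensor F I

/-- The map `π ⊗ π : V ⊗ V → V/I ⊗ V/I` induced by the projection `π : V → V/I`. -/
def quotTensor (F : Type*) {V : Type*} [Field F] [Ring V] [Algebra F V] (I : Ideal V)
    [I.IsTwoSided] : V ⊗[F] V →ₗ[F] (V ⧸ I) ⊗[F] (V ⧸ I) :=
  TensorProduct.map (Ideal.Quotient.mkₐ F I).toLinearMap (Ideal.Quotient.mkₐ F I).toLinearMap

/-- `(d', br')` is the structure on `V/I` induced by `(d, br)`. -/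
def IsInduced (I : Ideal V) [I.IsTwoSided] (d : V →ₗ[F] V) (br : LambdaMap F V)
    (d' : (V ⧸ I) →ₗ[F] (V ⧸ I)) (br' : LambdaMap F (V ⧸ I)) : Prop :=
  (∀ a, d' (Ideal.Quotient.mk I a) = Ideal.Quotient.mk I (d a)) ∧
    ∀ a b, br' (Ideal.Quotient.mk I a) (Ideal.Quotient.mk I b) =
      mapCoeff (quotTensor F I) (br a b)

end Brackets

end NonlocalDoublePVA

end

noncomputable section

namespace NonlocalDoublePVA

/-! ### Calculus of symbols -/

section SymbolCalculus

variable {F : Type*} [Field F]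
variable {M : Type*} [AddCommGroup M] [Module F M]
variable {N : Type*} [AddCommGroup N] [Module F N]
variable {P : Type*} [AddCommGroup P] [Module F P]
variable {Q : Type*} [AddCommGroup Q] [Module F Q]
variable {M' : Type*} [AddCommGroup M'] [Module F M']
variable {N' : Type*} [AddCommGroup N'] [Module F N']
variable {P' : Type*} [AddCommGroup P'] [Module F P']

/-! Symbols over `(V ⊗ V, •)` with the product `f(λ+∂) • g(λ)` (`symMul`) form an associative
algebra `K`. In it the correction term is a sandwich `q E r`: a row of brackets `{{θ_β b}}`, the
inverse `E` of `C`, a column of brackets `{{a θ_α}}`. Sesquilinearity and the Leibniz rules say how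
the bracket behaves under operations that pass through such products, so they survive. The adjoint
`f(-λ-∂)^σ` is an anti-automorphism of `K` under which `C`, hence `E`, is skewadjoint; this gives
skewsymmetry. Part (b) is `C E = 1 = E C`.

The Jacobi identity is the core. Each nested bracket, as a function of its inner bracket, is a
derivation `Δ` from `K` to a differential bimodule (`brL_bullet`, `brR_bullet`, `brFst_bullet`).
Since `Δ E = -E Δ(C) E`, the value of `Δ` on `p - q E r` is `Δp - Δ(q) E r - q E Δ(r) + q E Δ(C) E
r` (`derivation_sub_sandwich`). These four terms are the expansion of a product of two
substitutions: each of the two inner arguments is corrected by a combination of the `θ`s. Modifying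
the outer bracket corrects the third argument. Hence each of the three nested Dirac brackets is
obtained from the original one by the same three operators `projA`, `projB`, `projC`
(`nestedL_dirac`, `nestedR_dirac`, `nestedFst_dirac`).

These operators act on series in `λ, μ, ν` before any expansion. They commute with one another and
with multiplication by `ν - λ - μ`, and they are compatible with the three embeddings. Applied to `X
- Y - Z = (ν - λ - μ) Q` they yield the Jacobi identity of the modification, and admissibility with
it.

Identities between series are rarely proved by comparing binomial coefficients. Both sides are
continuous, agree on constants, and their truth at `f` and at `z f` is equivalent once it is stated
for all values of the other arguments (`eq_of_const`, `eq_zero_of_const_of_mulZ`).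

For (c), the elements `x` of the ideal whose brackets `{{a_λ x}}^D` lie in `V ⊗ I + I ⊗ V` form a
two-sided differential ideal containing the `θ`s, and skewsymmetry handles `{{x_λ a}}^D`. All axioms
descend along a surjective homomorphism. -/

lemma InvLaurent.ext {f g : InvLaurent F M} (h : ∀ n, f.1 n = g.1 n) : f = g :=
  Subtype.ext (funext h)

@[simp]
lemma InvLaurent.neg_coeff (f : InvLaurent F M) (n : ℤ) : (-f).1 n = -f.1 n := rfl

@[simp]
lemma InvLaurent.sub_coeff (f g : InvLaurent F M) (n : ℤ) : (f - g).1 n = f.1 n - g.1 n :=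
  congrFun (Submodule.coe_sub (p := invLaurentSubmodule F M) f g) n

/-- The coefficient of `zⁿ`, as a linear map. -/
def coeffₗ (n : ℤ) : InvLaurent F M →ₗ[F] M where
  toFun f := f.1 n
  map_add' _ _ := rfl
  map_smul' _ _ := rfl

@[simp]
lemma coeffₗ_apply (n : ℤ) (f : InvLaurent F M) : coeffₗ n f = f.1 n := rfl

@[simp]
lemma mapCoeff_coeff (φ : M →ₗ[F] N) (f : InvLaurent F M) (n : ℤ) :
    (mapCoeff φ f).1 n = φ (f.1 n) := rfl

@[simp]
lemma mapCoeff₂_coeff (β : M →ₗ[F] N →ₗ[F] P) (f : InvLaurent F M) (x : N) (n : ℤ) :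
    (mapCoeff₂ β f x).1 n = β (f.1 n) x := rfl

lemma const_coeff (x : M) (n : ℤ) : (const x : InvLaurent F M).1 n = if n = 0 then x else 0 := rfl

@[simp]
lemma mulVar_coeff (f : InvLaurent F M) (n : ℤ) : (mulVar f).1 n = f.1 (n - 1) := rfl

lemma symComp_coeff (β : M →ₗ[F] N →ₗ[F] P) (D : N →ₗ[F] N) (f : InvLaurent F M)
    (g : InvLaurent F N) (m : ℤ) : (symComp β D f g).1 m = ∑ᶠ x : ℕ × ℤ,
      Ring.choose x.2 x.1 • β (f.1 x.2) ((D ^ x.1) (g.1 (m - x.2 + x.1))) := rfl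

@[simp]
lemma mapCoeff_id (f : InvLaurent F M) : mapCoeff LinearMap.id f = f := rfl

@[simp]
lemma mapCoeff_const (φ : M →ₗ[F] N) (x : M) :
    mapCoeff φ (const x : InvLaurent F M) = const (φ x) :=
  InvLaurent.ext fun n => by
    simp only [mapCoeff_coeff, const_coeff]
    split_ifs <;> simp

variable (F M) in
/-- Multiplication by the variable, as a linear automorphism. -/
def mulVarEquiv : InvLaurent F M ≃ₗ[F] InvLaurent F M where
  toFun := mulVar
  invFun f := ⟨fun n => f.1 (n + 1), by
    obtain ⟨K, hK⟩ := f.2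
    exact ⟨K, fun n hn => hK _ (by omega)⟩⟩
  map_add' _ _ := rfl
  map_smul' _ _ := rfl
  left_inv f := InvLaurent.ext fun n => congrArg f.1 (by ring)
  right_inv f := InvLaurent.ext fun n => congrArg f.1 (by ring)

variable (F M) in
/-- Multiplication by the variable, as a linear map. -/
def mulVarₗ : InvLaurent F M →ₗ[F] InvLaurent F M := (mulVarEquiv F M).toLinearMap

@[simp]
lemma mulVarₗ_apply (f : InvLaurent F M) : mulVarₗ F M f = mulVar f := rfl

@[simp]
lemma mulVar_zero : mulVar (0 : InvLaurent F M) = 0 := rfl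

@[simp]
lemma mulVar_sub (f g : InvLaurent F M) : mulVar (f - g) = mulVar f - mulVar g :=
  map_sub (mulVarₗ F M) f g

/-- All coefficients of `zⁿ`, `n > K`, vanish. -/
def DegreeLE (K : ℤ) (f : InvLaurent F M) : Prop := ∀ n, K < n → f.1 n = 0

lemma exists_degreeLE (f : InvLaurent F M) : ∃ K, DegreeLE K f := f.2

lemma DegreeLE.mono {K L : ℤ} {f : InvLaurent F M} (h : DegreeLE K f) (hKL : K ≤ L) :
    DegreeLE L f := fun n hn => h n (lt_of_le_of_lt hKL hn)

lemma DegreeLE.sub {K : ℤ} {f g : InvLaurent F M} (hf : DegreeLE K f) (hg : DegreeLE K g) :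
    DegreeLE K (f - g) := fun n hn => by simp [hf n hn, hg n hn]

lemma DegreeLE.mapCoeff {K : ℤ} {f : InvLaurent F M} (hf : DegreeLE K f) (φ : M →ₗ[F] N) :
    DegreeLE K (mapCoeff φ f) := fun n hn => by simp [hf n hn]

lemma degreeLE_const (x : M) : DegreeLE 0 (const x : InvLaurent F M) :=
  fun _ hn => if_neg (ne_of_gt hn)

lemma DegreeLE.symComp {A B : ℤ} {f : InvLaurent F M} {g : InvLaurent F N} (hf : DegreeLE A f)
    (hg : DegreeLE B g) (β : M →ₗ[F] N →ₗ[F] P) (D : N →ₗ[F] N) :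
    DegreeLE (A + B) (symComp β D f g) := fun m hm => by
  rw [symComp_coeff]
  refine finsum_eq_zero_of_forall_eq_zero fun x => ?_
  by_cases h : A < x.2
  · simp [hf _ h]
  · simp [hg (m - x.2 + x.1) (by omega)]

lemma DegreeLE.arrow {A : ℤ} {f : InvLaurent F M} (hf : DegreeLE A f)
    (β : M →ₗ[F] N →ₗ[F] P) (D : N →ₗ[F] N) (x : N) : DegreeLE A (arrow β D f x) := by
  have h := hf.symComp (degreeLE_const x) β D
  rwa [add_zero] at h

/-- The monomial `a zⁿ`. -/
def monomial (n : ℤ) (a : M) : InvLaurent F M :=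
  ⟨fun k => if k = n then a else 0, ⟨n, fun _ hk => if_neg (ne_of_gt hk)⟩⟩

lemma mulVar_monomial (n : ℤ) (a : M) :
    mulVar (monomial n a : InvLaurent F M) = monomial (n + 1) a :=
  InvLaurent.ext fun k => if_congr (by omega) rfl rfl

/-- Families of linear maps which are continuous, vanish on constants, and whose common
vanishing at `f` and at `z f` are equivalent, vanish. -/
theorem eq_zero_of_const {ι : Type*} (Φ : ι → InvLaurent F M →ₗ[F] Q)
    (hb : ∀ i, ∃ K, ∀ f, DegreeLE K f → Φ i f = 0)
    (hc : ∀ i a, Φ i (const a) = 0)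
    (hs : ∀ f, (∀ i, Φ i f = 0) ↔ ∀ i, Φ i (mulVar f) = 0) (i : ι) (f : InvLaurent F M) :
    Φ i f = 0 := by
  -- The index stays universally quantified during the induction, since passing between `f` and `z
  -- f` may change it. Negative exponents need the backward half of `hs`.
  have hm : ∀ (n : ℤ) (a : M) (i : ι), Φ i (monomial n a) = 0 := by
    intro n a
    induction n using Int.induction_on with
    | zero => exact fun i => hc i a
    | succ n ih =>
      have := (hs _).1 ih
      rwa [mulVar_monomial] at this
    | pred n ih =>
      refine (hs _).2 ?_
      rw [mulVar_monomial]
      simpa using ih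
  obtain ⟨K, hK⟩ := hb i
  obtain ⟨L, hL⟩ := exists_degreeLE f
  -- Only the finitely many degrees in `(K, L]` matter: the rest of `f` has degree at most `K` and
  -- is killed by continuity.
  have hsum : ∀ n, (∑ k ∈ Finset.Ioc K L, monomial k (f.1 k) : InvLaurent F M).1 n =
      if n ∈ Finset.Ioc K L then f.1 n else 0 := by
    intro n
    rw [← coeffₗ_apply, map_sum]
    simp only [monomial]
    exact Finset.sum_ite_eq _ n _
  have htail : DegreeLE K (f - ∑ k ∈ Finset.Ioc K L, monomial k (f.1 k)) := by
    intro n hn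
    rw [InvLaurent.sub_coeff, hsum]
    by_cases h : n ≤ L
    · rw [if_pos (Finset.mem_Ioc.2 ⟨hn, h⟩), sub_self]
    · rw [if_neg (by simp [h]), hL n (by omega), sub_zero]
  have := hK _ htail
  rw [map_sub, map_sum, Finset.sum_eq_zero fun k _ => hm k _ i, sub_zero] at this
  exact this

/-- A version of `eq_zero_of_const` for equalities between maps with bounded degree shift. -/
theorem eq_of_const {ι : Type*} (Φ Ψ : ι → InvLaurent F M →ₗ[F] InvLaurent F Q)
    (hΦ : ∀ i, ∃ B, ∀ K f, DegreeLE K f → DegreeLE (K + B) (Φ i f))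
    (hΨ : ∀ i, ∃ B, ∀ K f, DegreeLE K f → DegreeLE (K + B) (Ψ i f))
    (hc : ∀ i a, Φ i (const a) = Ψ i (const a))
    (hs : ∀ f, (∀ i, Φ i f = Ψ i f) ↔ ∀ i, Φ i (mulVar f) = Ψ i (mulVar f)) (i : ι)
    (f : InvLaurent F M) : Φ i f = Ψ i f := by
  have key : ∀ f : InvLaurent F M, (∀ i, Φ i f = Ψ i f) ↔
      ∀ x : ι × ℤ, (coeffₗ x.2 ∘ₗ (Φ x.1 - Ψ x.1)) f = 0 := fun f => by
    constructor
    · intro h x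
      simp [h x.1]
    · intro h i
      refine InvLaurent.ext fun n => sub_eq_zero.1 ?_
      simpa using h (i, n)
  refine (key f).2 (fun x => eq_zero_of_const
    (fun x : ι × ℤ => coeffₗ x.2 ∘ₗ (Φ x.1 - Ψ x.1)) ?_ ?_ ?_ x f) i
  · rintro ⟨i, n⟩
    obtain ⟨B, hB⟩ := hΦ i
    obtain ⟨B', hB'⟩ := hΨ i
    -- With this bound both images have degree at most `n - 1`, so their coefficients at `n` vanish.
    refine ⟨n - 1 - max B B', fun f hf => ?_⟩
    have h1 := hB _ f hf n (by omega)
    have h2 := hB' _ f hf n (by omega)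
    simp [h1, h2]
  · rintro ⟨i, n⟩ a
    simp [hc]
  · intro f
    rw [← key, ← key, hs]

/-- A Leibniz rule for coefficients lifts to symbols because the maps on the second factor commute
with the derivations, hence with all their powers. The two summands may use different products, so
the statement covers derivations into bimodules and, with one summand zero, homomorphisms. -/
lemma mapCoeff_symComp_add (φ : P →ₗ[F] P') {β : M →ₗ[F] N →ₗ[F] P} {D : N →ₗ[F] N}
    {M₁ N₁ M₂ N₂ : Type*} [AddCommGroup M₁] [Module F M₁] [AddCommGroup N₁] [Module F N₁]
    [AddCommGroup M₂] [Module F M₂] [AddCommGroup N₂] [Module F N₂]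
    (β₁ : M₁ →ₗ[F] N₁ →ₗ[F] P') (D₁ : N₁ →ₗ[F] N₁) (a₁ : M →ₗ[F] M₁) (b₁ : N →ₗ[F] N₁)
    (β₂ : M₂ →ₗ[F] N₂ →ₗ[F] P') (D₂ : N₂ →ₗ[F] N₂) (a₂ : M →ₗ[F] M₂) (b₂ : N →ₗ[F] N₂)
    (h₁ : ∀ y, b₁ (D y) = D₁ (b₁ y)) (h₂ : ∀ y, b₂ (D y) = D₂ (b₂ y))
    (h : ∀ x y, φ (β x y) = β₁ (a₁ x) (b₁ y) + β₂ (a₂ x) (b₂ y))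
    (f : InvLaurent F M) (g : InvLaurent F N) :
    mapCoeff φ (symComp β D f g) = symComp β₁ D₁ (mapCoeff a₁ f) (mapCoeff b₁ g) +
      symComp β₂ D₂ (mapCoeff a₂ f) (mapCoeff b₂ g) := by
  have p₁ : ∀ (j : ℕ) y, b₁ ((D ^ j) y) = (D₁ ^ j) (b₁ y) := fun j y => by
    induction j with
    | zero => rfl
    | succ j ih => rw [pow_succ', pow_succ', Module.End.mul_apply, h₁, ih, Module.End.mul_apply]
  have p₂ : ∀ (j : ℕ) y, b₂ ((D ^ j) y) = (D₂ ^ j) (b₂ y) := fun j y => by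
    induction j with
    | zero => rfl
    | succ j ih => rw [pow_succ', pow_succ', Module.End.mul_apply, h₂, ih, Module.End.mul_apply]
  refine InvLaurent.ext fun m => ?_
  rw [InvLaurent.add_coeff, mapCoeff_coeff, symComp_coeff, symComp_coeff, symComp_coeff,
    ← finsum_add_distrib (finite_symComp β₁ D₁ _ _ m) (finite_symComp β₂ D₂ _ _ m)]
  refine (φ.toAddMonoidHom.map_finsum (finite_symComp β D f g m)).trans (finsum_congr fun x => ?_)
  simp [h, p₁, p₂]

lemma mapCoeff_symComp (φ : P →ₗ[F] P') {β : M →ₗ[F] N →ₗ[F] P} {D : N →ₗ[F] N}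
    (β' : M' →ₗ[F] N' →ₗ[F] P') (D' : N' →ₗ[F] N') (a : M →ₗ[F] M') (b : N →ₗ[F] N')
    (hb : ∀ y, b (D y) = D' (b y)) (h : ∀ x y, φ (β x y) = β' (a x) (b y))
    (f : InvLaurent F M) (g : InvLaurent F N) :
    mapCoeff φ (symComp β D f g) = symComp β' D' (mapCoeff a f) (mapCoeff b g) := by
  have := mapCoeff_symComp_add φ (β := β) β' D' a b β' D' (0 : M →ₗ[F] M') b hb hb
    (fun x y => by simp [h]) f g
  have h0 : mapCoeff (0 : M →ₗ[F] M') f = 0 := rfl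
  simpa [h0] using this

/-- A version of `mapCoeff_symComp` acting on the left factor only. -/
lemma mapCoeff_symComp_left (φ : P →ₗ[F] P') {β : M →ₗ[F] N →ₗ[F] P} {D : N →ₗ[F] N}
    (β' : M' →ₗ[F] N →ₗ[F] P') (a : M →ₗ[F] M') (h : ∀ x y, φ (β x y) = β' (a x) y)
    (f : InvLaurent F M) (g : InvLaurent F N) :
    mapCoeff φ (symComp β D f g) = symComp β' D (mapCoeff a f) g :=
  mapCoeff_symComp φ β' D a LinearMap.id (fun _ => rfl) h f g

/-- The operator `z + D` on series. -/
def shiftOp (D : N →ₗ[F] N) : InvLaurent F N →ₗ[F] InvLaurent F N := mulVarₗ F N + mapCoeff D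

lemma shiftOp_apply (D : N →ₗ[F] N) (g : InvLaurent F N) :
    shiftOp D g = mulVar g + mapCoeff D g := rfl

lemma symComp_mulVar_right (β : M →ₗ[F] N →ₗ[F] P) (D : N →ₗ[F] N) (f : InvLaurent F M)
    (g : InvLaurent F N) : symComp β D f (mulVar g) = mulVar (symComp β D f g) := by
  refine InvLaurent.ext fun m => ?_
  rw [mulVar_coeff, symComp_coeff, symComp_coeff]
  refine finsum_congr fun x => ?_
  rw [mulVar_coeff, show m - x.2 + x.1 - 1 = m - 1 - x.2 + x.1 by ring]

lemma symComp_const_left (β : M →ₗ[F] N →ₗ[F] P) (D : N →ₗ[F] N) (a : M) (g : InvLaurent F N) :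
    symComp β D (const a) g = mapCoeff (β a) g := by
  refine InvLaurent.ext fun m => ?_
  rw [symComp_coeff, finsum_eq_single _ ((0 : ℕ), (0 : ℤ))]
  · simp [const_coeff]
  · rintro ⟨j, n⟩ h
    simp only [const_coeff]
    by_cases hn : n = 0
    · subst hn
      cases j with
      | zero => exact absurd rfl h
      | succ j => simp
    · simp [hn]

/-- This is Pascal's rule for `Ring.choose`. Together with the rules for constants and for `mulVar`
on the right it determines `symComp`, which lets later proofs avoid coefficients. -/
lemma symComp_mulVar_left (β : M →ₗ[F] N →ₗ[F] P) (D : N →ₗ[F] N) (f : InvLaurent F M)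
    (g : InvLaurent F N) : symComp β D (mulVar f) g = symComp β D f (shiftOp D g) := by
  rw [shiftOp_apply, map_add, symComp_mulVar_right]
  refine InvLaurent.ext fun m => ?_
  rw [InvLaurent.add_coeff, mulVar_coeff, symComp_coeff, symComp_coeff, symComp_coeff]
  let G : ℕ → ℤ → P := fun j n => β (f.1 n) ((D ^ j) (g.1 (m - 1 - n + j)))
  have hfin : ∀ v : ℕ → ℤ → ℤ,
      (Function.support fun x : ℕ × ℤ => v x.1 x.2 • G x.1 x.2).Finite := by
    intro v
    obtain ⟨A, hA⟩ := f.2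
    obtain ⟨B, hB⟩ := g.2
    refine (((Finset.range ((A + B - (m - 1)).toNat + 1)) ×ˢ
      (Finset.Icc (m - 1 - B) A)).finite_toSet).subset ?_
    rintro ⟨j, n⟩ hx
    rw [Function.mem_support] at hx
    have h1 : n ≤ A := by
      by_contra h
      exact hx (by simp [G, hA n (by omega)])
    have h2 : m - 1 - n + j ≤ B := by
      by_contra h
      exact hx (by simp [G, hB (m - 1 - n + j) (by omega)])
    simp only [Finset.coe_product, Set.mem_prod, Finset.mem_coe, Finset.mem_range, Finset.mem_Icc]
    omega
  -- The second summand of Pascal's rule, with value `0` at `j = 0`; reindexing by `j + 1` turns it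
  -- into the term with `D g`.
  let w : ℕ → ℤ → ℤ := fun j n => match j with
    | 0 => 0
    | j + 1 => Ring.choose n j
  have hinj : Function.Injective fun x : ℕ × ℤ => (x.1 + 1, x.2) := by
    rintro ⟨a, b⟩ ⟨c, e⟩ h
    simpa using h
  have h1 : ∑ᶠ x : ℕ × ℤ,
      Ring.choose x.2 x.1 • β ((mulVar f).1 x.2) ((D ^ x.1) (g.1 (m - x.2 + x.1))) =
      ∑ᶠ x : ℕ × ℤ, (Ring.choose x.2 x.1 • G x.1 x.2 + w x.1 x.2 • G x.1 x.2) := by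
    rw [← finsum_comp_equiv ((Equiv.refl ℕ).prodCongr (Equiv.addRight (1 : ℤ)))]
    refine finsum_congr fun x => ?_
    obtain ⟨j, n⟩ := x
    simp only [Equiv.prodCongr_apply, Prod.map, Equiv.refl_apply, Equiv.coe_addRight, mulVar_coeff,
      add_sub_cancel_right, G, ← add_smul]
    rw [sub_add_eq_sub_sub, sub_right_comm]
    congr 1
    cases j with
    | zero => simp [w]
    | succ j => rw [Ring.choose_succ_succ, add_comm]
  have h2 : ∑ᶠ x : ℕ × ℤ, w x.1 x.2 • G x.1 x.2 =
      ∑ᶠ x : ℕ × ℤ, Ring.choose x.2 x.1 • G (x.1 + 1) x.2 := by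
    have h := finsum_mem_range (f := fun x : ℕ × ℤ => w x.1 x.2 • G x.1 x.2) hinj
    rw [finsum_mem_def, Set.indicator_eq_self.2] at h
    · exact h
    · rintro ⟨j, n⟩ hx
      cases j with
      | zero => exact absurd (zero_smul ℤ (G 0 n)) hx
      | succ j => exact ⟨(j, n), rfl⟩
  rw [h1, finsum_add_distrib (hfin fun j n => Ring.choose n j) (hfin w), h2]
  refine congrArg₂ (· + ·) rfl (finsum_congr fun x => ?_)
  simp only [G, mapCoeff_coeff, pow_succ, Module.End.mul_apply]
  rw [show m - 1 - x.2 + ((x.1 + 1 : ℕ) : ℤ) = m - x.2 + x.1 by push_cast; ring]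

/-- The derivation of the product splits by Leibniz. The part where `D` hits `g`, together with the
factor `z`, is `f` composed with `(z + D) g`, that is, `z f` composed with `g`. -/
lemma shiftOp_symComp {β : M →ₗ[F] N →ₗ[F] P} {D : N →ₗ[F] N} {DM : M →ₗ[F] M} {DP : P →ₗ[F] P}
    (h : ∀ x y, DP (β x y) = β (DM x) y + β x (D y)) (f : InvLaurent F M) (g : InvLaurent F N) :
    shiftOp DP (symComp β D f g) = symComp β D (shiftOp DM f) g := by
  rw [shiftOp_apply, mapCoeff_symComp_add DP β D DM LinearMap.id β D LinearMap.id D (fun _ => rfl)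
    (fun _ => rfl) h f g, ← symComp_mulVar_right, mapCoeff_id, mapCoeff_id, shiftOp_apply, map_add,
    LinearMap.add_apply, symComp_mulVar_left, shiftOp_apply, map_add]
  abel

variable (F) in
/-- The series `z⁻¹`. -/
def invVar : InvLaurent F F := monomial (-1) 1

lemma mulVar_invVar : mulVar (invVar F) = const (1 : F) := by
  rw [invVar, mulVar_monomial]
  exact InvLaurent.ext fun n => rfl

/-- The operator `(z + D)⁻¹`. -/
def shiftOpInv (D : N →ₗ[F] N) : InvLaurent F N →ₗ[F] InvLaurent F N :=
  symComp (LinearMap.lsmul F N) D (invVar F)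

lemma shiftOp_shiftOpInv (D : N →ₗ[F] N) (g : InvLaurent F N) :
    shiftOp D (shiftOpInv D g) = g := by
  have h0 : mapCoeff (0 : F →ₗ[F] F) (invVar F) = 0 := rfl
  rw [shiftOpInv, shiftOp_symComp (DM := 0) (by simp), shiftOp_apply, h0, add_zero, mulVar_invVar,
    symComp_const_left]
  exact InvLaurent.ext fun n => one_smul _ _

lemma shiftOpInv_shiftOp (D : N →ₗ[F] N) (g : InvLaurent F N) :
    shiftOpInv D (shiftOp D g) = g := by
  rw [shiftOpInv, ← symComp_mulVar_left, mulVar_invVar, symComp_const_left]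
  exact InvLaurent.ext fun n => one_smul _ _

/-- In proofs by `eq_of_const`, multiplying `f` by `z` replaces another argument `g` by `(z + D) g`.
Surjectivity says that every argument has this form, so one can return from `z f` to `f`. -/
lemma shiftOp_surjective (D : N →ₗ[F] N) : Function.Surjective (shiftOp D) :=
  fun g => ⟨_, shiftOp_shiftOpInv D g⟩

lemma shiftOp_injective (D : N →ₗ[F] N) : Function.Injective (shiftOp D) :=
  Function.LeftInverse.injective (shiftOpInv_shiftOp D)

/-- The general associativity of the composition of symbols. -/
theorem symComp_assoc {M₁ M₂ M₃ M₁₂ M₂₃ : Type*} [AddCommGroup M₁] [Module F M₁] [AddCommGroup M₂]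
    [Module F M₂] [AddCommGroup M₃] [Module F M₃] [AddCommGroup M₁₂] [Module F M₁₂]
    [AddCommGroup M₂₃] [Module F M₂₃]
    {β₁₂ : M₁ →ₗ[F] M₂ →ₗ[F] M₁₂} {γ : M₁₂ →ₗ[F] M₃ →ₗ[F] P} {β₂₃ : M₂ →ₗ[F] M₃ →ₗ[F] M₂₃}
    {δ : M₁ →ₗ[F] M₂₃ →ₗ[F] P} {D₂ : M₂ →ₗ[F] M₂} {D₃ : M₃ →ₗ[F] M₃} {D₂₃ : M₂₃ →ₗ[F] M₂₃}
    (hD : ∀ y z, D₂₃ (β₂₃ y z) = β₂₃ (D₂ y) z + β₂₃ y (D₃ z))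
    (hβ : ∀ x y z, γ (β₁₂ x y) z = δ x (β₂₃ y z))
    (f : InvLaurent F M₁) (g : InvLaurent F M₂) (h : InvLaurent F M₃) :
    symComp γ D₃ (symComp β₁₂ D₂ f g) h = symComp δ D₂₃ f (symComp β₂₃ D₃ g h) := by
  refine eq_of_const (ι := InvLaurent F M₂ × InvLaurent F M₃)
    (fun i => (symComp γ D₃).flip i.2 ∘ₗ (symComp β₁₂ D₂).flip i.1)
    (fun i => (symComp δ D₂₃).flip (symComp β₂₃ D₃ i.1 i.2)) ?_ ?_ ?_ ?_ (g, h) f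
  · rintro ⟨g, h⟩
    obtain ⟨A, hA⟩ := exists_degreeLE g
    obtain ⟨B, hB⟩ := exists_degreeLE h
    exact ⟨A + B, fun K f hf => by
      simpa [add_assoc] using (hf.symComp hA β₁₂ D₂).symComp hB γ D₃⟩
  · rintro ⟨g, h⟩
    obtain ⟨A, hA⟩ := exists_degreeLE (symComp β₂₃ D₃ g h)
    exact ⟨A, fun K f hf => hf.symComp hA δ D₂₃⟩
  · rintro ⟨g, h⟩ a
    simp only [LinearMap.comp_apply, LinearMap.flip_apply, symComp_const_left]
    exact (mapCoeff_symComp_left (δ a) γ (β₁₂ a) (fun y z => (hβ a y z).symm) g h).symm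
  -- A factor `z` on `f` becomes `z + D₂` on `g` on the left and `z + D₂₃` on the product on the
  -- right, which by Leibniz is again `z + D₂` on `g`.
  · intro f
    simp only [LinearMap.comp_apply, LinearMap.flip_apply, symComp_mulVar_left, Prod.forall,
      shiftOp_symComp hD]
    constructor
    · exact fun H g h => H _ h
    · intro H g h
      obtain ⟨g, rfl⟩ := shiftOp_surjective D₂ g
      exact H g h

lemma arrow_apply (β : M →ₗ[F] N →ₗ[F] P) (D : N →ₗ[F] N) (f : InvLaurent F M) (x : N) :
    arrow β D f x = symComp β D f (const x) := rfl

lemma arrow_mulVar (β : M →ₗ[F] N →ₗ[F] P) (D : N →ₗ[F] N) (f : InvLaurent F M) (x : N) :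
    arrow β D (mulVar f) x = mulVar (arrow β D f x) + arrow β D f (D x) := by
  rw [arrow_apply, symComp_mulVar_left, shiftOp_apply, map_add, symComp_mulVar_right,
    mapCoeff_const]
  rfl

lemma arrow_const (β : M →ₗ[F] N →ₗ[F] P) (D : N →ₗ[F] N) (a : M) (x : N) :
    arrow β D (const a) x = const (β a x) := by
  rw [arrow_apply, symComp_const_left, mapCoeff_const]

lemma mapCoeff_arrow (φ : P →ₗ[F] P') {β : M →ₗ[F] N →ₗ[F] P} {D : N →ₗ[F] N}
    (β' : M' →ₗ[F] N' →ₗ[F] P') (D' : N' →ₗ[F] N') (a : M →ₗ[F] M') (b : N →ₗ[F] N')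
    (hb : ∀ y, b (D y) = D' (b y)) (h : ∀ x y, φ (β x y) = β' (a x) (b y))
    (f : InvLaurent F M) (y : N) :
    mapCoeff φ (arrow β D f y) = arrow β' D' (mapCoeff a f) (b y) := by
  rw [arrow_apply, mapCoeff_symComp φ β' D' a b hb h, mapCoeff_const]
  rfl

/-- Two successive insertions of elements amount to the insertion of a tensor. -/
lemma arrow_arrow {M₂ M₃ M₁₂ : Type*} [AddCommGroup M₂]
    [Module F M₂] [AddCommGroup M₃] [Module F M₃] [AddCommGroup M₁₂] [Module F M₁₂]
    (β : M →ₗ[F] M₂ →ₗ[F] M₁₂) (γ : M₁₂ →ₗ[F] M₃ →ₗ[F] P) (δ : M →ₗ[F] N →ₗ[F] P)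
    (τ : M₂ →ₗ[F] M₃ →ₗ[F] N)
    {D₂ : M₂ →ₗ[F] M₂} {D₃ : M₃ →ₗ[F] M₃} {D : N →ₗ[F] N}
    (hD : ∀ y z, D (τ y z) = τ (D₂ y) z + τ y (D₃ z))
    (h : ∀ x y z, γ (β x y) z = δ x (τ y z))
    (f : InvLaurent F M) (y : M₂) (z : M₃) :
    arrow γ D₃ (arrow β D₂ f y) z = arrow δ D f (τ y z) := by
  rw [arrow_apply, arrow_apply, arrow_apply, symComp_assoc hD h, symComp_const_left,
    mapCoeff_const]

lemma symComp_arrow {M₁ M₂ M₃ M₁₂ M₂₃ : Type*} [AddCommGroup M₁] [Module F M₁] [AddCommGroup M₂]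
    [Module F M₂] [AddCommGroup M₃] [Module F M₃] [AddCommGroup M₁₂] [Module F M₁₂]
    [AddCommGroup M₂₃] [Module F M₂₃]
    {β₁₂ : M₁ →ₗ[F] M₂ →ₗ[F] M₁₂} {γ : M₁₂ →ₗ[F] M₃ →ₗ[F] P} {β₂₃ : M₂ →ₗ[F] M₃ →ₗ[F] M₂₃}
    {δ : M₁ →ₗ[F] M₂₃ →ₗ[F] P} {D₂ : M₂ →ₗ[F] M₂} {D₃ : M₃ →ₗ[F] M₃} {D₂₃ : M₂₃ →ₗ[F] M₂₃}
    (hD : ∀ y z, D₂₃ (β₂₃ y z) = β₂₃ (D₂ y) z + β₂₃ y (D₃ z))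
    (hβ : ∀ x y z, γ (β₁₂ x y) z = δ x (β₂₃ y z))
    (f : InvLaurent F M₁) (g : InvLaurent F M₂) (z : M₃) :
    arrow γ D₃ (symComp β₁₂ D₂ f g) z = symComp δ D₂₃ f (arrow β₂₃ D₃ g z) :=
  symComp_assoc hD hβ f g (const z)

end SymbolCalculus

/-! ### The substitution `z ↦ -z - D` -/

section Adjoint

variable {F : Type*} [Field F]
variable {M : Type*} [AddCommGroup M] [Module F M]
variable {N : Type*} [AddCommGroup N] [Module F N]
variable {P : Type*} [AddCommGroup P] [Module F P]

lemma substNeg_coeff (D : M →ₗ[F] M) (f : InvLaurent F M) (m : ℤ) : (substNeg D f).1 m =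
    ∑ᶠ j : ℕ, (((m + j).negOnePow : ℤˣ) : ℤ) • Ring.choose (m + j : ℤ) j •
      (D ^ j) (f.1 (m + j)) := rfl

lemma finite_of_eq_zero_of_lt {K m : ℤ} (G : ℕ → M) (hG : ∀ j : ℕ, K < m + j → G j = 0) :
    (Function.support G).Finite := by
  refine (Finset.range ((K - m).toNat + 1)).finite_toSet.subset fun j hj => ?_
  rw [Function.mem_support] at hj
  have : ¬ K < m + j := fun h => hj (hG j h)
  simp only [Finset.mem_coe, Finset.mem_range]
  omega

lemma finite_substNeg (D : M →ₗ[F] M) (f : InvLaurent F M) (m : ℤ) :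
    (Function.support fun j : ℕ => (((m + j).negOnePow : ℤˣ) : ℤ) •
      Ring.choose (m + j : ℤ) j • (D ^ j) (f.1 (m + j))).Finite := by
  obtain ⟨K, hK⟩ := f.2
  exact finite_of_eq_zero_of_lt (K := K) (m := m) _ fun j hj => by simp [hK _ hj]

/-- `substNeg` as a linear map. -/
def substNegₗ (D : M →ₗ[F] M) : InvLaurent F M →ₗ[F] InvLaurent F M where
  toFun := substNeg D
  map_add' f g := InvLaurent.ext fun m => by
    rw [InvLaurent.add_coeff, substNeg_coeff, substNeg_coeff, substNeg_coeff,
      ← finsum_add_distrib (finite_substNeg D f m) (finite_substNeg D g m)]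
    simp
  map_smul' c f := InvLaurent.ext fun m => by
    rw [RingHom.id_apply, InvLaurent.smul_coeff, substNeg_coeff, substNeg_coeff,
      smul_finsum' c (finite_substNeg D f m)]
    simp [smul_comm c]

@[simp]
lemma substNegₗ_apply (D : M →ₗ[F] M) (f : InvLaurent F M) : substNegₗ D f = substNeg D f := rfl

lemma DegreeLE.substNeg {K : ℤ} {f : InvLaurent F M} (hf : DegreeLE K f) (D : M →ₗ[F] M) :
    DegreeLE K (substNeg D f) := fun m hm => by
  rw [substNeg_coeff]
  refine finsum_eq_zero_of_forall_eq_zero fun j => ?_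
  rw [hf (m + j) (by omega)]
  simp

lemma mapCoeff_substNeg (φ : M →ₗ[F] N) {D : M →ₗ[F] M} {D' : N →ₗ[F] N}
    (h : ∀ x, φ (D x) = D' (φ x)) (f : InvLaurent F M) :
    mapCoeff φ (substNeg D f) = substNeg D' (mapCoeff φ f) := by
  have p : ∀ (j : ℕ) y, φ ((D ^ j) y) = (D' ^ j) (φ y) := fun j y => by
    induction j with
    | zero => rfl
    | succ j ih => rw [pow_succ', pow_succ', Module.End.mul_apply, h, ih, Module.End.mul_apply]
  refine InvLaurent.ext fun m => ?_
  rw [mapCoeff_coeff, substNeg_coeff, substNeg_coeff]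
  refine (φ.toAddMonoidHom.map_finsum (finite_substNeg D f m)).trans (finsum_congr fun j => ?_)
  simp [p]

lemma substNeg_const (D : M →ₗ[F] M) (x : M) : substNeg D (const x) = const x := by
  refine InvLaurent.ext fun m => ?_
  rw [substNeg_coeff, finsum_eq_single _ 0]
  · by_cases h : m = 0 <;> simp [const_coeff, h]
  · intro j hj
    rw [const_coeff]
    split_ifs with h
    · rw [h, ← Nat.succ_pred_eq_of_ne_zero hj, Nat.succ_eq_add_one, Ring.choose_zero_succ]
      simp
    · simp

/-- The reason is `(-z-D)^(n+1) = -(z+D)(-z-D)^n`. On coefficients this is Pascal's rule, the sign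
coming from the change of parity. -/
lemma substNeg_mulVar (D : M →ₗ[F] M) (f : InvLaurent F M) :
    substNeg D (mulVar f) = -shiftOp D (substNeg D f) := by
  refine InvLaurent.ext fun m => ?_
  obtain ⟨K, hK⟩ := f.2
  let G : ℕ → M := fun j => (((m + j).negOnePow : ℤˣ) : ℤ) • (D ^ j) (f.1 (m + j - 1))
  let w : ℕ → ℤ := fun j => match j with
    | 0 => 0
    | j + 1 => Ring.choose (m + j : ℤ) j
  have hfin : ∀ v : ℕ → ℤ, (Function.support fun j => v j • G j).Finite := fun v =>
    finite_of_eq_zero_of_lt (K := K) (m := m - 1) _ fun j hj => by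
      simp [G, hK (m + j - 1) (by omega)]
  have h1 : (substNeg D (mulVar f)).1 m =
      ∑ᶠ j : ℕ, (Ring.choose (m - 1 + j : ℤ) j • G j + w j • G j) := by
    rw [substNeg_coeff]
    refine finsum_congr fun j => ?_
    rw [mulVar_coeff, ← add_smul, smul_comm]
    refine congrArg₂ (· • ·) ?_ rfl
    cases j with
    | zero => simp [w]
    | succ j =>
      simp only [w]
      rw [show m + ((j + 1 : ℕ) : ℤ) = m + j + 1 by push_cast; ring, Ring.choose_succ_succ,
        show m - 1 + ((j + 1 : ℕ) : ℤ) = m + j by push_cast; ring, add_comm]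
  have h2 : ∑ᶠ j : ℕ, w j • G j = ∑ᶠ j : ℕ, Ring.choose (m + j : ℤ) j • G (j + 1) := by
    have hinj : Function.Injective fun j : ℕ => j + 1 := fun a b h => by simpa using h
    have h := finsum_mem_range (f := fun j => w j • G j) hinj
    rw [finsum_mem_def, Set.indicator_eq_self.2] at h
    · exact h
    · intro j hx
      cases j with
      | zero => exact absurd (zero_smul ℤ (G 0)) hx
      | succ j => exact ⟨j, rfl⟩
  have h3 : (substNeg D f).1 (m - 1) = -∑ᶠ j : ℕ, Ring.choose (m - 1 + j : ℤ) j • G j := by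
    rw [substNeg_coeff, ← finsum_neg_distrib]
    refine finsum_congr fun j => ?_
    simp only [G]
    rw [smul_comm, show m + (j : ℤ) = m - 1 + j + 1 by ring, Int.negOnePow_succ,
      add_sub_cancel_right]
    simp
  have h4 : (mapCoeff D (substNeg D f)).1 m =
      -∑ᶠ j : ℕ, Ring.choose (m + j : ℤ) j • G (j + 1) := by
    rw [mapCoeff_coeff, substNeg_coeff, ← finsum_neg_distrib]
    refine (D.toAddMonoidHom.map_finsum (finite_substNeg D f m)).trans (finsum_congr fun j => ?_)
    simp only [G]
    rw [show m + ((j + 1 : ℕ) : ℤ) = m + j + 1 by push_cast; ring, Int.negOnePow_succ,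
      add_sub_cancel_right, pow_succ', smul_comm (Ring.choose _ _)]
    simp
  rw [h1, finsum_add_distrib (hfin _) (hfin w), h2, InvLaurent.neg_coeff, shiftOp_apply,
    InvLaurent.add_coeff, mulVar_coeff, h3, h4]
  abel

lemma substNeg_add (D : M →ₗ[F] M) (f g : InvLaurent F M) :
    substNeg D (f + g) = substNeg D f + substNeg D g := map_add (substNegₗ D) f g

/-- Under the substitution `z + D` goes to `(-z - D) + D = -z`. -/
lemma substNeg_shiftOp (D : M →ₗ[F] M) (f : InvLaurent F M) :
    substNeg D (shiftOp D f) = -mulVar (substNeg D f) := by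
  rw [shiftOp_apply, substNeg_add, substNeg_mulVar, ← mapCoeff_substNeg D (fun _ => rfl),
    shiftOp_apply]
  abel

/-- The substitution `z ↦ -z - D` reverses the order of compositions. -/
theorem substNeg_symComp {β : M →ₗ[F] N →ₗ[F] P} {DM : M →ₗ[F] M} {DN : N →ₗ[F] N}
    {DP : P →ₗ[F] P} (h : ∀ x y, DP (β x y) = β (DM x) y + β x (DN y))
    (f : InvLaurent F M) (g : InvLaurent F N) :
    substNeg DP (symComp β DN f g) = symComp β.flip DM (substNeg DN g) (substNeg DM f) := by
  have hflip : ∀ y x, DP (β.flip y x) = β.flip (DN y) x + β.flip y (DM x) := fun y x => by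
    simp [h, add_comm]
  -- For a constant first factor the induction is on `g`; both sides acquire the injective operator
  -- `-(z + DP)`, so `a` does not move. A general `f` is then reduced to this case with `g` as the
  -- moving index.
  have hc : ∀ (a : M) (g : InvLaurent F N), substNeg DP (symComp β DN (const a) g) =
      symComp β.flip DM (substNeg DN g) (const a) := by
    intro a g
    refine eq_of_const (ι := M)
      (fun a => substNegₗ DP ∘ₗ symComp β DN (const a))
      (fun a => (symComp β.flip DM).flip (const a) ∘ₗ substNegₗ DN) ?_ ?_ ?_ ?_ a g
    · exact fun a => ⟨0, fun K g hg => by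
        have := ((degreeLE_const (F := F) a).symComp hg β DN).substNeg DP
        rwa [zero_add, ← add_zero K] at this⟩
    · exact fun a => ⟨0, fun K g hg => (hg.substNeg DN).symComp (degreeLE_const a) β.flip DM⟩
    · intro a b
      simp only [LinearMap.comp_apply, LinearMap.flip_apply, substNegₗ_apply, symComp_const_left,
        mapCoeff_const, substNeg_const]
    · intro g
      simp only [LinearMap.comp_apply, LinearMap.flip_apply, substNegₗ_apply,
        symComp_mulVar_right, substNeg_mulVar, map_neg,
        ← shiftOp_symComp hflip, neg_inj, (shiftOp_injective DP).eq_iff]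
  refine eq_of_const (ι := InvLaurent F N)
    (fun g => substNegₗ DP ∘ₗ (symComp β DN).flip g)
    (fun g => symComp β.flip DM (substNeg DN g) ∘ₗ substNegₗ DM) ?_ ?_ ?_ ?_ g f
  · intro g
    obtain ⟨A, hA⟩ := exists_degreeLE g
    exact ⟨A, fun K f hf => (hf.symComp hA β DN).substNeg DP⟩
  · intro g
    obtain ⟨A, hA⟩ := exists_degreeLE g
    exact ⟨A, fun K f hf => by
      have := (hA.substNeg DN).symComp (hf.substNeg DM) β.flip DM
      rwa [add_comm] at this⟩
  · intro g a
    simp only [LinearMap.comp_apply, LinearMap.flip_apply, substNegₗ_apply, hc, substNeg_const]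
  · intro f
    have key : ∀ g, symComp β.flip DM (substNeg DN g) (substNeg DM (mulVar f)) =
        symComp β.flip DM (substNeg DN (shiftOp DN g)) (substNeg DM f) := fun g => by
      rw [substNeg_mulVar, map_neg, ← symComp_mulVar_left, substNeg_shiftOp, map_neg,
        LinearMap.neg_apply]
    simp only [LinearMap.comp_apply, LinearMap.flip_apply, substNegₗ_apply, symComp_mulVar_left,
      key]
    constructor
    · exact fun H g => H _
    · intro H g
      obtain ⟨g, rfl⟩ := shiftOp_surjective DN g
      exact H g

end Adjoint

/-! ### Derivations and inverse matrices -/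

section DerivationInverse

variable {F : Type*} [Field F]
variable {M : Type*} [AddCommGroup M] [Module F M]
variable {N : Type*} [AddCommGroup N] [Module F N]
variable {P : Type*} [AddCommGroup P] [Module F P]

/-- Only the terms without derivatives survive; this is applied to the unit `1 ⊗ 1`. -/
lemma symComp_const_right (β : M →ₗ[F] N →ₗ[F] P) {D : N →ₗ[F] N} {e : N} (he : D e = 0)
    (f : InvLaurent F M) : symComp β D f (const e) = mapCoeff (β.flip e) f := by
  refine InvLaurent.ext fun m => ?_
  rw [symComp_coeff, finsum_eq_single _ ((0 : ℕ), m)]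
  · simp [const_coeff]
  · rintro ⟨j, n⟩ h
    simp only [const_coeff]
    cases j with
    | zero =>
      rw [if_neg (fun h' => h (by simp at h' ⊢; omega))]
      simp
    | succ j =>
      split_ifs
      · simp [pow_succ, he]
      · simp

/-- The value of a derivation on `p - q E r`, where `E` is the inverse of the matrix `C`. -/
theorem derivation_sub_sandwich {K U : Type*} [AddCommGroup K] [Module F K] [AddCommGroup U]
    [Module F U] {mul : K →ₗ[F] K →ₗ[F] K} {lft : K →ₗ[F] U →ₗ[F] U} {rgt : U →ₗ[F] K →ₗ[F] U}
    {one : K} (hone : mul one one = one)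
    (hlft : ∀ f g X, lft (mul f g) X = lft f (lft g X))
    (hrgt : ∀ X f g, rgt X (mul f g) = rgt (rgt X f) g)
    (hlr : ∀ f X g, rgt (lft f X) g = lft f (rgt X g))
    (hlft_one : ∀ X, lft one X = X) (hrgt_one : ∀ X, rgt X one = X)
    {Δ : K →ₗ[F] U} (hΔ : ∀ f g, Δ (mul f g) = rgt (Δ f) g + lft f (Δ g))
    {m : ℕ} {C E : Fin m → Fin m → K}
    (hCE : ∀ i j, ∑ k, mul (C i k) (E k j) = if i = j then one else 0)
    (hEC : ∀ i j, ∑ k, mul (E i k) (C k j) = if i = j then one else 0)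
    (p : K) (q r : Fin m → K) :
    Δ (p - ∑ α, ∑ β, mul (q β) (mul (E β α) (r α))) =
      Δ p - ∑ β, rgt (Δ (q β)) (∑ α, mul (E β α) (r α)) -
        ∑ α, lft (∑ β, mul (q β) (E β α)) (Δ (r α)) +
        ∑ γ, ∑ δ, lft (∑ β, mul (q β) (E β γ)) (rgt (Δ (C γ δ)) (∑ α, mul (E δ α) (r α))) := by
  have hΔone : Δ one = 0 := by
    have h := hΔ one one
    rw [hone, hlft_one, hrgt_one] at h
    simpa using h
  have hsum : ∀ i j, ∑ k, (rgt (Δ (C i k)) (E k j) + lft (C i k) (Δ (E k j))) = 0 := by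
    intro i j
    have h := congrArg Δ (hCE i j)
    rw [map_sum] at h
    simp only [hΔ] at h
    rw [h]
    split_ifs
    · exact hΔone
    · exact map_zero Δ
  -- `C E = 1` gives `Δ(C) E + C Δ(E) = 0`; multiplying on the left by `E` and using `E C = 1`
  -- isolates `Δ(E)`.
  have hE : ∀ l j, Δ (E l j) = -∑ i, ∑ k, lft (E l i) (rgt (Δ (C i k)) (E k j)) := by
    intro l j
    have h : ∑ i, lft (E l i) (∑ k, (rgt (Δ (C i k)) (E k j) + lft (C i k) (Δ (E k j)))) = 0 :=
      Finset.sum_eq_zero fun i _ => by rw [hsum, map_zero]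
    have h2 : ∑ i, ∑ k, lft (E l i) (lft (C i k) (Δ (E k j))) = Δ (E l j) := by
      rw [Finset.sum_comm]
      have : ∀ k, ∑ i, lft (E l i) (lft (C i k) (Δ (E k j))) = if l = k then Δ (E k j) else 0 := by
        intro k
        simp only [← hlft]
        rw [← LinearMap.sum_apply, ← map_sum, hEC]
        split_ifs
        · exact hlft_one _
        · simp
      simp [this]
    simp only [map_sum, map_add, Finset.sum_add_distrib] at h
    rw [h2] at h
    exact (neg_eq_of_add_eq_zero_right h).symm
  have hterm : ∀ α β, Δ (mul (q β) (mul (E β α) (r α))) =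
      rgt (Δ (q β)) (mul (E β α) (r α)) + lft (mul (q β) (E β α)) (Δ (r α)) -
        ∑ γ, ∑ δ, lft (mul (q β) (E β γ)) (rgt (Δ (C γ δ)) (mul (E δ α) (r α))) := by
    intro α β
    rw [hΔ, hΔ, hE]
    simp only [map_neg, map_sum, LinearMap.neg_apply, LinearMap.sum_apply, map_add, hlft, hlr,
      hrgt]
    abel
  -- Only the order of the four summations changes.
  have hlast : ∑ γ, ∑ δ, lft (∑ β, mul (q β) (E β γ))
        (rgt (Δ (C γ δ)) (∑ α, mul (E δ α) (r α))) =
      ∑ α, ∑ β, ∑ γ, ∑ δ, lft (mul (q β) (E β γ)) (rgt (Δ (C γ δ)) (mul (E δ α) (r α))) := by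
    simp only [map_sum, LinearMap.sum_apply]
    calc _ = ∑ γ, ∑ α, ∑ β, ∑ δ, lft (mul (q β) (E β γ))
          (rgt (Δ (C γ δ)) (mul (E δ α) (r α))) := by
          refine Finset.sum_congr rfl fun γ _ => ?_
          rw [Finset.sum_comm]
          refine Finset.sum_congr rfl fun α _ => ?_
          rw [Finset.sum_comm]
      _ = _ := by
          rw [Finset.sum_comm]
          refine Finset.sum_congr rfl fun α _ => ?_
          rw [Finset.sum_comm]
  have hfirst : ∑ β, rgt (Δ (q β)) (∑ α, mul (E β α) (r α)) =
      ∑ α, ∑ β, rgt (Δ (q β)) (mul (E β α) (r α)) := by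
    simp only [map_sum]
    rw [Finset.sum_comm]
  rw [hlast, hfirst, map_sub, map_sum]
  simp only [map_sum, hterm, LinearMap.sum_apply, Finset.sum_add_distrib, Finset.sum_sub_distrib]
  abel

end DerivationInverse

/-! ### The algebra `(V ⊗ V, •)` and its flip -/

section DiracBracket

variable {F : Type*} [Field F]
variable {V : Type*} [Ring V] [Algebra F V]

@[simp]
lemma bullet_tmul (a b c e : V) :
    bullet F V (a ⊗ₜ b) (c ⊗ₜ e) = (a * c) ⊗ₜ[F] (e * b) := rfl

@[simp]
lemma tensorDer_tmul (d : V →ₗ[F] V) (a b : V) :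
    tensorDer d (a ⊗ₜ[F] b) = d a ⊗ₜ b + a ⊗ₜ d b := rfl

@[simp]
lemma outerLeft_tmul (c a b : V) : outerLeft c (a ⊗ₜ[F] b) = (c * a) ⊗ₜ b := rfl

@[simp]
lemma outerRight_tmul (c a b : V) : outerRight c (a ⊗ₜ[F] b) = a ⊗ₜ (b * c) := rfl

@[simp]
lemma starRight_tmul (a b c : V) : starRight F V (a ⊗ₜ[F] b) c = (a * c) ⊗ₜ b := rfl

@[simp]
lemma starLeft_tmul (a b c : V) : starLeft F V (a ⊗ₜ[F] b) c = a ⊗ₜ (c * b) := rfl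

lemma bullet_assoc (x y z : V ⊗[F] V) :
    bullet F V (bullet F V x y) z = bullet F V x (bullet F V y z) := by
  induction x with
  | zero => simp
  | add x x' hx hx' => simp only [map_add, LinearMap.add_apply, hx, hx']
  | tmul a b =>
    induction y with
    | zero => simp
    | add y y' hy hy' => simp only [map_add, LinearMap.add_apply, hy, hy']
    | tmul c e =>
      induction z with
      | zero => simp
      | add z z' hz hz' => simp only [map_add, hz, hz']
      | tmul u v => simp [mul_assoc]

lemma one_bullet (x : V ⊗[F] V) : bullet F V (1 ⊗ₜ 1) x = x := by
  induction x with
  | zero => simp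
  | add x x' hx hx' => simp only [map_add, hx, hx']
  | tmul a b => simp

lemma bullet_one (x : V ⊗[F] V) : bullet F V x (1 ⊗ₜ 1) = x := by
  induction x with
  | zero => simp
  | add x x' hx hx' => simp only [map_add, LinearMap.add_apply, hx, hx']
  | tmul a b => simp

lemma derivation_one {d : V →ₗ[F] V} (hd : ∀ a b, d (a * b) = d a * b + a * d b) : d 1 = 0 := by
  have h := hd 1 1
  simpa using h

lemma tensorDer_one {d : V →ₗ[F] V} (hd : ∀ a b, d (a * b) = d a * b + a * d b) :
    tensorDer d (1 ⊗ₜ[F] 1) = 0 := by simp [derivation_one hd]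

lemma tensorDer_bullet {d : V →ₗ[F] V} (hd : ∀ a b, d (a * b) = d a * b + a * d b)
    (x y : V ⊗[F] V) : tensorDer d (bullet F V x y) =
      bullet F V (tensorDer d x) y + bullet F V x (tensorDer d y) := by
  induction x with
  | zero => simp
  | add x x' hx hx' =>
    simp only [map_add, LinearMap.add_apply, hx, hx']
    abel
  | tmul a b =>
    induction y with
    | zero => simp
    | add y y' hy hy' =>
      simp only [map_add, hy, hy']
      abel
    | tmul c e =>
      simp only [bullet_tmul, tensorDer_tmul, hd, map_add, LinearMap.add_apply,
        TensorProduct.tmul_add, TensorProduct.add_tmul]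
      abel

/-- The flip `σ(a ⊗ b) = b ⊗ a`. -/
def flipTensor (F V : Type*) [Field F] [Ring V] [Algebra F V] : V ⊗[F] V →ₗ[F] V ⊗[F] V :=
  (TensorProduct.comm F V V).toLinearMap

@[simp]
lemma flipTensor_tmul (a b : V) : flipTensor F V (a ⊗ₜ b) = b ⊗ₜ a := rfl

/-- The product `•` multiplies the second factors in the opposite order, so exchanging the factors
reverses it. -/
lemma flipTensor_bullet (x y : V ⊗[F] V) : flipTensor F V (bullet F V x y) =
    bullet F V (flipTensor F V y) (flipTensor F V x) := by
  induction x with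
  | zero => simp
  | add x x' hx hx' => simp only [map_add, LinearMap.add_apply, hx, hx']
  | tmul a b =>
    induction y with
    | zero => simp
    | add y y' hy hy' => simp only [map_add, LinearMap.add_apply, hy, hy']
    | tmul c e => simp

lemma flipTensor_tensorDer (d : V →ₗ[F] V) (x : V ⊗[F] V) :
    flipTensor F V (tensorDer d x) = tensorDer d (flipTensor F V x) := by
  induction x with
  | zero => simp
  | add x x' hx hx' => simp only [map_add, hx, hx']
  | tmul a b => simp [add_comm]

/-! ### Symbols, adjoints and elementary properties of the Dirac modification -/

variable {d : V →ₗ[F] V}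

lemma symMul_assoc (hd : ∀ a b, d (a * b) = d a * b + a * d b)
    (f g h : InvLaurent F (V ⊗[F] V)) :
    symMul d (symMul d f g) h = symMul d f (symMul d g h) :=
  symComp_assoc (tensorDer_bullet hd) bullet_assoc f g h

lemma one_symMul (f : InvLaurent F (V ⊗[F] V)) : symMul d (const (1 ⊗ₜ 1)) f = f := by
  rw [symMul, symComp_const_left]
  exact InvLaurent.ext fun n => one_bullet _

lemma symMul_one (hd : ∀ a b, d (a * b) = d a * b + a * d b) (f : InvLaurent F (V ⊗[F] V)) :
    symMul d f (const (1 ⊗ₜ 1)) = f := by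
  rw [symMul, symComp_const_right _ (tensorDer_one hd)]
  exact InvLaurent.ext fun n => bullet_one _

/-- The adjoint `f(∂)*` of a pseudodifferential operator, with symbol `f(-λ-∂)^σ`. -/
def adj (d : V →ₗ[F] V) : InvLaurent F (V ⊗[F] V) →ₗ[F] InvLaurent F (V ⊗[F] V) :=
  mapCoeff (flipTensor F V) ∘ₗ substNegₗ (tensorDer d)

lemma adj_apply (f : InvLaurent F (V ⊗[F] V)) :
    adj d f = mapCoeff (flipTensor F V) (substNeg (tensorDer d) f) := rfl

lemma adj_const (x : V ⊗[F] V) : adj d (const x) = const (flipTensor F V x) := by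
  rw [adj_apply, substNeg_const, mapCoeff_const]

lemma adj_mulVar (f : InvLaurent F (V ⊗[F] V)) :
    adj d (mulVar f) = -shiftOp (tensorDer d) (adj d f) := by
  rw [adj_apply, substNeg_mulVar, map_neg, neg_inj, adj_apply]
  exact InvLaurent.ext fun n => by simp [shiftOp_apply, flipTensor_tensorDer]

lemma DegreeLE.adj {K : ℤ} {f : InvLaurent F (V ⊗[F] V)} (hf : DegreeLE K f) :
    DegreeLE K (adj d f) := (hf.substNeg _).mapCoeff _

/-- The substitution `λ ↦ -λ-∂` reverses the order of the symbols but leaves each coefficient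
product as it was; the flip then reverses the coefficient products. -/
lemma adj_symMul (hd : ∀ a b, d (a * b) = d a * b + a * d b) (f g : InvLaurent F (V ⊗[F] V)) :
    adj d (symMul d f g) = symMul d (adj d g) (adj d f) := by
  rw [adj_apply, symMul, substNeg_symComp (tensorDer_bullet hd)]
  exact mapCoeff_symComp _ _ _ _ _ (flipTensor_tensorDer d)
    (fun x y => flipTensor_bullet y x) _ _

variable {br : LambdaMap F V}

/-- In this form skewsymmetry shows at once that the matrix `C` is skewadjoint. -/
lemma isSkew_iff : IsSkew d br ↔ ∀ a b, adj d (br a b) = -br b a :=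
  ⟨fun h a b => by rw [h b a, neg_neg]; rfl, fun h a b => by
    rw [← neg_eq_iff_eq_neg, ← h b a]; rfl⟩

variable {m : ℕ} {θ : Fin m → V} {E : Matrix (Fin m) (Fin m) (InvLaurent F (V ⊗[F] V))}

lemma IsInverse.sum_left (hE : IsInverse d (constraintMatrix br θ) E) (i j : Fin m) :
    ∑ k, symMul d (br (θ k) (θ i)) (E k j) = if i = j then const (1 ⊗ₜ 1) else 0 :=
  congrFun (congrFun hE.1 i) j

lemma IsInverse.sum_right (hE : IsInverse d (constraintMatrix br θ) E) (i j : Fin m) :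
    ∑ k, symMul d (E i k) (br (θ j) (θ k)) = if i = j then const (1 ⊗ₜ 1) else 0 :=
  congrFun (congrFun hE.2 i) j

lemma matMul_assoc (hd : ∀ a b, d (a * b) = d a * b + a * d b)
    (A B C : Matrix (Fin m) (Fin m) (InvLaurent F (V ⊗[F] V))) :
    matMul d (matMul d A B) C = matMul d A (matMul d B C) := by
  ext1 i j
  simp only [matMul, map_sum, LinearMap.sum_apply, symMul_assoc hd]
  exact Finset.sum_comm

lemma matOne_matMul (A : Matrix (Fin m) (Fin m) (InvLaurent F (V ⊗[F] V))) :
    matMul d (matOne F V m) A = A := by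
  ext1 i j
  simp only [matMul, matOne]
  rw [Finset.sum_eq_single i (fun k _ hk => by simp [hk.symm]) (by simp), if_pos rfl, one_symMul]

lemma matMul_matOne (hd : ∀ a b, d (a * b) = d a * b + a * d b)
    (A : Matrix (Fin m) (Fin m) (InvLaurent F (V ⊗[F] V))) :
    matMul d A (matOne F V m) = A := by
  ext1 i j
  simp only [matMul, matOne]
  rw [Finset.sum_eq_single j (fun k _ hk => by simp [hk]) (by simp), if_pos rfl, symMul_one hd]

/-- The inverse of the skewadjoint matrix `C(∂)` is skewadjoint. -/
lemma adj_inverse (hd : ∀ a b, d (a * b) = d a * b + a * d b) (hs : IsSkew d br)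
    (hE : IsInverse d (constraintMatrix br θ) E) (i j : Fin m) :
    adj d (E i j) = -E j i := by
  rw [isSkew_iff] at hs
  -- The adjoint of `C E = 1` says that `G` is a left inverse of `C`, so `G = G C E = E`.
  let G : Matrix (Fin m) (Fin m) (InvLaurent F (V ⊗[F] V)) := fun i j => -adj d (E j i)
  have hG : matMul d G (constraintMatrix br θ) = matOne F V m := by
    ext1 k i
    have h := congrArg (adj d) (IsInverse.sum_left hE i k)
    simp only [map_sum, adj_symMul hd, hs, apply_ite (adj d), map_zero, adj_const,
      flipTensor_tmul] at h
    simp only [matMul, matOne, constraintMatrix, G]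
    simp only [map_neg, LinearMap.neg_apply] at h ⊢
    rw [h]
    simp only [eq_comm]
  have hGE : G = E := by
    rw [← matMul_matOne hd G, ← hE.1, ← matMul_assoc hd, hG, matOne_matMul]
  have h : -adj d (E i j) = E j i := congrFun (congrFun hGE j) i
  rw [← h, neg_neg]

/-- The adjoint reverses the triple product `q E r`. Each of its three factors contributes a sign,
leaving a single minus, and the summation indices exchange their roles. -/
lemma IsSkew.dirac (hd : ∀ a b, d (a * b) = d a * b + a * d b) (hs : IsSkew d br)
    (hE : IsInverse d (constraintMatrix br θ) E) : IsSkew d (dirac d br θ E) := by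
  have hs' := isSkew_iff.1 hs
  rw [isSkew_iff]
  intro a b
  simp only [dirac_apply, map_sub, map_sum, adj_symMul hd, hs', adj_inverse hd hs hE, map_neg,
    LinearMap.neg_apply, neg_neg, symMul_assoc hd]
  rw [Finset.sum_comm]
  simp only [Finset.sum_neg_distrib]
  abel

/-- For `b = θ i` the brackets on the left of the sandwich are a row of `C`, and `C E = 1` collapses
the correction to the bracket itself. -/
lemma dirac_constraint_right (hd : ∀ a b, d (a * b) = d a * b + a * d b)
    (hE : IsInverse d (constraintMatrix br θ) E) (a : V) (i : Fin m) :
    dirac d br θ E a (θ i) = 0 := by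
  rw [dirac_apply, sub_eq_zero]
  simp only [← symMul_assoc hd, ← LinearMap.sum_apply, ← map_sum, IsInverse.sum_left hE]
  rw [Finset.sum_eq_single i (fun k _ hk => by simp [hk.symm]) (by simp), if_pos rfl, one_symMul]

/-- Here the brackets on the right of the sandwich are a column of `C`, and `E C = 1` applies. -/
lemma dirac_constraint_left (hd : ∀ a b, d (a * b) = d a * b + a * d b)
    (hE : IsInverse d (constraintMatrix br θ) E) (a : V) (i : Fin m) :
    dirac d br θ E (θ i) a = 0 := by
  rw [dirac_apply, sub_eq_zero, Finset.sum_comm]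
  simp only [← map_sum, IsInverse.sum_right hE]
  rw [Finset.sum_eq_single i (fun k _ hk => by simp [hk]) (by simp), if_pos rfl, symMul_one hd]

/-- Insertion of elements by `⋆₁` in terms of the product of symbols. -/
lemma arrow_starRight (hd : ∀ a b, d (a * b) = d a * b + a * d b)
    (f : InvLaurent F (V ⊗[F] V)) (b : V) :
    arrow (starRight F V) d f b = symMul d f (const (b ⊗ₜ 1)) := by
  have h := mapCoeff_arrow (LinearMap.id : V ⊗[F] V →ₗ[F] V ⊗[F] V) (β := starRight F V) (D := d)
    (bullet F V) (tensorDer d) LinearMap.id ((TensorProduct.mk F V V).flip 1)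
    (fun y => by simp [derivation_one hd]) (fun x y => by
      induction x with
      | zero => simp
      | add x x' hx hx' => simp_all
      | tmul u v => simp) f b
  exact h

lemma arrow_starLeft (hd : ∀ a b, d (a * b) = d a * b + a * d b)
    (f : InvLaurent F (V ⊗[F] V)) (a : V) :
    arrow (starLeft F V) d f a = symMul d f (const (1 ⊗ₜ a)) := by
  have h := mapCoeff_arrow (LinearMap.id : V ⊗[F] V →ₗ[F] V ⊗[F] V) (β := starLeft F V) (D := d)
    (bullet F V) (tensorDer d) LinearMap.id (TensorProduct.mk F V V 1)
    (fun y => by simp [derivation_one hd]) (fun x y => by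
      induction x with
      | zero => simp
      | add x x' hx hx' => simp_all
      | tmul u v => simp) f a
  exact h

lemma outerRight_bullet (c : V) (x y : V ⊗[F] V) :
    outerRight c (bullet F V x y) = bullet F V (outerRight c x) y := by
  induction x with
  | zero => simp
  | add x x' hx hx' => simp only [map_add, LinearMap.add_apply, hx, hx']
  | tmul a b =>
    induction y with
    | zero => simp
    | add y y' hy hy' => simp only [map_add, hy, hy']
    | tmul u v => simp [mul_assoc]

lemma outerLeft_bullet (c : V) (x y : V ⊗[F] V) :
    outerLeft c (bullet F V x y) = bullet F V (outerLeft c x) y := by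
  induction x with
  | zero => simp
  | add x x' hx hx' => simp only [map_add, LinearMap.add_apply, hx, hx']
  | tmul a b =>
    induction y with
    | zero => simp
    | add y y' hy hy' => simp only [map_add, hy, hy']
    | tmul u v => simp [mul_assoc]

/-- The Dirac modification of a non-local 2-fold `λ`-bracket is a non-local 2-fold
`λ`-bracket. -/
lemma IsLambdaBracket.dirac (hd : ∀ a b, d (a * b) = d a * b + a * d b)
    (hb : IsLambdaBracket d br) (θ : Fin m → V)
    (E : Matrix (Fin m) (Fin m) (InvLaurent F (V ⊗[F] V))) :
    IsLambdaBracket d (dirac d br θ E) where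
  sesqui_left a b := by
    have h : ∀ f g : InvLaurent F (V ⊗[F] V), symMul d f (mulVarₗ F _ g) =
        mulVarₗ F _ (symMul d f g) := symComp_mulVar_right _ _
    simp only [dirac_apply, hb.sesqui_left, ← mulVarₗ_apply, map_neg, map_sub, map_sum, h,
      Finset.sum_neg_distrib]
    abel
  sesqui_right a b := by
    have h : ∀ f g : InvLaurent F (V ⊗[F] V), symMul d (shiftOp (tensorDer d) f) g =
        shiftOp (tensorDer d) (symMul d f g) :=
      fun f g => (shiftOp_symComp (tensorDer_bullet hd) f g).symm
    rw [← shiftOp_apply]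
    simp only [dirac_apply, hb.sesqui_right, ← shiftOp_apply, h, map_sub, map_sum]
  leibniz_right a b c := by
    have h1 : ∀ f g : InvLaurent F (V ⊗[F] V), symMul d (mapCoeff (outerRight c) f) g =
        mapCoeff (outerRight c) (symMul d f g) := fun f g =>
      (mapCoeff_symComp_left _ _ _ (outerRight_bullet c) f g).symm
    have h2 : ∀ f g : InvLaurent F (V ⊗[F] V), symMul d (mapCoeff (outerLeft b) f) g =
        mapCoeff (outerLeft b) (symMul d f g) := fun f g =>
      (mapCoeff_symComp_left _ _ _ (outerLeft_bullet b) f g).symm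
    simp only [dirac_apply, hb.leibniz_right, map_add, LinearMap.add_apply, h1, h2,
      Finset.sum_add_distrib, map_sub, map_sum]
    abel
  leibniz_left a b c := by
    -- The insertions by `⋆₁` are right multiplications by `b ⊗ 1` and `1 ⊗ a`, which pass through
    -- the sandwich by associativity.
    simp only [dirac_apply, hb.leibniz_left, arrow_starRight hd, arrow_starLeft hd, map_add,
      symMul_assoc hd, Finset.sum_add_distrib, map_sub, LinearMap.sub_apply, map_sum,
      LinearMap.sum_apply]
    abel

end DiracBracket

/-! ### Operators on series in three variables -/

section ThreeVariables

variable {F : Type*} [Field F]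
variable {A : Type*} [AddCommGroup A] [Module F A]
variable {M : Type*} [AddCommGroup M] [Module F M]
variable {N : Type*} [AddCommGroup N] [Module F N]

lemma Laurent₃.ext {X Y : Laurent₃ F M} (h : ∀ i j k, X.1 i j k = Y.1 i j k) : X = Y :=
  Subtype.ext (funext fun i => funext fun j => funext fun k => h i j k)

@[simp]
lemma Laurent₃.sub_coeff (X Y : Laurent₃ F M) (i j k : ℤ) :
    (X - Y).1 i j k = X.1 i j k - Y.1 i j k :=
  congrFun (congrFun (congrFun (Submodule.coe_sub (p := laurent₃Submodule F M) X Y) i) j) k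

/-- The exponents of the three variables are bounded by `a`, `b`, `c`. -/
def DegreesLE (a b c : ℤ) (X : Laurent₃ F M) : Prop :=
  ∀ i j k, a < i ∨ b < j ∨ c < k → X.1 i j k = 0

lemma exists_degreesLE (X : Laurent₃ F M) : ∃ K, DegreesLE K K K X := X.2

/-- Apply a linear map to all coefficients. -/
def mapCoeff₃ (φ : M →ₗ[F] N) : Laurent₃ F M →ₗ[F] Laurent₃ F N where
  toFun X := ⟨fun i j k => φ (X.1 i j k), by
    obtain ⟨K, hK⟩ := X.2
    exact ⟨K, fun i j k h => (congrArg φ (hK i j k h)).trans (map_zero φ)⟩⟩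
  map_add' X Y := Laurent₃.ext fun i j k => map_add φ (X.1 i j k) (Y.1 i j k)
  map_smul' c X := Laurent₃.ext fun i j k => map_smul φ c (X.1 i j k)

@[simp]
lemma mapCoeff₃_coeff (φ : M →ₗ[F] N) (X : Laurent₃ F M) (i j k : ℤ) :
    (mapCoeff₃ φ X).1 i j k = φ (X.1 i j k) := rfl

variable (F M) in
/-- Multiplication by the first variable. -/
def mulX : Laurent₃ F M →ₗ[F] Laurent₃ F M where
  toFun X := ⟨fun i j k => X.1 (i - 1) j k, by
    obtain ⟨K, hK⟩ := X.2
    exact ⟨K + 1, fun i j k h => hK _ _ _ (by omega)⟩⟩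
  map_add' _ _ := rfl
  map_smul' _ _ := rfl

variable (F M) in
/-- Multiplication by the second variable. -/
def mulY : Laurent₃ F M →ₗ[F] Laurent₃ F M where
  toFun X := ⟨fun i j k => X.1 i (j - 1) k, by
    obtain ⟨K, hK⟩ := X.2
    exact ⟨K + 1, fun i j k h => hK _ _ _ (by omega)⟩⟩
  map_add' _ _ := rfl
  map_smul' _ _ := rfl

variable (F M) in
/-- Multiplication by the third variable. -/
def mulZ : Laurent₃ F M →ₗ[F] Laurent₃ F M where
  toFun X := ⟨fun i j k => X.1 i j (k - 1), by
    obtain ⟨K, hK⟩ := X.2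
    exact ⟨K + 1, fun i j k h => hK _ _ _ (by omega)⟩⟩
  map_add' _ _ := rfl
  map_smul' _ _ := rfl

@[simp]
lemma mulX_coeff (X : Laurent₃ F M) (i j k : ℤ) : (mulX F M X).1 i j k = X.1 (i - 1) j k := rfl

@[simp]
lemma mulY_coeff (X : Laurent₃ F M) (i j k : ℤ) : (mulY F M X).1 i j k = X.1 i (j - 1) k := rfl

@[simp]
lemma mulZ_coeff (X : Laurent₃ F M) (i j k : ℤ) : (mulZ F M X).1 i j k = X.1 i j (k - 1) := rfl

lemma mulY_surjective : Function.Surjective (mulY F M) := fun X =>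
  ⟨⟨fun i j k => X.1 i (j + 1) k, by
    obtain ⟨K, hK⟩ := X.2
    exact ⟨K, fun i j k h => hK _ _ _ (by omega)⟩⟩,
    Laurent₃.ext fun i j k => congrArg (fun n => X.1 i n k) (by ring)⟩

lemma mulRel_eq (ε : ℤˣ) (X : Laurent₃ F M) :
    mulRel F ε X = mulZ F M X - mulX F M X - (ε : ℤ) • mulY F M X := by
  refine Laurent₃.ext fun i j k => ?_
  rw [Laurent₃.sub_coeff, Laurent₃.sub_coeff, mulRel_coeff]
  rfl

/-- The series in the third variable with given exponents of the others. -/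
def zLine (i j : ℤ) : Laurent₃ F M →ₗ[F] InvLaurent F M where
  toFun X := ⟨fun k => X.1 i j k, by
    obtain ⟨K, hK⟩ := X.2
    exact ⟨K, fun k h => hK _ _ _ (by omega)⟩⟩
  map_add' _ _ := rfl
  map_smul' _ _ := rfl

/-- The series in the first and third variables with given exponent of the second. -/
def xzPlane (j : ℤ) : Laurent₃ F M →ₗ[F] InvLaurent F (InvLaurent F M) where
  toFun X := ⟨fun i => zLine i j X, by
    obtain ⟨K, hK⟩ := X.2
    exact ⟨K, fun i h => InvLaurent.ext fun k => hK _ _ _ (by omega)⟩⟩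
  map_add' _ _ := rfl
  map_smul' _ _ := rfl

@[simp]
lemma zLine_coeff (i j k : ℤ) (X : Laurent₃ F M) : (zLine i j X).1 k = X.1 i j k := rfl

@[simp]
lemma xzPlane_coeff (i j : ℤ) (X : Laurent₃ F M) : (xzPlane j X).1 i = zLine i j X := rfl

lemma DegreesLE.symComp_zLine {a b c K : ℤ} {X : Laurent₃ F M} (hX : DegreesLE a b c X)
    {f : InvLaurent F A} (hf : DegreeLE K f) (ℓ : A →ₗ[F] M →ₗ[F] N) (δ : M →ₗ[F] M)
    (i j k : ℤ) (h : a < i ∨ b < j ∨ c + K < k) : (symComp ℓ δ f (zLine i j X)).1 k = 0 := by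
  by_cases h' : a < i ∨ b < j
  · have : zLine i j X = 0 := InvLaurent.ext fun k => hX _ _ _ (by omega)
    rw [this, map_zero]
    rfl
  · exact hf.symComp (B := c) (g := zLine i j X) (fun n hn => hX _ _ _ (by omega)) ℓ δ k
      (by omega)

/-- `f(z + δ) X`, with `δ` acting on the coefficients of `X`. -/
def leftZ (ℓ : A →ₗ[F] M →ₗ[F] N) (δ : M →ₗ[F] M) (f : InvLaurent F A) :
    Laurent₃ F M →ₗ[F] Laurent₃ F N where
  toFun X := ⟨fun i j k => (symComp ℓ δ f (zLine i j X)).1 k, by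
    obtain ⟨K, hK⟩ := exists_degreesLE X
    obtain ⟨L, hL⟩ := exists_degreeLE f
    exact ⟨max K (K + L), fun i j k h => hK.symComp_zLine hL ℓ δ i j k (by omega)⟩⟩
  map_add' X Y := Laurent₃.ext fun i j k => congrArg (fun f => f.1 k)
    (map_add (symComp ℓ δ f) (zLine i j X) (zLine i j Y))
  map_smul' c X := Laurent₃.ext fun i j k => congrArg (fun f => f.1 k)
    (map_smul (symComp ℓ δ f) c (zLine i j X))

lemma leftZ_coeff (ℓ : A →ₗ[F] M →ₗ[F] N) (δ : M →ₗ[F] M) (f : InvLaurent F A)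
    (X : Laurent₃ F M) (i j k : ℤ) :
    (leftZ ℓ δ f X).1 i j k = (symComp ℓ δ f (zLine i j X)).1 k := rfl

lemma DegreesLE.leftZ {a b c K : ℤ} {X : Laurent₃ F M} (hX : DegreesLE a b c X)
    {f : InvLaurent F A} (hf : DegreeLE K f) (ℓ : A →ₗ[F] M →ₗ[F] N) (δ : M →ₗ[F] M) :
    DegreesLE a b (c + K) (leftZ ℓ δ f X) := hX.symComp_zLine hf ℓ δ

lemma degreeLE_symComp_arrow {c : ℤ} {f : InvLaurent F (InvLaurent F M)}
    (hf : ∀ n, DegreeLE c (f.1 n)) (ρ : M →ₗ[F] A →ₗ[F] N) (D : A →ₗ[F] A)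
    (g : InvLaurent F A) (n : ℤ) : DegreeLE c ((symComp (arrow ρ D) D f g).1 n) := by
  intro k hk
  rw [symComp_coeff]
  refine ((coeffₗ k).toAddMonoidHom.map_finsum (finite_symComp (arrow ρ D) D f g n)).trans
    (finsum_eq_zero_of_forall_eq_zero fun x => ?_)
  have := (hf x.2).arrow ρ D ((D ^ x.1) (g.1 (n - x.2 + x.1))) k hk
  simp [this]

lemma DegreesLE.symComp_xzPlane {a b c K : ℤ} {X : Laurent₃ F M} (hX : DegreesLE a b c X)
    {g : InvLaurent F A} (hg : DegreeLE K g) (ρ : M →ₗ[F] A →ₗ[F] N) (D : A →ₗ[F] A)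
    (i j k : ℤ) (h : a + K < i ∨ b < j ∨ c < k) :
    ((symComp (arrow ρ D) D (xzPlane j X) g).1 i).1 k = 0 := by
  by_cases h' : b < j
  · have : xzPlane j X = 0 := InvLaurent.ext fun i => InvLaurent.ext fun k =>
      hX _ _ _ (by omega)
    rw [this, map_zero]
    rfl
  by_cases h' : c < k
  · exact degreeLE_symComp_arrow (c := c) (fun i k hk => hX _ _ _ (by omega)) ρ D g i k h'
  · have hp : DegreeLE a (xzPlane j X) := fun i hi => InvLaurent.ext fun k =>
      hX _ _ _ (by omega)
    rw [hp.symComp hg (arrow ρ D) D i (by omega)]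
    rfl

/-- `X(x + D, y, z + D) g(x)`, with `D` acting on the coefficients of `g`. -/
def rightXZ (ρ : M →ₗ[F] A →ₗ[F] N) (D : A →ₗ[F] A) (g : InvLaurent F A) :
    Laurent₃ F M →ₗ[F] Laurent₃ F N where
  toFun X := ⟨fun i j k => ((symComp (arrow ρ D) D (xzPlane j X) g).1 i).1 k, by
    obtain ⟨K, hK⟩ := exists_degreesLE X
    obtain ⟨L, hL⟩ := exists_degreeLE g
    exact ⟨max K (K + L), fun i j k h => hK.symComp_xzPlane hL ρ D i j k (by omega)⟩⟩
  map_add' X Y := Laurent₃.ext fun i j k => congrArg (fun f => (f.1 i).1 k)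
    (map_add ((symComp (arrow ρ D) D).flip g) (xzPlane j X) (xzPlane j Y))
  map_smul' c X := Laurent₃.ext fun i j k => congrArg (fun f => (f.1 i).1 k)
    (map_smul ((symComp (arrow ρ D) D).flip g) c (xzPlane j X))

lemma rightXZ_coeff (ρ : M →ₗ[F] A →ₗ[F] N) (D : A →ₗ[F] A) (g : InvLaurent F A)
    (X : Laurent₃ F M) (i j k : ℤ) : (rightXZ ρ D g X).1 i j k =
      ((symComp (arrow ρ D) D (xzPlane j X) g).1 i).1 k := rfl

lemma DegreesLE.rightXZ {a b c K : ℤ} {X : Laurent₃ F M} (hX : DegreesLE a b c X)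
    {g : InvLaurent F A} (hg : DegreeLE K g) (ρ : M →ₗ[F] A →ₗ[F] N) (D : A →ₗ[F] A) :
    DegreesLE (a + K) b c (rightXZ ρ D g X) := hX.symComp_xzPlane hg ρ D

/-- `X(x, y + D, z + D) h(y)`, with `D` acting on the coefficients of `h`. -/
def rightYZ (ρ : M →ₗ[F] A →ₗ[F] N) (D : A →ₗ[F] A) (h : InvLaurent F A) :
    Laurent₃ F M →ₗ[F] Laurent₃ F N := swapVars F ∘ₗ rightXZ ρ D h ∘ₗ swapVars F

lemma rightYZ_coeff (ρ : M →ₗ[F] A →ₗ[F] N) (D : A →ₗ[F] A) (h : InvLaurent F A)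
    (X : Laurent₃ F M) (i j k : ℤ) :
    (rightYZ ρ D h X).1 i j k = (rightXZ ρ D h (swapVars F X)).1 j i k := rfl

lemma rightYZ_swapVars (ρ : M →ₗ[F] A →ₗ[F] N) (D : A →ₗ[F] A) (h : InvLaurent F A)
    (X : Laurent₃ F M) : rightYZ ρ D h (swapVars F X) = swapVars F (rightXZ ρ D h X) := rfl

lemma rightXZ_swapVars (ρ : M →ₗ[F] A →ₗ[F] N) (D : A →ₗ[F] A) (h : InvLaurent F A)
    (X : Laurent₃ F M) : rightXZ ρ D h (swapVars F X) = swapVars F (rightYZ ρ D h X) := rfl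

lemma leftZ_swapVars (ℓ : A →ₗ[F] M →ₗ[F] N) (δ : M →ₗ[F] M) (f : InvLaurent F A)
    (X : Laurent₃ F M) : leftZ ℓ δ f (swapVars F X) = swapVars F (leftZ ℓ δ f X) := rfl

lemma DegreesLE.swapVars {a b c : ℤ} {X : Laurent₃ F M} (hX : DegreesLE a b c X) :
    DegreesLE b a c (swapVars F X) := fun i j k h => hX _ _ _ (by omega)

lemma DegreesLE.rotVars {a b c : ℤ} {X : Laurent₃ F M} (hX : DegreesLE a b c X) :
    DegreesLE c a b (rotVars F X) := fun i j k h => hX _ _ _ (by omega)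

lemma DegreesLE.rightYZ {a b c K : ℤ} {X : Laurent₃ F M} (hX : DegreesLE a b c X)
    {h : InvLaurent F A} (hh : DegreeLE K h) (ρ : M →ₗ[F] A →ₗ[F] N) (D : A →ₗ[F] A) :
    DegreesLE a (b + K) c (rightYZ ρ D h X) := (hX.swapVars.rightXZ hh ρ D).swapVars

/-! #### Dependence on the symbols -/

lemma leftZ_add (ℓ : A →ₗ[F] M →ₗ[F] N) (δ : M →ₗ[F] M) (f f' : InvLaurent F A)
    (X : Laurent₃ F M) : leftZ ℓ δ (f + f') X = leftZ ℓ δ f X + leftZ ℓ δ f' X :=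
  Laurent₃.ext fun i j k => by simp [leftZ_coeff]

lemma leftZ_smul (ℓ : A →ₗ[F] M →ₗ[F] N) (δ : M →ₗ[F] M) (c : F) (f : InvLaurent F A)
    (X : Laurent₃ F M) : leftZ ℓ δ (c • f) X = c • leftZ ℓ δ f X :=
  Laurent₃.ext fun i j k => by simp [leftZ_coeff]

lemma rightXZ_add (ρ : M →ₗ[F] A →ₗ[F] N) (D : A →ₗ[F] A) (g g' : InvLaurent F A)
    (X : Laurent₃ F M) : rightXZ ρ D (g + g') X = rightXZ ρ D g X + rightXZ ρ D g' X :=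
  Laurent₃.ext fun i j k => by simp [rightXZ_coeff]

lemma rightXZ_smul (ρ : M →ₗ[F] A →ₗ[F] N) (D : A →ₗ[F] A) (c : F) (g : InvLaurent F A)
    (X : Laurent₃ F M) : rightXZ ρ D (c • g) X = c • rightXZ ρ D g X :=
  Laurent₃.ext fun i j k => by simp [rightXZ_coeff]

lemma rightYZ_add (ρ : M →ₗ[F] A →ₗ[F] N) (D : A →ₗ[F] A) (g g' : InvLaurent F A)
    (X : Laurent₃ F M) : rightYZ ρ D (g + g') X = rightYZ ρ D g X + rightYZ ρ D g' X :=
  congrArg (swapVars F) (rightXZ_add ρ D g g' (swapVars F X))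

lemma rightYZ_smul (ρ : M →ₗ[F] A →ₗ[F] N) (D : A →ₗ[F] A) (c : F) (g : InvLaurent F A)
    (X : Laurent₃ F M) : rightYZ ρ D (c • g) X = c • rightYZ ρ D g X :=
  congrArg (swapVars F) (rightXZ_smul ρ D c g (swapVars F X))

/-- `leftZ` as a linear map in the symbol. -/
def leftZₗ (ℓ : A →ₗ[F] M →ₗ[F] N) (δ : M →ₗ[F] M) (X : Laurent₃ F M) :
    InvLaurent F A →ₗ[F] Laurent₃ F N where
  toFun f := leftZ ℓ δ f X
  map_add' f f' := leftZ_add ℓ δ f f' X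
  map_smul' c f := leftZ_smul ℓ δ c f X

/-- `rightYZ` as a linear map in the symbol. -/
def rightYZₗ (ρ : M →ₗ[F] A →ₗ[F] N) (D : A →ₗ[F] A) (X : Laurent₃ F M) :
    InvLaurent F A →ₗ[F] Laurent₃ F N where
  toFun h := rightYZ ρ D h X
  map_add' h h' := rightYZ_add ρ D h h' X
  map_smul' c h := rightYZ_smul ρ D c h X

/-! #### Multiplication by the variables -/

lemma leftZ_mulX (ℓ : A →ₗ[F] M →ₗ[F] N) (δ : M →ₗ[F] M) (f : InvLaurent F A)
    (X : Laurent₃ F M) : leftZ ℓ δ f (mulX F M X) = mulX F N (leftZ ℓ δ f X) := rfl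

lemma leftZ_mulY (ℓ : A →ₗ[F] M →ₗ[F] N) (δ : M →ₗ[F] M) (f : InvLaurent F A)
    (X : Laurent₃ F M) : leftZ ℓ δ f (mulY F M X) = mulY F N (leftZ ℓ δ f X) := rfl

lemma zLine_mulZ (i j : ℤ) (X : Laurent₃ F M) : zLine i j (mulZ F M X) = mulVar (zLine i j X) :=
  rfl

lemma leftZ_mulZ (ℓ : A →ₗ[F] M →ₗ[F] N) (δ : M →ₗ[F] M) (f : InvLaurent F A)
    (X : Laurent₃ F M) : leftZ ℓ δ f (mulZ F M X) = mulZ F N (leftZ ℓ δ f X) :=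
  Laurent₃.ext fun i j k => by
    rw [leftZ_coeff, zLine_mulZ, symComp_mulVar_right]
    rfl

lemma leftZ_mulVar (ℓ : A →ₗ[F] M →ₗ[F] N) (δ : M →ₗ[F] M) (f : InvLaurent F A)
    (X : Laurent₃ F M) :
    leftZ ℓ δ (mulVar f) X = leftZ ℓ δ f (mulZ F M X + mapCoeff₃ δ X) :=
  Laurent₃.ext fun i j k => by
    rw [leftZ_coeff, symComp_mulVar_left]
    rfl

lemma leftZ_const (ℓ : A →ₗ[F] M →ₗ[F] N) (δ : M →ₗ[F] M) (a : A) (X : Laurent₃ F M) :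
    leftZ ℓ δ (const a) X = mapCoeff₃ (ℓ a) X :=
  Laurent₃.ext fun i j k => by
    rw [leftZ_coeff, symComp_const_left]
    rfl

/-- Invertibility of `z + δ` on each line in the third variable; needed for the backward step in
`expand_leftZ`. -/
lemma mulZ_add_mapCoeff₃_surjective (δ : M →ₗ[F] M) (X : Laurent₃ F M) :
    ∃ Y, mulZ F M Y + mapCoeff₃ δ Y = X :=
  ⟨leftZ (LinearMap.lsmul F M) δ (invVar F) X, Laurent₃.ext fun i j k =>
    congrFun (congrArg Subtype.val (shiftOp_shiftOpInv δ (zLine i j X))) k⟩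

lemma rightXZ_mulX (ρ : M →ₗ[F] A →ₗ[F] N) (D : A →ₗ[F] A) (g : InvLaurent F A)
    (X : Laurent₃ F M) : rightXZ ρ D g (mulX F M X) = rightXZ ρ D (shiftOp D g) X :=
  Laurent₃.ext fun i j k => by
    rw [rightXZ_coeff, rightXZ_coeff, ← symComp_mulVar_left]
    rfl

lemma rightXZ_mulVar (ρ : M →ₗ[F] A →ₗ[F] N) (D : A →ₗ[F] A) (g : InvLaurent F A)
    (X : Laurent₃ F M) : rightXZ ρ D (mulVar g) X = mulX F N (rightXZ ρ D g X) :=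
  Laurent₃.ext fun i j k => by
    rw [rightXZ_coeff, symComp_mulVar_right]
    rfl

lemma rightXZ_mulY (ρ : M →ₗ[F] A →ₗ[F] N) (D : A →ₗ[F] A) (g : InvLaurent F A)
    (X : Laurent₃ F M) : rightXZ ρ D g (mulY F M X) = mulY F N (rightXZ ρ D g X) := rfl

lemma symComp_arrow_mulVar (ρ : M →ₗ[F] A →ₗ[F] N) (D : A →ₗ[F] A)
    (f : InvLaurent F (InvLaurent F M)) (g : InvLaurent F A) :
    symComp (arrow ρ D) D (mapCoeff (mulVarₗ F M) f) g =
      mapCoeff (mulVarₗ F N) (symComp (arrow ρ D) D f g) +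
        symComp (arrow ρ D) D f (mapCoeff D g) := by
  -- This uses `arrow_mulVar` solved for multiplication by `z`, whence the map `-D` in the second
  -- summand.
  have h := mapCoeff_symComp_add (mulVarₗ F N) (β := arrow ρ D) (D := D) (arrow ρ D) D
    (mulVarₗ F M) LinearMap.id (arrow ρ D) D LinearMap.id (-D) (fun _ => rfl) (fun _ => by simp)
    (fun x y => by simp [arrow_mulVar]) f g
  have hD : mapCoeff (-D) g = -mapCoeff D g := rfl
  rw [h, mapCoeff_id, mapCoeff_id, hD, map_neg]
  abel

lemma rightXZ_mulZ (ρ : M →ₗ[F] A →ₗ[F] N) (D : A →ₗ[F] A) (g : InvLaurent F A)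
    (X : Laurent₃ F M) : rightXZ ρ D g (mulZ F M X) =
      mulZ F N (rightXZ ρ D g X) + rightXZ ρ D (mapCoeff D g) X :=
  Laurent₃.ext fun i j k => congrFun (congrArg Subtype.val (congrFun (congrArg Subtype.val
    (symComp_arrow_mulVar ρ D (xzPlane j X) g)) i)) k

lemma rightYZ_mulX (ρ : M →ₗ[F] A →ₗ[F] N) (D : A →ₗ[F] A) (g : InvLaurent F A)
    (X : Laurent₃ F M) : rightYZ ρ D g (mulX F M X) = mulX F N (rightYZ ρ D g X) := rfl

lemma rightYZ_mulY (ρ : M →ₗ[F] A →ₗ[F] N) (D : A →ₗ[F] A) (g : InvLaurent F A)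
    (X : Laurent₃ F M) : rightYZ ρ D g (mulY F M X) = rightYZ ρ D (shiftOp D g) X :=
  congrArg (swapVars F) (rightXZ_mulX ρ D g (swapVars F X))

lemma rightYZ_mulVar (ρ : M →ₗ[F] A →ₗ[F] N) (D : A →ₗ[F] A) (g : InvLaurent F A)
    (X : Laurent₃ F M) : rightYZ ρ D (mulVar g) X = mulY F N (rightYZ ρ D g X) :=
  congrArg (swapVars F) (rightXZ_mulVar ρ D g (swapVars F X))

lemma rightYZ_mulZ (ρ : M →ₗ[F] A →ₗ[F] N) (D : A →ₗ[F] A) (g : InvLaurent F A)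
    (X : Laurent₃ F M) : rightYZ ρ D g (mulZ F M X) =
      mulZ F N (rightYZ ρ D g X) + rightYZ ρ D (mapCoeff D g) X :=
  congrArg (swapVars F) (rightXZ_mulZ ρ D g (swapVars F X))

lemma leftZ_mulRel (ℓ : A →ₗ[F] M →ₗ[F] N) (δ : M →ₗ[F] M) (f : InvLaurent F A)
    (X : Laurent₃ F M) : leftZ ℓ δ f (mulRel F 1 X) = mulRel F 1 (leftZ ℓ δ f X) := by
  simp [mulRel_eq, leftZ_mulX, leftZ_mulY, leftZ_mulZ]

/-- The operator shifts `ν` and `λ` by the same `D`, so `ν - λ - μ` is unaffected: the two terms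
with `D g` cancel. -/
lemma rightXZ_mulRel (ρ : M →ₗ[F] A →ₗ[F] N) (D : A →ₗ[F] A) (g : InvLaurent F A)
    (X : Laurent₃ F M) : rightXZ ρ D g (mulRel F 1 X) = mulRel F 1 (rightXZ ρ D g X) := by
  simp only [mulRel_eq, map_sub, rightXZ_mulX, rightXZ_mulY, rightXZ_mulZ, shiftOp_apply,
    rightXZ_add, rightXZ_mulVar, Units.val_one, one_smul]
  abel

lemma rightYZ_mulRel (ρ : M →ₗ[F] A →ₗ[F] N) (D : A →ₗ[F] A) (g : InvLaurent F A)
    (X : Laurent₃ F M) : rightYZ ρ D g (mulRel F 1 X) = mulRel F 1 (rightYZ ρ D g X) := by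
  simp only [mulRel_eq, map_sub, rightYZ_mulX, rightYZ_mulY, rightYZ_mulZ, shiftOp_apply,
    rightYZ_add, rightYZ_mulVar, Units.val_one, one_smul]
  abel

/-! #### Commutation relations -/

/-- Either order amounts to inserting the one tensor `u ⊗ v`, on which `D` acts as a derivation. -/
lemma arrow_comm {ρ ρ' : M →ₗ[F] A →ₗ[F] M} (hρ : ∀ w u v, ρ (ρ' w u) v = ρ' (ρ w v) u)
    (D : A →ₗ[F] A) (x : InvLaurent F M) (u v : A) :
    arrow ρ D (arrow ρ' D x u) v = arrow ρ' D (arrow ρ D x v) u := by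
  let δ : M →ₗ[F] A ⊗[F] A →ₗ[F] M := LinearMap.flip (TensorProduct.lift
    (LinearMap.mk₂ F (fun u v => ρ.flip v ∘ₗ ρ'.flip u) (fun u u' v => by ext; simp)
      (fun c u v => by ext; simp) (fun u v v' => by ext; simp) (fun c u v => by ext; simp)))
  have h1 := arrow_arrow ρ' ρ δ (TensorProduct.mk F A A) (D₂ := D) (D₃ := D)
    (D := D.rTensor A + D.lTensor A) (fun y z => rfl) (fun x y z => rfl) x u v
  have h2 := arrow_arrow ρ ρ' δ (TensorProduct.mk F A A).flip (D₂ := D) (D₃ := D)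
    (D := D.rTensor A + D.lTensor A) (fun y z => add_comm (D z ⊗ₜ[F] y) (z ⊗ₜ D y)) (fun x y z => (hρ x z y).symm) x v u
  exact h1.trans h2.symm

/-- A series in three variables as an iterated series. -/
def nest : Laurent₃ F M →ₗ[F] InvLaurent F (InvLaurent F (InvLaurent F M)) where
  toFun X := ⟨fun i => ⟨fun j => zLine i j X, by
      obtain ⟨K, hK⟩ := X.2
      exact ⟨K, fun j h => InvLaurent.ext fun k => hK _ _ _ (by omega)⟩⟩, by
    obtain ⟨K, hK⟩ := X.2
    exact ⟨K, fun i h => InvLaurent.ext fun j => InvLaurent.ext fun k => hK _ _ _ (by omega)⟩⟩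
  map_add' _ _ := rfl
  map_smul' _ _ := rfl

lemma nest_injective : Function.Injective (nest : Laurent₃ F M →ₗ[F] _) := fun _ _ h =>
  Laurent₃.ext fun i j k =>
    congrFun (congrArg Subtype.val (congrFun (congrArg Subtype.val
      (congrFun (congrArg Subtype.val h) i)) j)) k

/-- On iterated series each of the three operators becomes a composition of symbols at one level, so
their commutation reduces to naturality of `symComp` in its coefficients. -/
lemma nest_leftZ (ℓ : A →ₗ[F] M →ₗ[F] N) (δ : M →ₗ[F] M) (f : InvLaurent F A)
    (X : Laurent₃ F M) : nest (leftZ ℓ δ f X) = mapCoeff (mapCoeff (symComp ℓ δ f)) (nest X) := rfl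

lemma nest_rightYZ (ρ : M →ₗ[F] A →ₗ[F] N) (D : A →ₗ[F] A) (h : InvLaurent F A)
    (X : Laurent₃ F M) : nest (rightYZ ρ D h X) =
      mapCoeff ((symComp (arrow ρ D) D).flip h) (nest X) := rfl

lemma nest_rightXZ (ρ : M →ₗ[F] A →ₗ[F] N) (D : A →ₗ[F] A) (g : InvLaurent F A)
    (X : Laurent₃ F M) : nest (rightXZ ρ D g X) =
      symComp (mapCoeff₂ (arrow ρ D)) D (nest X) g := by
  refine InvLaurent.ext fun i => InvLaurent.ext fun j => ?_
  have h := mapCoeff_symComp_left (coeffₗ j) (β := mapCoeff₂ (arrow ρ D)) (D := D) (arrow ρ D)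
    (coeffₗ j) (fun x y => rfl) (nest X) g
  exact (congrFun (congrArg Subtype.val h) i).symm

/-- The two operators do not act on separate variables, as both shift `ν`; on the innermost series
the claim is `arrow_comm`. -/
lemma rightXZ_rightYZ {ρ ρ' : M →ₗ[F] A →ₗ[F] M} (hρ : ∀ w u v, ρ (ρ' w u) v = ρ' (ρ w v) u)
    (D : A →ₗ[F] A) (g h : InvLaurent F A) (X : Laurent₃ F M) :
    rightXZ ρ D g (rightYZ ρ' D h X) = rightYZ ρ' D h (rightXZ ρ D g X) := by
  refine nest_injective ?_
  rw [nest_rightXZ, nest_rightYZ, nest_rightYZ, nest_rightXZ]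
  refine (mapCoeff_symComp_left _ _ _ (fun u v => ?_) _ _).symm
  exact (mapCoeff_symComp_left ((arrow ρ D).flip v) (arrow ρ' D) ((arrow ρ D).flip v)
    (fun x y => arrow_comm hρ D x y v) u h).symm

/-- In `f(z + δ)` the derivation `δ` splits between `X` and `g`, and the part on `g` is exactly the
shift of `z` that `rightXZ` performs. For each line this is associativity, `symComp_arrow`. -/
lemma leftZ_rightXZ {ℓ : A →ₗ[F] M →ₗ[F] M} {ρ : M →ₗ[F] A →ₗ[F] M}
    (hℓ : ∀ u w v, ℓ u (ρ w v) = ρ (ℓ u w) v) {δ : M →ₗ[F] M} {D : A →ₗ[F] A}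
    (hδ : ∀ w u, δ (ρ w u) = ρ (δ w) u + ρ w (D u)) (f g : InvLaurent F A) (X : Laurent₃ F M) :
    leftZ ℓ δ f (rightXZ ρ D g X) = rightXZ ρ D g (leftZ ℓ δ f X) := by
  refine nest_injective ?_
  rw [nest_rightXZ, nest_leftZ, nest_leftZ, nest_rightXZ]
  refine mapCoeff_symComp_left _ _ _ (fun u v => InvLaurent.ext fun j => ?_) _ _
  exact (symComp_arrow hδ (fun x y z => (hℓ x y z).symm) f (u.1 j) v).symm

lemma leftZ_rightYZ {ℓ : A →ₗ[F] M →ₗ[F] M} {ρ : M →ₗ[F] A →ₗ[F] M}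
    (hℓ : ∀ u w v, ℓ u (ρ w v) = ρ (ℓ u w) v) {δ : M →ₗ[F] M} {D : A →ₗ[F] A}
    (hδ : ∀ w u, δ (ρ w u) = ρ (δ w) u + ρ w (D u)) (f g : InvLaurent F A) (X : Laurent₃ F M) :
    leftZ ℓ δ f (rightYZ ρ D g X) = rightYZ ρ D g (leftZ ℓ δ f X) :=
  congrArg (swapVars F) (leftZ_rightXZ hℓ hδ f g (swapVars F X))

end ThreeVariables

/-! ### Compatibility of the operators with the expansions -/

section Expansions

variable {F : Type*} [Field F]
variable {A : Type*} [AddCommGroup A] [Module F A]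
variable {M : Type*} [AddCommGroup M] [Module F M]
variable {N : Type*} [AddCommGroup N] [Module F N]
variable {P : Type*} [AddCommGroup P] [Module F P]

lemma expand_coeff (ε : ℤˣ) (X : Laurent₃ F M) (q p : ℤ) :
    ((expand ε X).1 q).1 p = ∑ᶠ x, expandTerm ε X.1 q p x := rfl

lemma DegreesLE.expand {a b c : ℤ} {X : Laurent₃ F M} (hX : DegreesLE a b c X) (ε : ℤˣ) :
    DegreeLE (b + c) (expand ε X) := fun q hq => InvLaurent.ext fun p => by
  rw [expand_coeff]
  refine finsum_eq_zero_of_forall_eq_zero fun x => ?_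
  rw [expandTerm, hX (p - x.1) (q - x.2 + x.1) x.2 (by omega)]
  simp

lemma expand_mapCoeff₃ (ε : ℤˣ) (φ : M →ₗ[F] N) (X : Laurent₃ F M) :
    expand ε (mapCoeff₃ φ X) = mapCoeff (mapCoeff φ) (expand ε X) :=
  InvLaurent.ext fun q => InvLaurent.ext fun p => by
    rw [mapCoeff_coeff, mapCoeff_coeff, expand_coeff, expand_coeff]
    refine Eq.symm ((φ.toAddMonoidHom.map_finsum (finite_expandTerm ε X q p)).trans
      (finsum_congr fun x => ?_))
    simp [expandTerm]

lemma expand_mulX (ε : ℤˣ) (X : Laurent₃ F M) :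
    expand ε (mulX F M X) = mapCoeff (mulVarₗ F M) (expand ε X) :=
  InvLaurent.ext fun q => InvLaurent.ext fun p => by
    rw [mapCoeff_coeff, mulVarₗ_apply, mulVar_coeff, expand_coeff, expand_coeff]
    refine finsum_congr fun x => ?_
    simp only [expandTerm, mulX_coeff, sub_right_comm]

lemma expand_mulY (ε : ℤˣ) (X : Laurent₃ F M) :
    expand ε (mulY F M X) = mulVar (expand ε X) :=
  InvLaurent.ext fun q => InvLaurent.ext fun p => by
    rw [mulVar_coeff, expand_coeff, expand_coeff]
    refine finsum_congr fun x => ?_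
    simp only [expandTerm, mulY_coeff]
    rw [show q - x.2 + x.1 - 1 = q - 1 - x.2 + x.1 by ring]

lemma expand_mulZ (ε : ℤˣ) (X : Laurent₃ F M) :
    expand ε (mulZ F M X) = mapCoeff (mulVarₗ F M) (expand ε X) +
      (ε : ℤ) • mulVar (expand ε X) := by
  have h := expand_mulRel ε X
  rw [mulRel_eq, map_sub, map_sub, map_zsmul, expand_mulX, expand_mulY, sub_sub, sub_eq_zero] at h
  exact h

lemma expand_of_const {ε : ℤˣ} {X : Laurent₃ F M} (hX : ∀ i j k, k ≠ 0 → X.1 i j k = 0)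
    (q p : ℤ) : ((expand ε X).1 q).1 p = X.1 p q 0 := by
  rw [expand_coeff, finsum_eq_single _ ((0 : ℕ), (0 : ℤ))]
  · simp [expandTerm]
  · rintro ⟨l, k⟩ h
    by_cases hk : k = 0
    · subst hk
      cases l with
      | zero => exact absurd rfl h
      | succ l => simp [expandTerm]
    · simp [expandTerm, hX _ _ _ hk]

/-- The part of degree `k` in the third variable. -/
def zPart (k : ℤ) (X : Laurent₃ F M) : Laurent₃ F M :=
  ⟨fun i j n => if n = k then X.1 i j n else 0, by
    obtain ⟨K, hK⟩ := X.2
    exact ⟨K, fun i j n h => by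
      beta_reduce
      split_ifs
      · exact hK i j n h
      · rfl⟩⟩

lemma zPart_coeff (k : ℤ) (X : Laurent₃ F M) (i j n : ℤ) :
    (zPart k X).1 i j n = if n = k then X.1 i j n else 0 := rfl

/-- Reduction of identities about expansions `z = x + ε y` to series which are constant in `z`. -/
theorem eq_zero_of_const_of_mulZ {B : Type*} (ε : ℤˣ)
    (Φ : B → Laurent₃ F M →ₗ[F] InvLaurent F (InvLaurent F P)) (s : B → B) (c : ℤ)
    (hz : ∀ b X, Φ b (mulZ F M X) =
      mapCoeff (mulVarₗ F P) (Φ b X) + (ε : ℤ) • mulVar (Φ b X) + c • Φ (s b) X)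
    (hdeg : ∀ N, ∃ L, ∀ K X, DegreesLE N N K X → ∀ b, DegreeLE (K + L) (Φ b X))
    (h0 : ∀ b X, (∀ i j k, k ≠ 0 → X.1 i j k = 0) → Φ b X = 0) (b : B) (X : Laurent₃ F M) :
    Φ b X = 0 := by
  -- Solved for `y Φ b X`, the relation `hz` expresses the coefficient at `q` through coefficients
  -- at `q + 1`. The degree bound therefore drops by one, indefinitely. It has to be uniform in `b`,
  -- because `s` moves `b`.
  have hpred : ∀ X, (∀ b, Φ b (mulZ F M X) = 0) → ∀ b, Φ b X = 0 := by
    intro X hX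
    obtain ⟨K, hK⟩ := exists_degreesLE X
    obtain ⟨L, hL⟩ := hdeg K
    have hn : ∀ (n : ℕ) b, DegreeLE (K + L - n) (Φ b X) := by
      intro n
      induction n with
      | zero => exact fun b => by simpa using hL K X hK b
      | succ n ih =>
        intro b q hq
        have h := congrArg (fun f => f.1 (q + 1)) ((hz b X).symm.trans (hX b))
        have h1 : (Φ b X).1 (q + 1) = 0 := ih b _ (by push_cast at hq; omega)
        have h2 : (Φ (s b) X).1 (q + 1) = 0 := ih (s b) _ (by push_cast at hq; omega)
        have h3 : (((ε : ℤ) • mulVar (Φ b X)).1 (q + 1)) = (ε : ℤ) • (Φ b X).1 (q + 1 - 1) := rfl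
        have h4 : ((c • Φ (s b) X).1 (q + 1)) = c • (Φ (s b) X).1 (q + 1) := rfl
        simp only [InvLaurent.add_coeff, mapCoeff_coeff, h1, h3, h4, h2, map_zero, smul_zero,
          add_zero, zero_add, InvLaurent.zero_coeff, add_sub_cancel_right] at h
        have hu := congrArg (fun y => (ε : ℤ) • y) h
        rwa [← mul_smul, ← Units.val_mul, Int.units_mul_self, Units.val_one, one_smul, smul_zero]
          at hu
    intro b
    refine InvLaurent.ext fun q => hn (K + L - q + 1).toNat b q ?_
    omega
  have hmono : ∀ (m : ℤ) X, (∀ i j k, k ≠ m → X.1 i j k = 0) → ∀ b, Φ b X = 0 := by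
    intro m
    induction m using Int.induction_on with
    | zero => exact fun X hX b => h0 b X hX
    | succ n ih =>
      intro X hX b
      obtain ⟨Y, hY⟩ : ∃ Y, mulZ F M Y = X := ⟨⟨fun i j k => X.1 i j (k + 1), by
        obtain ⟨K, hK⟩ := X.2
        exact ⟨K, fun i j k h => hK _ _ _ (by omega)⟩⟩,
        Laurent₃.ext fun i j k => congrArg (X.1 i j) (by ring)⟩
      have hYc : ∀ b, Φ b Y = 0 := ih Y fun i j k hk => by
        have := hX i j (k + 1) (by omega)
        rwa [← hY, mulZ_coeff, add_sub_cancel_right] at this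
      rw [← hY, hz, hYc, hYc]
      simp
    | pred n ih =>
      intro X hX
      refine hpred X (ih _ fun i j k hk => ?_)
      rw [mulZ_coeff]
      exact hX _ _ _ (by omega)
  obtain ⟨N, hN⟩ := exists_degreesLE X
  obtain ⟨L, hL⟩ := hdeg N
  refine InvLaurent.ext fun q => ?_
  have hsum : ∀ i j n, (∑ k ∈ Finset.Ioc (q - 1 - L) N, zPart k X).1 i j n =
      if n ∈ Finset.Ioc (q - 1 - L) N then X.1 i j n else 0 := by
    intro i j n
    have : (∑ k ∈ Finset.Ioc (q - 1 - L) N, zPart k X).1 i j n =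
        ∑ k ∈ Finset.Ioc (q - 1 - L) N, (zPart k X).1 i j n :=
      map_sum (coeffₗ n ∘ₗ zLine i j) _ _
    rw [this]
    simp only [zPart_coeff]
    exact Finset.sum_ite_eq _ n _
  -- After removal of the finitely many high powers of `z`, the image has degree at most `q - 1` in
  -- `y`, so its coefficient at `q` vanishes.
  have htail : DegreesLE N N (q - 1 - L) (X - ∑ k ∈ Finset.Ioc (q - 1 - L) N, zPart k X) := by
    intro i j k h
    rw [Laurent₃.sub_coeff, hsum]
    by_cases hk : k ∈ Finset.Ioc (q - 1 - L) N
    · rw [if_pos hk, sub_self]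
    · rw [if_neg hk, sub_zero]
      rw [Finset.mem_Ioc] at hk
      exact hN _ _ _ (by omega)
  have h := hL _ _ htail b q (by omega)
  rw [map_sub, map_sum, Finset.sum_eq_zero fun k _ => hmono k _ (fun i j n hn => if_neg hn) b,
    sub_zero] at h
  exact h

/-- `mapCoeff` with parameters. -/
def mapCoeffHom (ℓ : A →ₗ[F] M →ₗ[F] N) : A →ₗ[F] InvLaurent F M →ₗ[F] InvLaurent F N :=
  (mapCoeff₂ ℓ.flip).flip

@[simp]
lemma mapCoeffHom_apply (ℓ : A →ₗ[F] M →ₗ[F] N) (a : A) (f : InvLaurent F M) :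
    mapCoeffHom ℓ a f = mapCoeff (ℓ a) f := rfl

/-- At `z = x + y` the operator `z + δ` is `y + (x + δ)`, which is `shiftOp (shiftOp δ)`.
Multiplying `f` by its variable thus has the same effect on both sides, and the claim is reduced to
constant `f`. -/
lemma expand_leftZ (ℓ : A →ₗ[F] M →ₗ[F] N) (δ : M →ₗ[F] M) (f : InvLaurent F A)
    (X : Laurent₃ F M) :
    expand 1 (leftZ ℓ δ f X) = symComp (mapCoeffHom ℓ) (shiftOp δ) f (expand 1 X) := by
  refine eq_of_const (ι := Laurent₃ F M) (fun X => expand 1 ∘ₗ leftZₗ ℓ δ X)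
    (fun X => (symComp (mapCoeffHom ℓ) (shiftOp δ)).flip (expand 1 X)) ?_ ?_ ?_ ?_ X f
  · intro X
    obtain ⟨K, hK⟩ := exists_degreesLE X
    exact ⟨K + K, fun L f hf => by
      have := (hK.leftZ hf ℓ δ).expand 1
      rw [show L + (K + K) = K + (K + L) by ring]
      exact this⟩
  · intro X
    obtain ⟨K, hK⟩ := exists_degreeLE (expand 1 X)
    exact ⟨K, fun L f hf => hf.symComp hK _ _⟩
  · intro X a
    change expand 1 (leftZ ℓ δ (const a) X) =
      symComp (mapCoeffHom ℓ) (shiftOp δ) (const a) (expand 1 X)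
    rw [leftZ_const, expand_mapCoeff₃, symComp_const_left]
    rfl
  · intro f
    change (∀ X, expand 1 (leftZ ℓ δ f X) =
        symComp (mapCoeffHom ℓ) (shiftOp δ) f (expand 1 X)) ↔
      ∀ X, expand 1 (leftZ ℓ δ (mulVar f) X) =
        symComp (mapCoeffHom ℓ) (shiftOp δ) (mulVar f) (expand 1 X)
    have key : ∀ X : Laurent₃ F M, shiftOp (shiftOp δ) (expand 1 X) =
        expand 1 (mulZ F M X + mapCoeff₃ δ X) := by
      intro X
      rw [map_add, expand_mulZ, expand_mapCoeff₃, Units.val_one, one_smul, shiftOp_apply]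
      have : mapCoeff (shiftOp δ) (expand 1 X) =
        mapCoeff (mulVarₗ F M) (expand 1 X) + mapCoeff (mapCoeff δ) (expand 1 X) := rfl
      rw [this]
      abel
    simp only [leftZ_mulVar, symComp_mulVar_left, key]
    constructor
    · exact fun H X => H _
    · intro H X
      obtain ⟨Y, rfl⟩ := mulZ_add_mapCoeff₃_surjective δ X
      exact H Y

lemma rightXZ_of_const {ρ : M →ₗ[F] A →ₗ[F] N} {D : A →ₗ[F] A} {g : InvLaurent F A}
    {X : Laurent₃ F M} (hX : ∀ i j k, k ≠ 0 → X.1 i j k = 0) (i j k : ℤ) :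
    (rightXZ ρ D g X).1 i j k =
      if k = 0 then (symComp ρ D (mapCoeff (coeffₗ 0) (xzPlane j X)) g).1 i else 0 := by
  have h : mapCoeff const (mapCoeff (coeffₗ 0) (xzPlane j X)) = xzPlane j X :=
    InvLaurent.ext fun i => InvLaurent.ext fun k => by
      simp only [mapCoeff_coeff, const_coeff, coeffₗ_apply, xzPlane_coeff, zLine_coeff]
      split_ifs with hk
      · rw [hk]
      · exact (hX _ _ _ hk).symm
  rw [rightXZ_coeff, ← h, ← mapCoeff_symComp_left const (β := ρ) (D := D) (arrow ρ D) const
    (fun x y => (arrow_const ρ D x y).symm)]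
  rfl

lemma rightXZ_of_const' {ρ : M →ₗ[F] A →ₗ[F] N} {D : A →ₗ[F] A} {g : InvLaurent F A}
    {X : Laurent₃ F M} (hX : ∀ i j k, k ≠ 0 → X.1 i j k = 0) (i j k : ℤ) (hk : k ≠ 0) :
    (rightXZ ρ D g X).1 i j k = 0 := by
  rw [rightXZ_of_const hX, if_neg hk]

/-- Shifting `x` by `D` already shifts `x + y`, so the shift of `z` disappears in the expansion. The
reduction is to series without `z`; the index `g` moves to `D g`, and the bounds in `y` and `z` do
not depend on `g`. -/
lemma expand_rightXZ (ρ : M →ₗ[F] A →ₗ[F] N) (D : A →ₗ[F] A) (g : InvLaurent F A)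
    (X : Laurent₃ F M) :
    expand 1 (rightXZ ρ D g X) = mapCoeff ((symComp ρ D).flip g) (expand 1 X) := by
  rw [← sub_eq_zero]
  refine eq_zero_of_const_of_mulZ (B := InvLaurent F A) 1 (fun g => expand 1 ∘ₗ rightXZ ρ D g -
    mapCoeff ((symComp ρ D).flip g) ∘ₗ expand 1) (fun g => mapCoeff D g) 1 ?_ ?_ ?_ g X
  · intro g X
    have h : ∀ Y : InvLaurent F (InvLaurent F M),
        mapCoeff ((symComp ρ D).flip g) (mapCoeff (mulVarₗ F M) Y) =
        mapCoeff (mulVarₗ F N) (mapCoeff ((symComp ρ D).flip g) Y) +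
          mapCoeff ((symComp ρ D).flip (mapCoeff D g)) Y := fun Y => by
      refine InvLaurent.ext fun q => ?_
      simp [symComp_mulVar_left, shiftOp_apply, symComp_mulVar_right]
    have h' : ∀ Y : InvLaurent F (InvLaurent F M),
        mapCoeff ((symComp ρ D).flip g) (mulVar Y) =
        mulVar (mapCoeff ((symComp ρ D).flip g) Y) := fun Y => rfl
    simp only [LinearMap.sub_apply, LinearMap.comp_apply, rightXZ_mulZ, map_add, expand_mulZ, h, h',
      Units.val_one, one_smul, map_sub, mulVar_sub]
    abel
  · intro K
    refine ⟨K, fun L X hX g => ?_⟩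
    obtain ⟨R, hR⟩ := exists_degreeLE g
    rw [add_comm]
    exact ((hX.rightXZ hR ρ D).expand 1).sub ((hX.expand 1).mapCoeff _)
  · intro g X hX
    rw [LinearMap.sub_apply, sub_eq_zero]
    refine InvLaurent.ext fun q => InvLaurent.ext fun p => ?_
    rw [LinearMap.comp_apply, expand_of_const (rightXZ_of_const' hX), rightXZ_of_const hX,
      if_pos rfl, LinearMap.comp_apply, mapCoeff_coeff, LinearMap.flip_apply]
    have he : mapCoeff (coeffₗ 0) (xzPlane q X) = (expand 1 X).1 q :=
      InvLaurent.ext fun i => (expand_of_const (ε := 1) hX q i).symm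
    rw [he]

lemma expand_rightYZ (ρ : M →ₗ[F] A →ₗ[F] N) (D : A →ₗ[F] A) (h : InvLaurent F A)
    (X : Laurent₃ F M) :
    expand 1 (rightYZ ρ D h X) = symComp (mapCoeff₂ ρ) D (expand 1 X) h := by
  obtain ⟨R, hR⟩ := exists_degreeLE h
  rw [← sub_eq_zero]
  -- Here `h` contributes to the degree in `y`. The bound has to be uniform, so the index ranges
  -- over symbols of degree at most `R`, which `D` preserves.
  refine eq_zero_of_const_of_mulZ (B := {h : InvLaurent F A // DegreeLE R h}) 1
    (fun h => expand 1 ∘ₗ rightYZ ρ D h.1 - (symComp (mapCoeff₂ ρ) D).flip h.1 ∘ₗ expand 1)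
    (fun h => ⟨mapCoeff D h.1, h.2.mapCoeff D⟩) 1 ?_ ?_ ?_ ⟨h, hR⟩ X
  · rintro ⟨h, hh⟩ X
    have h1 : ∀ Y : InvLaurent F (InvLaurent F M),
        symComp (mapCoeff₂ ρ) D (mapCoeff (mulVarₗ F M) Y) h =
        mapCoeff (mulVarₗ F N) (symComp (mapCoeff₂ ρ) D Y h) := fun Y =>
      (mapCoeff_symComp_left (mulVarₗ F N) (mapCoeff₂ ρ) (mulVarₗ F M) (fun _ _ => rfl) Y h).symm
    simp only [LinearMap.sub_apply, LinearMap.comp_apply, rightYZ_mulZ, map_add, expand_mulZ, h1,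
      LinearMap.flip_apply, symComp_mulVar_left, symComp_mulVar_right,
      shiftOp_apply, Units.val_one, one_smul, map_sub, mulVar_sub]
    abel
  · intro K
    refine ⟨K + R, fun L X hX h => ?_⟩
    have h1 := (hX.rightYZ h.2 ρ D).expand 1
    have h2 := (hX.expand 1).symComp h.2 (mapCoeff₂ ρ) D
    rw [show L + (K + R) = K + R + L by ring]
    rw [show K + L + R = K + R + L by ring] at h2
    exact h1.sub h2
  · rintro ⟨h, hh⟩ X hX
    rw [LinearMap.sub_apply, sub_eq_zero]
    have hX' : ∀ i j k, k ≠ 0 → (swapVars F X).1 i j k = 0 := fun i j k hk => hX _ _ _ hk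
    have hY : ∀ i j k, k ≠ 0 → (rightYZ ρ D h X).1 i j k = 0 := fun i j k hk => by
      rw [rightYZ_coeff, rightXZ_of_const' hX' j i k hk]
    refine InvLaurent.ext fun q => InvLaurent.ext fun p => ?_
    rw [LinearMap.comp_apply, expand_of_const hY, rightYZ_coeff, rightXZ_of_const hX', if_pos rfl, LinearMap.comp_apply, LinearMap.flip_apply]
    have h2 := mapCoeff_symComp_left (coeffₗ p) (β := mapCoeff₂ ρ) (D := D) ρ (coeffₗ p)
      (fun _ _ => rfl) (expand 1 X) h
    have he : mapCoeff (coeffₗ 0) (xzPlane p (swapVars F X)) = mapCoeff (coeffₗ p) (expand 1 X) :=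
      InvLaurent.ext fun i => (expand_of_const (ε := 1) hX i p).symm
    rw [he]
    exact (congrFun (congrArg Subtype.val h2) q).symm

lemma rotVars_mulY (X : Laurent₃ F M) : rotVars F (mulY F M X) = mulZ F M (rotVars F X) := rfl

lemma rotVars_rotVars_mulZ (X : Laurent₃ F M) :
    rotVars F (rotVars F (mulZ F M X)) = mulY F M (rotVars F (rotVars F X)) := rfl

lemma DegreesLE.mono {a b c a' b' c' : ℤ} {X : Laurent₃ F M} (hX : DegreesLE a b c X)
    (ha : a ≤ a') (hb : b ≤ b') (hc : c ≤ c') : DegreesLE a' b' c' X :=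
  fun i j k h => hX i j k (by omega)

/-- A version of `eq_zero_of_const_of_mulZ` for the expansion of the second variable as a
difference of the third and the first one. -/
theorem eq_of_const_of_mulY {B : Type*}
    (Φ Ψ : B → Laurent₃ F M →ₗ[F] InvLaurent F (InvLaurent F P)) (s : B → B) (c : ℤ)
    (hΦ : ∀ b X, Φ b (mulY F M X) =
      mapCoeff (mulVarₗ F P) (Φ b X) - mulVar (Φ b X) + c • Φ (s b) X)
    (hΨ : ∀ b X, Ψ b (mulY F M X) =
      mapCoeff (mulVarₗ F P) (Ψ b X) - mulVar (Ψ b X) + c • Ψ (s b) X)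
    (hdΦ : ∀ N, ∃ L, ∀ K X, DegreesLE N K N X → ∀ b, DegreeLE (K + L) (Φ b X))
    (hdΨ : ∀ N, ∃ L, ∀ K X, DegreesLE N K N X → ∀ b, DegreeLE (K + L) (Ψ b X))
    (h0 : ∀ b X, (∀ i j k, j ≠ 0 → X.1 i j k = 0) → Φ b X = Ψ b X) (b : B) (X : Laurent₃ F M) :
    Φ b X = Ψ b X := by
  rw [← sub_eq_zero]
  -- Three rotations are the identity: composing with two and evaluating at `rotVars F X` returns to
  -- `X`, while the second variable takes the place of the third.
  refine eq_zero_of_const_of_mulZ (-1)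
    (fun b => (Φ b - Ψ b) ∘ₗ rotVars F ∘ₗ rotVars F) s c ?_ ?_ ?_ b (rotVars F X)
  · intro b X
    simp only [LinearMap.comp_apply, LinearMap.sub_apply, rotVars_rotVars_mulZ, hΦ, hΨ, map_sub,
      mulVar_sub, smul_sub, Units.val_neg, Units.val_one, neg_smul, one_smul]
    abel
  · intro K
    obtain ⟨L, hL⟩ := hdΦ K
    obtain ⟨L', hL'⟩ := hdΨ K
    refine ⟨max L L', fun R X hX b => ?_⟩
    have h := hX.rotVars.rotVars
    exact ((hL R _ h b).mono (by omega)).sub ((hL' R _ h b).mono (by omega))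
  · intro b X hX
    rw [LinearMap.comp_apply, LinearMap.sub_apply, sub_eq_zero]
    exact h0 b _ fun i j k hj => hX _ _ _ hj

lemma expand_rotVars_of_const {ε : ℤˣ} {X : Laurent₃ F M} (hX : ∀ i j k, j ≠ 0 → X.1 i j k = 0) :
    expand ε (rotVars F X) = xzPlane 0 X :=
  InvLaurent.ext fun q => InvLaurent.ext fun p => expand_of_const (fun i j k hk => hX j k i hk) q p

lemma expand_rotVars_mulY (X : Laurent₃ F M) : expand (-1) (rotVars F (mulY F M X)) =
    mapCoeff (mulVarₗ F M) (expand (-1) (rotVars F X)) - mulVar (expand (-1) (rotVars F X)) := by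
  rw [rotVars_mulY, expand_mulZ, Units.val_neg, Units.val_one, neg_smul, one_smul, sub_eq_add_neg]

/-- In this expansion the inner variable is `ν` itself, so `f(ν + δ)` acts on the inner series. -/
lemma expand_rotVars_leftZ (ℓ : A →ₗ[F] M →ₗ[F] N) (δ : M →ₗ[F] M) (f : InvLaurent F A)
    (X : Laurent₃ F M) : expand (-1) (rotVars F (leftZ ℓ δ f X)) =
      mapCoeff (symComp ℓ δ f) (expand (-1) (rotVars F X)) := by
  refine eq_of_const_of_mulY (B := Unit) (fun _ => expand (-1) ∘ₗ rotVars F ∘ₗ leftZ ℓ δ f)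
    (fun _ => mapCoeff (symComp ℓ δ f) ∘ₗ expand (-1) ∘ₗ rotVars F) id 0 ?_ ?_ ?_ ?_ ?_ () X
  · intro _ X
    simp only [LinearMap.comp_apply, leftZ_mulY, expand_rotVars_mulY, zero_smul, add_zero]
  · intro _ X
    simp only [LinearMap.comp_apply, expand_rotVars_mulY, zero_smul, add_zero, map_sub]
    refine congrArg₂ (· - ·) (InvLaurent.ext fun q => ?_) rfl
    exact symComp_mulVar_right ℓ δ f _
  · obtain ⟨R, hR⟩ := exists_degreeLE f
    exact fun K => ⟨K, fun L X hX _ => by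
      rw [add_comm]
      exact (hX.leftZ hR ℓ δ).rotVars.expand (-1)⟩
  · exact fun K => ⟨K, fun L X hX _ => by
      rw [add_comm]
      exact (hX.rotVars.expand (-1)).mapCoeff _⟩
  · intro _ X hX
    have hX' : ∀ i j k, j ≠ 0 → (leftZ ℓ δ f X).1 i j k = 0 := fun i j k hj => by
      have : zLine i j X = 0 := InvLaurent.ext fun k => hX _ _ _ hj
      rw [leftZ_coeff, this, map_zero]
      rfl
    simp only [LinearMap.comp_apply, expand_rotVars_of_const hX, expand_rotVars_of_const hX']
    rfl

/-- Both visible variables, `λ` outside and `ν` inside, are shifted by `D`, while the eliminated `μ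
= ν - λ` is unchanged. -/
lemma expand_rotVars_rightXZ (ρ : M →ₗ[F] A →ₗ[F] N) (D : A →ₗ[F] A) (g : InvLaurent F A)
    (X : Laurent₃ F M) : expand (-1) (rotVars F (rightXZ ρ D g X)) =
      symComp (arrow ρ D) D (expand (-1) (rotVars F X)) g := by
  refine eq_of_const_of_mulY (B := Unit) (fun _ => expand (-1) ∘ₗ rotVars F ∘ₗ rightXZ ρ D g)
    (fun _ => (symComp (arrow ρ D) D).flip g ∘ₗ expand (-1) ∘ₗ rotVars F) id 0 ?_ ?_ ?_ ?_ ?_ () X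
  · intro _ X
    simp only [LinearMap.comp_apply, rightXZ_mulY, expand_rotVars_mulY, zero_smul, add_zero]
  · intro _ X
    simp only [LinearMap.comp_apply, expand_rotVars_mulY, zero_smul, add_zero, map_sub,
      LinearMap.flip_apply, symComp_arrow_mulVar, symComp_mulVar_left,
      shiftOp_apply, map_add, symComp_mulVar_right]
    abel
  · obtain ⟨R, hR⟩ := exists_degreeLE g
    exact fun K => ⟨K + R, fun L X hX _ => by
      rw [show L + (K + R) = K + R + L by ring]
      exact (hX.rightXZ hR ρ D).rotVars.expand (-1)⟩
  · obtain ⟨R, hR⟩ := exists_degreeLE g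
    exact fun K => ⟨K + R, fun L X hX _ => by
      rw [show L + (K + R) = K + L + R by ring]
      exact (hX.rotVars.expand (-1)).symComp hR _ _⟩
  · intro _ X hX
    have hX' : ∀ i j k, j ≠ 0 → (rightXZ ρ D g X).1 i j k = 0 := fun i j k hj => by
      have : xzPlane j X = 0 := InvLaurent.ext fun i => InvLaurent.ext fun k => hX _ _ _ hj
      rw [rightXZ_coeff, this, map_zero]
      rfl
    simp only [LinearMap.comp_apply, expand_rotVars_of_const hX, expand_rotVars_of_const hX']
    rfl

/-- For a constant symbol only the shift of `ν` remains visible. A general symbol in the eliminated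
variable `μ` is handled below by writing it as an adjoint. -/
lemma expand_rotVars_rightYZ_const (ρ : M →ₗ[F] A →ₗ[F] N) (D : A →ₗ[F] A) (a : A)
    (X : Laurent₃ F M) : expand (-1) (rotVars F (rightYZ ρ D (const a) X)) =
      mapCoeff ((arrow ρ D).flip a) (expand (-1) (rotVars F X)) := by
  refine eq_of_const_of_mulY (B := A)
    (fun a => expand (-1) ∘ₗ rotVars F ∘ₗ rightYZ ρ D (const a))
    (fun a => mapCoeff ((arrow ρ D).flip a) ∘ₗ expand (-1) ∘ₗ rotVars F) D 1 ?_ ?_ ?_ ?_ ?_ a X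
  · intro a X
    simp only [LinearMap.comp_apply, rightYZ_mulY, shiftOp_apply, rightYZ_add, mapCoeff_const,
      rightYZ_mulVar, map_add, expand_rotVars_mulY, one_smul]
  · intro a X
    simp only [LinearMap.comp_apply, expand_rotVars_mulY, one_smul, map_sub]
    rw [sub_add_eq_add_sub]
    refine congrArg₂ (· - ·) (InvLaurent.ext fun q => ?_) rfl
    exact arrow_mulVar ρ D _ a
  · exact fun K => ⟨K, fun L X hX a => by
      rw [add_comm]
      simpa using (hX.rightYZ (degreeLE_const a) ρ D).rotVars.expand (-1)⟩
  · exact fun K => ⟨K, fun L X hX _ => by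
      rw [add_comm]
      exact (hX.rotVars.expand (-1)).mapCoeff _⟩
  · intro a X hX
    have hcoeff : ∀ i j k, (rightYZ ρ D (const a) X).1 i j k =
        ((const (arrow ρ D (zLine i 0 X) a) : InvLaurent F (InvLaurent F N)).1 j).1 k := by
      intro i j k
      have h : xzPlane i (swapVars F X) = const (zLine i 0 X) := InvLaurent.ext fun j => by
        rw [const_coeff]
        split_ifs with hj
        · rw [hj]
          rfl
        · exact InvLaurent.ext fun k => hX _ _ _ hj
      change (rightXZ ρ D (const a) (swapVars F X)).1 j i k = _
      rw [rightXZ_coeff, h, ← arrow_apply, arrow_const]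
    have hX' : ∀ i j k, j ≠ 0 → (rightYZ ρ D (const a) X).1 i j k = 0 := fun i j k hj => by
      rw [hcoeff, const_coeff, if_neg hj]
      rfl
    simp only [LinearMap.comp_apply, expand_rotVars_of_const hX, expand_rotVars_of_const hX']
    refine InvLaurent.ext fun i => InvLaurent.ext fun k => ?_
    rw [xzPlane_coeff, zLine_coeff, hcoeff]
    rfl

/-- The expansion of `rightYZ` in terms of an adjoint symbol. -/
lemma expand_rotVars_rightYZ (ρ : M →ₗ[F] A →ₗ[F] N) (D : A →ₗ[F] A) (σ : A →ₗ[F] A)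
    (T : InvLaurent F A →ₗ[F] InvLaurent F A) (hTdeg : ∀ K f, DegreeLE K f → DegreeLE K (T f))
    (hTc : ∀ a, T (const a) = const (σ a))
    (hT : ∀ f, T (mulVar f) = -shiftOp D (T f)) (f : InvLaurent F A) (X : Laurent₃ F M) :
    expand (-1) (rotVars F (rightYZ ρ D (T f) X)) =
      symComp ((arrow ρ D).flip ∘ₗ σ) (-mulVarₗ F M) f (expand (-1) (rotVars F X)) := by
  refine eq_of_const (ι := Laurent₃ F M)
    (fun X => expand (-1) ∘ₗ rotVars F ∘ₗ rightYZₗ ρ D X ∘ₗ T)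
    (fun X => (symComp ((arrow ρ D).flip ∘ₗ σ) (-mulVarₗ F M)).flip (expand (-1) (rotVars F X)))
    ?_ ?_ ?_ ?_ X f
  · intro X
    obtain ⟨K, hK⟩ := exists_degreesLE X
    exact ⟨K + K, fun L f hf => by
      have := (hK.rightYZ (hTdeg _ _ hf) ρ D).rotVars.expand (-1)
      rw [show L + (K + K) = K + (K + L) by ring]
      exact this⟩
  · intro X
    obtain ⟨K, hK⟩ := exists_degreeLE (expand (-1) (rotVars F X))
    exact ⟨K, fun L f hf => hf.symComp hK _ _⟩
  · intro X a
    change expand (-1) (rotVars F (rightYZ ρ D (T (const a)) X)) =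
      symComp ((arrow ρ D).flip ∘ₗ σ) (-mulVarₗ F M) (const a) (expand (-1) (rotVars F X))
    rw [hTc, expand_rotVars_rightYZ_const, symComp_const_left]
    rfl
  · intro f
    change (∀ X, expand (-1) (rotVars F (rightYZ ρ D (T f) X)) =
        symComp ((arrow ρ D).flip ∘ₗ σ) (-mulVarₗ F M) f (expand (-1) (rotVars F X))) ↔
      ∀ X, expand (-1) (rotVars F (rightYZ ρ D (T (mulVar f)) X)) =
        symComp ((arrow ρ D).flip ∘ₗ σ) (-mulVarₗ F M) (mulVar f) (expand (-1) (rotVars F X))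
    -- A factor `z` on `f` becomes `-(z + D)` on `T f`, that is, multiplication of `X` by `-μ`.
    -- After the expansion this is `λ - ν`, the shift of the outer `λ` by minus the inner variable.
    have h1 : ∀ X : Laurent₃ F M, rightYZ ρ D (T (mulVar f)) X =
        -rightYZ ρ D (T f) (mulY F M X) := fun X => by
      rw [hT, rightYZ_mulY]
      exact map_neg (rightYZₗ ρ D X) _
    have h2 : ∀ X : Laurent₃ F M, shiftOp (-mulVarₗ F M) (expand (-1) (rotVars F X)) =
        -expand (-1) (rotVars F (mulY F M X)) := fun X => by
      rw [expand_rotVars_mulY, neg_sub, shiftOp_apply, sub_eq_add_neg]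
      rfl
    simp only [h1, symComp_mulVar_left, h2, map_neg, neg_inj]
    constructor
    · exact fun H X => H _
    · intro H X
      obtain ⟨Y, rfl⟩ := mulY_surjective X
      exact H Y

end Expansions

/-! ### The three actions on `V ⊗ V ⊗ V` -/

section TripleActions

variable {F : Type*} [Field F]
variable {V : Type*} [Ring V] [Algebra F V]

variable (F V) in
/-- `(u ⊗ v) · (x ⊗ y ⊗ z) = ux ⊗ y ⊗ zv`. -/
def actC : V ⊗[F] V →ₗ[F] V ⊗[F] (V ⊗[F] V) →ₗ[F] V ⊗[F] (V ⊗[F] V) :=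
  TensorProduct.lift (LinearMap.mk₂ F
    (fun u v => TensorProduct.map (LinearMap.mulLeft F u) ((LinearMap.mulRight F v).lTensor V))
    (fun u u' v => by ext; simp [add_mul, TensorProduct.add_tmul])
    (fun c u v => by ext; simp [TensorProduct.smul_tmul'])
    (fun u v v' => by ext; simp [mul_add, TensorProduct.tmul_add])
    (fun c u v => by ext; simp))

variable (F V) in
/-- `(x ⊗ y ⊗ z) · (u ⊗ v) = xu ⊗ vy ⊗ z`. -/
def actA : V ⊗[F] (V ⊗[F] V) →ₗ[F] V ⊗[F] V →ₗ[F] V ⊗[F] (V ⊗[F] V) :=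
  (TensorProduct.lift (LinearMap.mk₂ F
    (fun u v => TensorProduct.map (LinearMap.mulRight F u) ((LinearMap.mulLeft F v).rTensor V))
    (fun u u' v => by ext; simp [mul_add, TensorProduct.add_tmul])
    (fun c u v => by ext; simp [TensorProduct.smul_tmul'])
    (fun u v v' => by ext; simp [add_mul, TensorProduct.add_tmul, TensorProduct.tmul_add])
    (fun c u v => by ext; simp [← TensorProduct.smul_tmul']))).flip

variable (F V) in
/-- `(x ⊗ y ⊗ z) · (u ⊗ v) = x ⊗ yu ⊗ vz`. -/
def actB : V ⊗[F] (V ⊗[F] V) →ₗ[F] V ⊗[F] V →ₗ[F] V ⊗[F] (V ⊗[F] V) :=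
  (TensorProduct.lift (LinearMap.mk₂ F
    (fun u v => (TensorProduct.map (LinearMap.mulRight F u) (LinearMap.mulLeft F v)).lTensor V)
    (fun u u' v => by ext; simp [mul_add, TensorProduct.add_tmul, TensorProduct.tmul_add])
    (fun c u v => by ext; simp [← TensorProduct.smul_tmul'])
    (fun u v v' => by ext; simp [add_mul, TensorProduct.tmul_add])
    (fun c u v => by ext; simp))).flip

/-- The action of `∂` on `V ⊗ V ⊗ V`. -/
def tripleDer (d : V →ₗ[F] V) : V ⊗[F] (V ⊗[F] V) →ₗ[F] V ⊗[F] (V ⊗[F] V) :=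
  d.rTensor (V ⊗[F] V) + (tensorDer d).lTensor V

@[simp]
lemma actC_tmul (u v x y z : V) :
    actC F V (u ⊗ₜ v) (x ⊗ₜ (y ⊗ₜ z)) = (u * x) ⊗ₜ (y ⊗ₜ (z * v)) := rfl

@[simp]
lemma actA_tmul (u v x y z : V) :
    actA F V (x ⊗ₜ (y ⊗ₜ z)) (u ⊗ₜ v) = (x * u) ⊗ₜ ((v * y) ⊗ₜ z) := rfl

@[simp]
lemma actB_tmul (u v x y z : V) :
    actB F V (x ⊗ₜ (y ⊗ₜ z)) (u ⊗ₜ v) = x ⊗ₜ ((y * u) ⊗ₜ (v * z)) := rfl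

@[simp]
lemma tripleDer_tmul (d : V →ₗ[F] V) (x y z : V) : tripleDer d (x ⊗ₜ[F] (y ⊗ₜ[F] z)) =
    d x ⊗ₜ (y ⊗ₜ z) + (x ⊗ₜ (d y ⊗ₜ z) + x ⊗ₜ (y ⊗ₜ d z)) := by
  rw [← TensorProduct.tmul_add]
  rfl

@[simp]
lemma tensorRight_tmul (x y z : V) : tensorRight F V (x ⊗ₜ y) z = x ⊗ₜ (y ⊗ₜ z) := rfl

@[simp]
lemma tensorLeft_tmul (x y z : V) : tensorLeft F V (x ⊗ₜ y) z = z ⊗ₜ (x ⊗ₜ y) := rfl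

@[simp]
lemma tensorMid_tmul (x y z : V) : tensorMid F V (x ⊗ₜ y) z = x ⊗ₜ (z ⊗ₜ y) := rfl

@[elab_as_elim]
theorem triple_induction {p : V ⊗[F] (V ⊗[F] V) → Prop} (w : V ⊗[F] (V ⊗[F] V)) (zero : p 0)
    (tmul : ∀ x y z, p (x ⊗ₜ (y ⊗ₜ z))) (add : ∀ w w', p w → p w' → p (w + w')) : p w := by
  induction w with
  | zero => exact zero
  | add w w' hw hw' => exact add _ _ hw hw'
  | tmul x t =>
    induction t with
    | zero => rwa [TensorProduct.tmul_zero]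
    | add t t' ht ht' =>
      rw [TensorProduct.tmul_add]
      exact add _ _ ht ht'
    | tmul y z => exact tmul x y z

lemma actC_bullet (u v : V ⊗[F] V) (w : V ⊗[F] (V ⊗[F] V)) :
    actC F V (bullet F V u v) w = actC F V u (actC F V v w) := by
  induction u with
  | zero => simp
  | add u u' hu hu' => simp only [map_add, LinearMap.add_apply, hu, hu']
  | tmul a b =>
    induction v with
    | zero => simp
    | add v v' hv hv' => simp only [map_add, LinearMap.add_apply, hv, hv']
    | tmul a' b' =>
      induction w using triple_induction with
      | zero => simp
      | add w w' hw hw' => simp only [map_add, hw, hw']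
      | tmul x y z => simp [mul_assoc]

lemma actA_bullet (w : V ⊗[F] (V ⊗[F] V)) (u v : V ⊗[F] V) :
    actA F V w (bullet F V u v) = actA F V (actA F V w u) v := by
  induction u with
  | zero => simp
  | add u u' hu hu' => simp only [map_add, LinearMap.add_apply, hu, hu']
  | tmul a b =>
    induction v with
    | zero => simp
    | add v v' hv hv' => simp only [map_add, hv, hv']
    | tmul a' b' =>
      induction w using triple_induction with
      | zero => simp
      | add w w' hw hw' => simp only [map_add, LinearMap.add_apply, hw, hw']
      | tmul x y z => simp [mul_assoc]

lemma actB_bullet (w : V ⊗[F] (V ⊗[F] V)) (u v : V ⊗[F] V) :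
    actB F V w (bullet F V u v) = actB F V (actB F V w u) v := by
  induction u with
  | zero => simp
  | add u u' hu hu' => simp only [map_add, LinearMap.add_apply, hu, hu']
  | tmul a b =>
    induction v with
    | zero => simp
    | add v v' hv hv' => simp only [map_add, hv, hv']
    | tmul a' b' =>
      induction w using triple_induction with
      | zero => simp
      | add w w' hw hw' => simp only [map_add, LinearMap.add_apply, hw, hw']
      | tmul x y z => simp [mul_assoc]

/-- `actC` multiplies at the two outer ends, `actA` in the gap between the first two factors, `actB`
in the gap between the last two. No two of them multiply a factor on the same side, so they commute.
-/
lemma actC_actA (u : V ⊗[F] V) (w : V ⊗[F] (V ⊗[F] V)) (v : V ⊗[F] V) :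
    actC F V u (actA F V w v) = actA F V (actC F V u w) v := by
  induction u with
  | zero => simp
  | add u u' hu hu' => simp only [map_add, LinearMap.add_apply, hu, hu']
  | tmul a b =>
    induction v with
    | zero => simp
    | add v v' hv hv' => simp only [map_add, hv, hv']
    | tmul a' b' =>
      induction w using triple_induction with
      | zero => simp
      | add w w' hw hw' => simp only [map_add, LinearMap.add_apply, hw, hw']
      | tmul x y z => simp [mul_assoc]

lemma actC_actB (u : V ⊗[F] V) (w : V ⊗[F] (V ⊗[F] V)) (v : V ⊗[F] V) :
    actC F V u (actB F V w v) = actB F V (actC F V u w) v := by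
  induction u with
  | zero => simp
  | add u u' hu hu' => simp only [map_add, LinearMap.add_apply, hu, hu']
  | tmul a b =>
    induction v with
    | zero => simp
    | add v v' hv hv' => simp only [map_add, hv, hv']
    | tmul a' b' =>
      induction w using triple_induction with
      | zero => simp
      | add w w' hw hw' => simp only [map_add, LinearMap.add_apply, hw, hw']
      | tmul x y z => simp [mul_assoc]

lemma actA_actB (w : V ⊗[F] (V ⊗[F] V)) (u v : V ⊗[F] V) :
    actA F V (actB F V w u) v = actB F V (actA F V w v) u := by
  induction u with
  | zero => simp
  | add u u' hu hu' => simp only [map_add, LinearMap.add_apply, hu, hu']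
  | tmul a b =>
    induction v with
    | zero => simp
    | add v v' hv hv' => simp only [map_add, LinearMap.add_apply, hv, hv']
    | tmul a' b' =>
      induction w using triple_induction with
      | zero => simp
      | add w w' hw hw' => simp only [map_add, LinearMap.add_apply, hw, hw']
      | tmul x y z => simp [mul_assoc]

lemma one_actC (w : V ⊗[F] (V ⊗[F] V)) : actC F V (1 ⊗ₜ 1) w = w := by
  induction w using triple_induction with
  | zero => simp
  | add w w' hw hw' => simp only [map_add, hw, hw']
  | tmul x y z => simp

lemma actA_one (w : V ⊗[F] (V ⊗[F] V)) : actA F V w (1 ⊗ₜ 1) = w := by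
  induction w using triple_induction with
  | zero => simp
  | add w w' hw hw' => simp only [map_add, LinearMap.add_apply, hw, hw']
  | tmul x y z => simp

lemma actB_one (w : V ⊗[F] (V ⊗[F] V)) : actB F V w (1 ⊗ₜ 1) = w := by
  induction w using triple_induction with
  | zero => simp
  | add w w' hw hw' => simp only [map_add, LinearMap.add_apply, hw, hw']
  | tmul x y z => simp

variable {d : V →ₗ[F] V}

lemma tripleDer_actC (hd : ∀ a b, d (a * b) = d a * b + a * d b) (u : V ⊗[F] V)
    (w : V ⊗[F] (V ⊗[F] V)) : tripleDer d (actC F V u w) =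
      actC F V (tensorDer d u) w + actC F V u (tripleDer d w) := by
  induction u with
  | zero => simp
  | add u u' hu hu' =>
    simp only [map_add, LinearMap.add_apply, hu, hu']
    abel
  | tmul a b =>
    induction w using triple_induction with
    | zero => simp
    | add w w' hw hw' =>
      simp only [map_add, hw, hw']
      abel
    | tmul x y z =>
      simp only [actC_tmul, tripleDer_tmul, tensorDer_tmul, hd, map_add, LinearMap.add_apply,
        TensorProduct.tmul_add, TensorProduct.add_tmul]
      abel

lemma tripleDer_actA (hd : ∀ a b, d (a * b) = d a * b + a * d b)
    (w : V ⊗[F] (V ⊗[F] V)) (u : V ⊗[F] V) : tripleDer d (actA F V w u) =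
      actA F V (tripleDer d w) u + actA F V w (tensorDer d u) := by
  induction u with
  | zero => simp
  | add u u' hu hu' =>
    simp only [map_add, hu, hu']
    abel
  | tmul a b =>
    induction w using triple_induction with
    | zero => simp
    | add w w' hw hw' =>
      simp only [map_add, LinearMap.add_apply, hw, hw']
      abel
    | tmul x y z =>
      simp only [actA_tmul, tripleDer_tmul, tensorDer_tmul, hd, map_add, LinearMap.add_apply,
        TensorProduct.tmul_add, TensorProduct.add_tmul]
      abel

lemma tripleDer_actB (hd : ∀ a b, d (a * b) = d a * b + a * d b)
    (w : V ⊗[F] (V ⊗[F] V)) (u : V ⊗[F] V) : tripleDer d (actB F V w u) =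
      actB F V (tripleDer d w) u + actB F V w (tensorDer d u) := by
  induction u with
  | zero => simp
  | add u u' hu hu' =>
    simp only [map_add, hu, hu']
    abel
  | tmul a b =>
    induction w using triple_induction with
    | zero => simp
    | add w w' hw hw' =>
      simp only [map_add, LinearMap.add_apply, hw, hw']
      abel
    | tmul x y z =>
      simp only [actB_tmul, tripleDer_tmul, tensorDer_tmul, hd, map_add, LinearMap.add_apply,
        TensorProduct.tmul_add, TensorProduct.add_tmul]
      abel

end TripleActions

/-! ### Derivations of the algebra of symbols into differential bimodules -/

section DiffBimodule

variable {F : Type*} [Field F]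
variable {V : Type*} [Ring V] [Algebra F V]
variable {U : Type*} [AddCommGroup U] [Module F U]

/-- `U` is a differential bimodule over `(V ⊗ V, •)`, with left action `ℓ`, right action `ρ` and
derivation `δ`. -/
structure IsDiffBimodule (d : V →ₗ[F] V) (ℓ : V ⊗[F] V →ₗ[F] U →ₗ[F] U)
    (ρ : U →ₗ[F] V ⊗[F] V →ₗ[F] U) (δ : U →ₗ[F] U) : Prop where
  mul_left : ∀ u v x, ℓ (bullet F V u v) x = ℓ u (ℓ v x)
  mul_right : ∀ x u v, ρ x (bullet F V u v) = ρ (ρ x u) v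
  left_right : ∀ u x v, ρ (ℓ u x) v = ℓ u (ρ x v)
  one_left : ∀ x, ℓ (1 ⊗ₜ 1) x = x
  one_right : ∀ x, ρ x (1 ⊗ₜ 1) = x
  der_left : ∀ u x, δ (ℓ u x) = ℓ (tensorDer d u) x + ℓ u (δ x)
  der_right : ∀ x u, δ (ρ x u) = ρ (δ x) u + ρ x (tensorDer d u)

variable {d : V →ₗ[F] V} {ℓ : V ⊗[F] V →ₗ[F] U →ₗ[F] U} {ρ : U →ₗ[F] V ⊗[F] V →ₗ[F] U}
  {δ : U →ₗ[F] U}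

/-- The values of `brL` and `brR` are series in the variable of the outer bracket, and
sesquilinearity makes `∂` act on them as that variable plus `∂`. -/
lemma IsDiffBimodule.invLaurent (h : IsDiffBimodule d ℓ ρ δ) :
    IsDiffBimodule d (mapCoeffHom ℓ) (mapCoeff₂ ρ) (shiftOp δ) where
  mul_left u v x := InvLaurent.ext fun n => h.mul_left u v (x.1 n)
  mul_right x u v := InvLaurent.ext fun n => h.mul_right (x.1 n) u v
  left_right u x v := InvLaurent.ext fun n => h.left_right u (x.1 n) v
  one_left x := InvLaurent.ext fun n => h.one_left (x.1 n)
  one_right x := InvLaurent.ext fun n => h.one_right (x.1 n)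
  der_left u x := InvLaurent.ext fun n => by
    simp only [mapCoeffHom_apply, shiftOp_apply, InvLaurent.add_coeff, mulVar_coeff,
      mapCoeff_coeff, h.der_left, map_add]
    abel
  der_right x u := InvLaurent.ext fun n => by
    simp only [shiftOp_apply, InvLaurent.add_coeff, mulVar_coeff, mapCoeff₂_coeff,
      mapCoeff_coeff, h.der_right, map_add, LinearMap.add_apply]
    abel

/-- The value of the map induced by a derivation `Λ` on `p - q E r`, where `E` is the inverse of
`C`. -/
theorem IsDiffBimodule.mapCoeff_sub_sandwich (h : IsDiffBimodule d ℓ ρ δ)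
    (hd : ∀ a b, d (a * b) = d a * b + a * d b) {Λ : V ⊗[F] V →ₗ[F] U}
    (hΛ : ∀ u v, Λ (bullet F V u v) = ρ (Λ u) v + ℓ u (Λ v))
    (hΛd : ∀ u, Λ (tensorDer d u) = δ (Λ u)) {m : ℕ}
    {C E : Matrix (Fin m) (Fin m) (InvLaurent F (V ⊗[F] V))} (hE : IsInverse d C E)
    (p : InvLaurent F (V ⊗[F] V)) (q r : Fin m → InvLaurent F (V ⊗[F] V)) :
    mapCoeff Λ (p - ∑ α, ∑ β, symMul d (q β) (symMul d (E β α) (r α))) =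
      mapCoeff Λ p -
        ∑ β, symComp ρ (tensorDer d) (mapCoeff Λ (q β)) (∑ α, symMul d (E β α) (r α)) -
        ∑ α, symComp ℓ δ (∑ β, symMul d (q β) (E β α)) (mapCoeff Λ (r α)) +
        ∑ γ, ∑ ε, symComp ℓ δ (∑ β, symMul d (q β) (E β γ))
          (symComp ρ (tensorDer d) (mapCoeff Λ (C γ ε)) (∑ α, symMul d (E ε α) (r α))) := by
  refine derivation_sub_sandwich (mul := symMul d) (lft := symComp ℓ δ)
    (rgt := symComp ρ (tensorDer d)) (one := const (1 ⊗ₜ 1)) (one_symMul _) ?_ ?_ ?_ ?_ ?_ ?_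
    (fun i j => congrFun (congrFun hE.1 i) j) (fun i j => congrFun (congrFun hE.2 i) j) p q r
  · exact symComp_assoc h.der_left h.mul_left
  · exact fun X f g => (symComp_assoc (tensorDer_bullet hd)
      (fun x u v => (h.mul_right x u v).symm) X f g).symm
  · exact symComp_assoc h.der_right h.left_right
  · intro X
    rw [symComp_const_left]
    exact InvLaurent.ext fun n => h.one_left _
  · intro X
    rw [symComp_const_right _ (tensorDer_one hd)]
    exact InvLaurent.ext fun n => h.one_right _
  · exact mapCoeff_symComp_add Λ ρ (tensorDer d) Λ LinearMap.id ℓ δ LinearMap.id Λ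
      (fun _ => rfl) hΛd hΛ

lemma isDiffBimodule_actB (hd : ∀ a b, d (a * b) = d a * b + a * d b) :
    IsDiffBimodule d (actC F V) (actB F V) (tripleDer d) where
  mul_left := actC_bullet
  mul_right := actB_bullet
  left_right u x v := (actC_actB u x v).symm
  one_left := one_actC
  one_right := actB_one
  der_left := tripleDer_actC hd
  der_right := tripleDer_actB hd

lemma isDiffBimodule_actA (hd : ∀ a b, d (a * b) = d a * b + a * d b) :
    IsDiffBimodule d (actC F V) (actA F V) (tripleDer d) where
  mul_left := actC_bullet
  mul_right := actA_bullet
  left_right u x v := (actC_actA u x v).symm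
  one_left := one_actC
  one_right := actA_one
  der_left := tripleDer_actC hd
  der_right := tripleDer_actA hd

/-- The bimodule of the third nested bracket consists of series in `ν`. The right action fills the
first gap; the left action fills the second gap with the flipped tensor, and both shift `ν` by `∂`.
The derivation is `-ν`, by sesquilinearity in the first argument. -/
lemma isDiffBimodule_arrow (hd : ∀ a b, d (a * b) = d a * b + a * d b) :
    IsDiffBimodule d ((arrow (actB F V) (tensorDer d)).flip ∘ₗ flipTensor F V)
      (arrow (actA F V) (tensorDer d)) (-mulVarₗ F (V ⊗[F] (V ⊗[F] V))) where
  mul_left u v x := by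
    simp only [LinearMap.comp_apply, LinearMap.flip_apply, flipTensor_bullet]
    exact (arrow_arrow (actB F V) (actB F V) (actB F V) (bullet F V) (tensorDer_bullet hd)
      (fun x y z => (actB_bullet x y z).symm) x _ _).symm
  mul_right x u v := (arrow_arrow (actA F V) (actA F V) (actA F V) (bullet F V)
    (tensorDer_bullet hd) (fun x y z => (actA_bullet x y z).symm) x u v).symm
  left_right u x v := arrow_comm actA_actB (tensorDer d) x (flipTensor F V u) v
  one_left x := by
    simp only [LinearMap.comp_apply, LinearMap.flip_apply, flipTensor_tmul, arrow_apply]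
    rw [symComp_const_right _ (tensorDer_one hd)]
    exact InvLaurent.ext fun n => actB_one _
  one_right x := by
    rw [arrow_apply, symComp_const_right _ (tensorDer_one hd)]
    exact InvLaurent.ext fun n => actA_one _
  der_left u x := by
    simp only [LinearMap.comp_apply, LinearMap.flip_apply, LinearMap.neg_apply, mulVarₗ_apply,
      flipTensor_tensorDer, map_neg, arrow_mulVar]
    abel
  der_right x u := by
    simp only [LinearMap.neg_apply, mulVarₗ_apply, map_neg, arrow_mulVar]
    abel

end DiffBimodule

/-! ### Nested brackets as derivations -/

section NestedBrackets

variable {F : Type*} [Field F]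
variable {V : Type*} [Ring V] [Algebra F V]
variable {d : V →ₗ[F] V} {br : LambdaMap F V}

@[simp]
lemma brL_tmul (a x y : V) : brL br a (x ⊗ₜ y) =
    mapCoeff ((tensorRight F V).flip y) (br a x) := rfl

@[simp]
lemma brR_tmul (a x y : V) : brR br a (x ⊗ₜ y) =
    mapCoeff ((tensorLeft F V).flip x) (br a y) := rfl

@[simp]
lemma brFst_tmul (c x y : V) : brFst d br c (x ⊗ₜ y) = arrow (tensorMid F V) d (br x c) y := rfl

/-- Leibniz on `x x'`: in `{{a x}} x' ⊗ y' y` the new factors fill the second gap, in `x {{a x'}} ⊗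
y' y` they multiply the outer ends. -/
lemma brL_bullet (hb : IsLambdaBracket d br) (a : V) (u v : V ⊗[F] V) :
    brL br a (bullet F V u v) =
      mapCoeff₂ (actB F V) (brL br a u) v + mapCoeffHom (actC F V) u (brL br a v) := by
  induction u with
  | zero => simp
  | add u u' hu hu' =>
    simp only [map_add, LinearMap.add_apply, hu, hu']
    abel
  | tmul x y =>
    induction v with
    | zero => simp
    | add v v' hv hv' =>
      simp only [map_add, hv, hv']
      abel
    | tmul x' y' =>
      refine InvLaurent.ext fun n => ?_
      simp only [bullet_tmul, brL_tmul, hb.leibniz_right, map_add, InvLaurent.add_coeff,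
        mapCoeff_coeff, mapCoeff₂_coeff, mapCoeffHom_apply, LinearMap.flip_apply]
      refine congrArg₂ (· + ·) ?_ ?_
      · generalize (br a x).1 n = w
        induction w with
        | zero => simp
        | add w w' hw hw' => simp only [map_add, LinearMap.add_apply, hw, hw']
        | tmul p r => simp
      · generalize (br a x').1 n = w
        induction w with
        | zero => simp
        | add w w' hw hw' => simp only [map_add, LinearMap.add_apply, hw, hw']
        | tmul p r => simp

lemma tripleDer_tensorRight (w : V ⊗[F] V) (y : V) : tripleDer d (tensorRight F V w y) =
    tensorRight F V (tensorDer d w) y + tensorRight F V w (d y) := by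
  induction w with
  | zero => simp
  | add w w' hw hw' =>
    simp only [map_add, LinearMap.add_apply, hw, hw']
    abel
  | tmul p r => simp [add_assoc]

lemma tripleDer_tensorLeft (w : V ⊗[F] V) (x : V) : tripleDer d (tensorLeft F V w x) =
    tensorLeft F V (tensorDer d w) x + tensorLeft F V w (d x) := by
  induction w with
  | zero => simp
  | add w w' hw hw' =>
    simp only [map_add, LinearMap.add_apply, hw, hw']
    abel
  | tmul p r =>
    simp only [tensorLeft_tmul, tripleDer_tmul, tensorDer_tmul, map_add, LinearMap.add_apply]
    abel

lemma tripleDer_tensorMid (w : V ⊗[F] V) (y : V) : tripleDer d (tensorMid F V w y) =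
    tensorMid F V (tensorDer d w) y + tensorMid F V w (d y) := by
  induction w with
  | zero => simp
  | add w w' hw hw' =>
    simp only [map_add, LinearMap.add_apply, hw, hw']
    abel
  | tmul p r =>
    simp only [tensorMid_tmul, tripleDer_tmul, tensorDer_tmul, map_add, LinearMap.add_apply]
    abel

lemma brL_tensorDer (hb : IsLambdaBracket d br) (a : V) (u : V ⊗[F] V) :
    brL br a (tensorDer d u) = shiftOp (tripleDer d) (brL br a u) := by
  induction u with
  | zero => simp
  | add u u' hu hu' => simp only [map_add, hu, hu']
  | tmul x y =>
    refine InvLaurent.ext fun n => ?_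
    simp only [tensorDer_tmul, map_add, brL_tmul, hb.sesqui_right, InvLaurent.add_coeff,
      mapCoeff_coeff, mulVar_coeff, shiftOp_apply, LinearMap.flip_apply, tripleDer_tensorRight]
    abel

lemma brR_bullet (hb : IsLambdaBracket d br) (b : V) (u v : V ⊗[F] V) :
    brR br b (bullet F V u v) =
      mapCoeff₂ (actA F V) (brR br b u) v + mapCoeffHom (actC F V) u (brR br b v) := by
  induction u with
  | zero => simp
  | add u u' hu hu' =>
    simp only [map_add, LinearMap.add_apply, hu, hu']
    abel
  | tmul x y =>
    induction v with
    | zero => simp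
    | add v v' hv hv' =>
      simp only [map_add, hv, hv']
      abel
    | tmul x' y' =>
      refine InvLaurent.ext fun n => ?_
      simp only [bullet_tmul, brR_tmul, hb.leibniz_right, map_add, InvLaurent.add_coeff,
        mapCoeff_coeff, mapCoeff₂_coeff, mapCoeffHom_apply, LinearMap.flip_apply]
      -- The second factors multiply as `y' y`, so Leibniz produces the two terms in the opposite
      -- order.
      rw [add_comm]
      refine congrArg₂ (· + ·) ?_ ?_
      · generalize (br b y).1 n = w
        induction w with
        | zero => simp
        | add w w' hw hw' => simp only [map_add, LinearMap.add_apply, hw, hw']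
        | tmul p r => simp
      · generalize (br b y').1 n = w
        induction w with
        | zero => simp
        | add w w' hw hw' => simp only [map_add, LinearMap.add_apply, hw, hw']
        | tmul p r => simp

lemma brR_tensorDer (hb : IsLambdaBracket d br) (b : V) (u : V ⊗[F] V) :
    brR br b (tensorDer d u) = shiftOp (tripleDer d) (brR br b u) := by
  induction u with
  | zero => simp
  | add u u' hu hu' => simp only [map_add, hu, hu']
  | tmul x y =>
    refine InvLaurent.ext fun n => ?_
    simp only [tensorDer_tmul, map_add, brR_tmul, hb.sesqui_right, InvLaurent.add_coeff,
      mapCoeff_coeff, mulVar_coeff, shiftOp_apply, LinearMap.flip_apply, tripleDer_tensorLeft]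
    abel

/-- Both sides insert `x ⊗ (y ⊗ z)` at once, by `p ⊗ r ↦ p x ⊗ y z ⊗ r`, with `∂` acting on the
whole insertion. As `∂` is a derivation, it does not matter whether `y` and `z` are multiplied
before or after. -/
lemma arrow_tensorMid_starRight (hd : ∀ a b, d (a * b) = d a * b + a * d b)
    (f : InvLaurent F (V ⊗[F] V)) (x y z : V) :
    arrow (tensorMid F V) d (arrow (starRight F V) d f x) (y * z) =
      arrow (actA F V) (tensorDer d) (arrow (tensorMid F V) d f z) (x ⊗ₜ y) := by
  let μ : V ⊗[F] V →ₗ[F] V := LinearMap.mul' F V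
  let κ : V ⊗[F] V →ₗ[F] V ⊗[F] (V ⊗[F] V) →ₗ[F] V ⊗[F] (V ⊗[F] V) :=
    LinearMap.flip (TensorProduct.lift (LinearMap.mk₂ F
      (fun x t => (tensorMid F V).flip (μ t) ∘ₗ (starRight F V).flip x)
      (fun x x' t => by ext; simp) (fun c x t => by ext; simp) (fun x t t' => by ext; simp)
      (fun c x t => by ext; simp)))
  have hμ : ∀ t, μ (tensorDer d t) = d (μ t) := fun t => by
    induction t with
    | zero => simp
    | add t t' ht ht' => simp only [map_add, ht, ht']
    | tmul p r => simp [μ, hd]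
  have h0 := mapCoeff_arrow (LinearMap.id : V ⊗[F] (V ⊗[F] V) →ₗ[F] _)
    (β := (tensorMid F V).compl₂ μ) (D := tensorDer d) (tensorMid F V) d LinearMap.id μ hμ
    (fun _ _ => rfl) (arrow (starRight F V) d f x) (y ⊗ₜ z)
  have h1 := arrow_arrow (starRight F V) ((tensorMid F V).compl₂ μ) κ
    (TensorProduct.mk F V (V ⊗[F] V)) (D₂ := d) (D₃ := tensorDer d) (D := tripleDer d)
    (fun _ _ => rfl) (fun _ _ _ => rfl) f x (y ⊗ₜ z)
  have h2 := arrow_arrow (tensorMid F V) (actA F V) κ (tensorRight F V).flip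
    (D₂ := d) (D₃ := tensorDer d) (D := tripleDer d)
    (fun y w => by simp [tripleDer_tensorRight, add_comm]) (fun w y t => by
      induction t with
      | zero => simp
      | add t t' ht ht' => simp only [map_add, ht, ht']
      | tmul p r =>
        induction w with
        | zero => simp
        | add w w' hw hw' => simp only [map_add, LinearMap.add_apply, hw, hw']
        | tmul p' r' => simp [κ, μ]) f z (x ⊗ₜ y)
  exact h0.symm.trans (h1.trans h2.symm)

lemma arrow_tensorMid_starLeft (hd : ∀ a b, d (a * b) = d a * b + a * d b)
    (f : InvLaurent F (V ⊗[F] V)) (x y z : V) :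
    arrow (tensorMid F V) d (arrow (starLeft F V) d f x) (y * z) =
      arrow (actB F V) (tensorDer d) (arrow (tensorMid F V) d f y) (z ⊗ₜ x) := by
  let μ : V ⊗[F] V →ₗ[F] V := LinearMap.mul' F V
  let κ : V ⊗[F] V →ₗ[F] V ⊗[F] (V ⊗[F] V) →ₗ[F] V ⊗[F] (V ⊗[F] V) :=
    LinearMap.flip (TensorProduct.lift (LinearMap.mk₂ F
      (fun x t => (tensorMid F V).flip (μ t) ∘ₗ (starLeft F V).flip x)
      (fun x x' t => by ext; simp) (fun c x t => by ext; simp) (fun x t t' => by ext; simp)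
      (fun c x t => by ext; simp)))
  have hμ : ∀ t, μ (tensorDer d t) = d (μ t) := fun t => by
    induction t with
    | zero => simp
    | add t t' ht ht' => simp only [map_add, ht, ht']
    | tmul p r => simp [μ, hd]
  have h0 := mapCoeff_arrow (LinearMap.id : V ⊗[F] (V ⊗[F] V) →ₗ[F] _)
    (β := (tensorMid F V).compl₂ μ) (D := tensorDer d) (tensorMid F V) d LinearMap.id μ hμ
    (fun _ _ => rfl) (arrow (starLeft F V) d f x) (y ⊗ₜ z)
  have h1 := arrow_arrow (starLeft F V) ((tensorMid F V).compl₂ μ) κ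
    (TensorProduct.mk F V (V ⊗[F] V)) (D₂ := d) (D₃ := tensorDer d) (D := tripleDer d)
    (fun _ _ => rfl) (fun _ _ _ => rfl) f x (y ⊗ₜ z)
  have h2 := arrow_arrow (tensorMid F V) (actB F V) κ ((tensorMid F V) ∘ₗ flipTensor F V).flip
    (D₂ := d) (D₃ := tensorDer d) (D := tripleDer d)
    (fun y w => by simp [tripleDer_tensorMid, add_comm, flipTensor_tensorDer]) (fun w y t => by
      induction t with
      | zero => simp
      | add t t' ht ht' => simp only [map_add, ht, ht']
      | tmul p r =>
        induction w with
        | zero => simp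
        | add w w' hw hw' => simp only [map_add, LinearMap.add_apply, hw, hw']
        | tmul p' r' => simp [κ, μ]) f y (z ⊗ₜ x)
  exact h0.symm.trans (h1.trans h2.symm)

/-- The left Leibniz rule puts `x'` after the first factor and `x` before the last one. With `y' y`
in the middle, `x' ⊗ y'` fills the first gap and `y ⊗ x` the second; this explains the flip. -/
lemma brFst_bullet (hd : ∀ a b, d (a * b) = d a * b + a * d b) (hb : IsLambdaBracket d br)
    (c : V) (u v : V ⊗[F] V) : brFst d br c (bullet F V u v) =
      arrow (actA F V) (tensorDer d) (brFst d br c u) v +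
        ((arrow (actB F V) (tensorDer d)).flip ∘ₗ flipTensor F V) u (brFst d br c v) := by
  induction u with
  | zero => simp
  | add u u' hu hu' =>
    simp only [map_add, LinearMap.add_apply, hu, hu']
    abel
  | tmul x y =>
    induction v with
    | zero => simp
    | add v v' hv hv' =>
      simp only [map_add, hv, hv']
      abel
    | tmul x' y' =>
      simp only [bullet_tmul, brFst_tmul, hb.leibniz_left, map_add, LinearMap.add_apply,
        arrow_tensorMid_starRight hd, arrow_tensorMid_starLeft hd, LinearMap.comp_apply,
        LinearMap.flip_apply, flipTensor_tmul]

lemma brFst_tensorDer (hb : IsLambdaBracket d br) (c : V) (u : V ⊗[F] V) :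
    brFst d br c (tensorDer d u) = (-mulVarₗ F (V ⊗[F] (V ⊗[F] V))) (brFst d br c u) := by
  induction u with
  | zero => simp
  | add u u' hu hu' => simp only [map_add, hu, hu']
  | tmul x y =>
    simp only [tensorDer_tmul, map_add, brFst_tmul, hb.sesqui_left, map_neg, LinearMap.neg_apply,
      arrow_mulVar, mulVarₗ_apply]
    abel

end NestedBrackets

/-! ### The Jacobi identity for the Dirac modification -/

section DiracJacobi

variable {F : Type*} [Field F]
variable {V : Type*} [Ring V] [Algebra F V]
variable (d : V →ₗ[F] V) (br : LambdaMap F V) {m : ℕ} (θ : Fin m → V)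
  (E : Matrix (Fin m) (Fin m) (InvLaurent F (V ⊗[F] V)))

/-- The symbols `∑_α E_{βα}(λ + ∂) • {{a_λ θ_α}}`. -/
def srcSymbol (a : V) (β : Fin m) : InvLaurent F (V ⊗[F] V) :=
  ∑ α, symMul d (E β α) (br a (θ α))

/-- The symbols `∑_β {{θ_β _{λ+∂} c}} • E_{βα}(λ)`. -/
def tgtSymbol (c : V) (α : Fin m) : InvLaurent F (V ⊗[F] V) :=
  ∑ β, symMul d (br (θ β) c) (E β α)

/-- Replacement of the first argument `a` of `T` by `a - ∑_β θ_β srcSymbol a β`. -/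
def projA (T : V → V → V → Laurent₃ F (V ⊗[F] (V ⊗[F] V))) (a b c : V) :
    Laurent₃ F (V ⊗[F] (V ⊗[F] V)) :=
  T a b c - ∑ β, rightXZ (actA F V) (tensorDer d) (srcSymbol d br θ E a β) (T (θ β) b c)

/-- Replacement of the second argument `b` of `T` by `b - ∑_β θ_β srcSymbol b β`. -/
def projB (T : V → V → V → Laurent₃ F (V ⊗[F] (V ⊗[F] V))) (a b c : V) :
    Laurent₃ F (V ⊗[F] (V ⊗[F] V)) :=
  T a b c - ∑ β, rightYZ (actB F V) (tensorDer d) (srcSymbol d br θ E b β) (T a (θ β) c)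

/-- Replacement of the third argument `c` of `T` by `c - ∑_α tgtSymbol c α θ_α`. -/
def projC (T : V → V → V → Laurent₃ F (V ⊗[F] (V ⊗[F] V))) (a b c : V) :
    Laurent₃ F (V ⊗[F] (V ⊗[F] V)) :=
  T a b c - ∑ α, leftZ (actC F V) (tripleDer d) (tgtSymbol d br θ E c α) (T a b (θ α))

variable {d br θ E}

/-- The corrections concern different arguments of `T` and use commuting operators on its values. -/
lemma projA_projB (T : V → V → V → Laurent₃ F (V ⊗[F] (V ⊗[F] V))) :
    projA d br θ E (projB d br θ E T) = projB d br θ E (projA d br θ E T) := by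
  funext a b c
  have hc := rightXZ_rightYZ (actA_actB (F := F) (V := V)) (tensorDer d)
  simp only [projA, projB, map_sub, map_sum, Finset.sum_sub_distrib, hc]
  rw [Finset.sum_comm]
  abel

lemma projC_projA (hd : ∀ a b, d (a * b) = d a * b + a * d b)
    (T : V → V → V → Laurent₃ F (V ⊗[F] (V ⊗[F] V))) :
    projC d br θ E (projA d br θ E T) = projA d br θ E (projC d br θ E T) := by
  funext a b c
  simp only [projA, projC, map_sub, map_sum, Finset.sum_sub_distrib,
    leftZ_rightXZ actC_actA (tripleDer_actA hd)]
  rw [Finset.sum_comm]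
  abel

lemma projC_projB (hd : ∀ a b, d (a * b) = d a * b + a * d b)
    (T : V → V → V → Laurent₃ F (V ⊗[F] (V ⊗[F] V))) :
    projC d br θ E (projB d br θ E T) = projB d br θ E (projC d br θ E T) := by
  funext a b c
  simp only [projB, projC, map_sub, map_sum, Finset.sum_sub_distrib,
    leftZ_rightYZ actC_actB (tripleDer_actB hd)]
  rw [Finset.sum_comm]
  abel

lemma projA_sub (T T' : V → V → V → Laurent₃ F (V ⊗[F] (V ⊗[F] V))) :
    projA d br θ E (T - T') = projA d br θ E T - projA d br θ E T' := by
  funext a b c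
  simp only [projA, Pi.sub_apply, map_sub, Finset.sum_sub_distrib]
  abel

lemma projB_sub (T T' : V → V → V → Laurent₃ F (V ⊗[F] (V ⊗[F] V))) :
    projB d br θ E (T - T') = projB d br θ E T - projB d br θ E T' := by
  funext a b c
  simp only [projB, Pi.sub_apply, map_sub, Finset.sum_sub_distrib]
  abel

lemma projC_sub (T T' : V → V → V → Laurent₃ F (V ⊗[F] (V ⊗[F] V))) :
    projC d br θ E (T - T') = projC d br θ E T - projC d br θ E T' := by
  funext a b c
  simp only [projC, Pi.sub_apply, map_sub, Finset.sum_sub_distrib]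
  abel

/-- Multiples of `ν - λ - μ` are preserved, so a relation in `V^{⊗3}_{λ,μ}` may be corrected
argument by argument. -/
lemma projA_mulRel (T : V → V → V → Laurent₃ F (V ⊗[F] (V ⊗[F] V))) :
    projA d br θ E (fun a b c => mulRel F 1 (T a b c)) =
      fun a b c => mulRel F 1 (projA d br θ E T a b c) := by
  funext a b c
  simp only [projA, rightXZ_mulRel, map_sub, map_sum]

lemma projB_mulRel (T : V → V → V → Laurent₃ F (V ⊗[F] (V ⊗[F] V))) :
    projB d br θ E (fun a b c => mulRel F 1 (T a b c)) =
      fun a b c => mulRel F 1 (projB d br θ E T a b c) := by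
  funext a b c
  simp only [projB, rightYZ_mulRel, map_sub, map_sum]

lemma projC_mulRel (T : V → V → V → Laurent₃ F (V ⊗[F] (V ⊗[F] V))) :
    projC d br θ E (fun a b c => mulRel F 1 (T a b c)) =
      fun a b c => mulRel F 1 (projC d br θ E T a b c) := by
  funext a b c
  simp only [projC, leftZ_mulRel, map_sub, map_sum]

/-! ### Nested Dirac brackets in terms of the original ones -/

lemma dirac_eq_srcSymbol (a b : V) : dirac d br θ E a b =
    br a b - ∑ β, symMul d (br (θ β) b) (srcSymbol d br θ E a β) := by
  rw [dirac_apply, Finset.sum_comm]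
  simp only [srcSymbol, map_sum]

lemma dirac_eq_tgtSymbol (hd : ∀ a b, d (a * b) = d a * b + a * d b) (a b : V) :
    dirac d br θ E a b =
      br a b - ∑ α, symMul d (tgtSymbol d br θ E b α) (br a (θ α)) := by
  rw [dirac_apply]
  simp only [tgtSymbol, map_sum, LinearMap.sum_apply, symMul_assoc hd]

/-- In the third nested bracket `b` is the second argument of the inner bracket, so the sandwich
formula corrects it by left multiplication with `tgtSymbol`. Skewsymmetry converts this into the
correction by `srcSymbol` used in `projB`. -/
lemma adj_tgtSymbol (hd : ∀ a b, d (a * b) = d a * b + a * d b) (hs : IsSkew d br)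
    (hE : IsInverse d (constraintMatrix br θ) E) (b : V) (α : Fin m) :
    adj d (tgtSymbol d br θ E b α) = srcSymbol d br θ E b α := by
  simp only [tgtSymbol, srcSymbol, map_sum, adj_symMul hd, isSkew_iff.1 hs, adj_inverse hd hs hE,
    map_neg, LinearMap.neg_apply, neg_neg]

lemma tensorRight_bullet (u v : V ⊗[F] V) (y : V) : tensorRight F V (bullet F V u v) y =
    actA F V (tensorRight F V u y) v := by
  induction u with
  | zero => simp
  | add u u' hu hu' => simp only [map_add, LinearMap.add_apply, hu, hu']
  | tmul p r =>
    induction v with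
    | zero => simp
    | add v v' hv hv' => simp only [map_add, LinearMap.add_apply, hv, hv']
    | tmul p' r' => simp

lemma tensorLeft_bullet (u v : V ⊗[F] V) (x : V) : tensorLeft F V (bullet F V u v) x =
    actB F V (tensorLeft F V u x) v := by
  induction u with
  | zero => simp
  | add u u' hu hu' => simp only [map_add, LinearMap.add_apply, hu, hu']
  | tmul p r =>
    induction v with
    | zero => simp
    | add v v' hv hv' => simp only [map_add, LinearMap.add_apply, hv, hv']
    | tmul p' r' => simp

lemma tensorMid_bullet (u v : V ⊗[F] V) (y : V) : tensorMid F V (bullet F V u v) y =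
    actC F V u (tensorMid F V v y) := by
  induction u with
  | zero => simp
  | add u u' hu hu' => simp only [map_add, LinearMap.add_apply, hu, hu']
  | tmul p r =>
    induction v with
    | zero => simp
    | add v v' hv hv' => simp only [map_add, LinearMap.add_apply, hv, hv']
    | tmul p' r' => simp

lemma brL_dirac (a : V) (u : V ⊗[F] V) : brL (dirac d br θ E) a u = brL br a u -
    ∑ β, symComp (actA F V) (tensorDer d) (brL br (θ β) u) (srcSymbol d br θ E a β) := by
  induction u with
  | zero => simp
  | add u u' hu hu' =>
    simp only [map_add, hu, hu', LinearMap.add_apply, Finset.sum_add_distrib]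
    abel
  | tmul x y =>
    simp only [brL_tmul, dirac_eq_srcSymbol, map_sub, map_sum]
    refine congrArg₂ (· - ·) rfl (Finset.sum_congr rfl fun β _ => ?_)
    exact mapCoeff_symComp_left _ (actA F V) _ (fun u v => tensorRight_bullet u v y) _ _

lemma brR_dirac (b : V) (u : V ⊗[F] V) : brR (dirac d br θ E) b u = brR br b u -
    ∑ β, symComp (actB F V) (tensorDer d) (brR br (θ β) u) (srcSymbol d br θ E b β) := by
  induction u with
  | zero => simp
  | add u u' hu hu' =>
    simp only [map_add, hu, hu', LinearMap.add_apply, Finset.sum_add_distrib]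
    abel
  | tmul x y =>
    simp only [brR_tmul, dirac_eq_srcSymbol, map_sub, map_sum]
    refine congrArg₂ (· - ·) rfl (Finset.sum_congr rfl fun β _ => ?_)
    exact mapCoeff_symComp_left _ (actB F V) _ (fun u v => tensorLeft_bullet u v x) _ _

lemma brFst_dirac (hd : ∀ a b, d (a * b) = d a * b + a * d b) (c : V) (u : V ⊗[F] V) :
    brFst d (dirac d br θ E) c u = brFst d br c u -
      ∑ α, symComp (actC F V) (tripleDer d) (tgtSymbol d br θ E c α) (brFst d br (θ α) u) := by
  induction u with
  | zero => simp
  | add u u' hu hu' =>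
    simp only [map_add, hu, hu', Finset.sum_add_distrib]
    abel
  | tmul x y =>
    simp only [brFst_tmul, dirac_eq_tgtSymbol hd, map_sub, map_sum, LinearMap.sub_apply,
      LinearMap.sum_apply]
    refine congrArg₂ (· - ·) rfl (Finset.sum_congr rfl fun β _ => ?_)
    exact symComp_arrow tripleDer_tensorMid tensorMid_bullet _ _ y

/-- The inner modification corrects `b` and `c` through the sandwich formula, the outer one corrects
`a`. -/
lemma nestedL_dirac (hd : ∀ a b, d (a * b) = d a * b + a * d b) (hb : IsLambdaBracket d br)
    (hE : IsInverse d (constraintMatrix br θ) E)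
    {T : V → V → V → Laurent₃ F (V ⊗[F] (V ⊗[F] V))}
    (hT : ∀ a b c, expand 1 (T a b c) = nestedL br a b c) (a b c : V) :
    expand 1 (projA d br θ E (projC d br θ E (projB d br θ E T)) a b c) =
      nestedL (dirac d br θ E) a b c := by
  -- The four terms of the sandwich formula are those of the two successive corrections, the term
  -- with `Δ(C)` being the one with both. The first argument stays general because `projA` also
  -- evaluates at `θ β`.
  have h1 : ∀ a, expand 1 (projC d br θ E (projB d br θ E T) a b c) =
      mapCoeff (brL br a) (dirac d br θ E b c) := fun a => by
    have h0 : mapCoeff (brL br a) (dirac d br θ E b c) = nestedL br a b c -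
        ∑ β, symComp (mapCoeff₂ (actB F V)) (tensorDer d) (nestedL br a (θ β) c)
          (srcSymbol d br θ E b β) -
        ∑ α, symComp (mapCoeffHom (actC F V)) (shiftOp (tripleDer d)) (tgtSymbol d br θ E c α)
          (nestedL br a b (θ α)) +
        ∑ γ, ∑ ε, symComp (mapCoeffHom (actC F V)) (shiftOp (tripleDer d))
          (tgtSymbol d br θ E c γ) (symComp (mapCoeff₂ (actB F V)) (tensorDer d)
            (nestedL br a (θ ε) (θ γ)) (srcSymbol d br θ E b ε)) := by
      rw [dirac_apply]
      exact (isDiffBimodule_actB hd).invLaurent.mapCoeff_sub_sandwich hd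
        (brL_bullet hb a) (brL_tensorDer hb a) hE _ _ _
    rw [h0]
    simp only [projC, projB, map_sub, map_sum, expand_leftZ, expand_rightYZ, hT,
      Finset.sum_sub_distrib]
    abel
  have h2 : nestedL (dirac d br θ E) a b c = mapCoeff (brL br a) (dirac d br θ E b c) -
      ∑ β, mapCoeff ((symComp (actA F V) (tensorDer d)).flip (srcSymbol d br θ E a β))
        (mapCoeff (brL br (θ β)) (dirac d br θ E b c)) := by
    refine InvLaurent.ext fun n => ?_
    rw [InvLaurent.sub_coeff, ← coeffₗ_apply n (∑ β, _), map_sum]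
    exact brL_dirac a _
  rw [h2, projA, map_sub, map_sum, h1]
  simp only [expand_rightXZ, h1]

lemma nestedR_dirac (hd : ∀ a b, d (a * b) = d a * b + a * d b) (hb : IsLambdaBracket d br)
    (hE : IsInverse d (constraintMatrix br θ) E)
    {T : V → V → V → Laurent₃ F (V ⊗[F] (V ⊗[F] V))}
    (hT : ∀ a b c, expand 1 (swapVars F (T a b c)) = nestedR br a b c) (a b c : V) :
    expand 1 (swapVars F (projB d br θ E (projC d br θ E (projA d br θ E T)) a b c)) =
      nestedR (dirac d br θ E) a b c := by
  have h1 : ∀ b, expand 1 (swapVars F (projC d br θ E (projA d br θ E T) a b c)) =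
      mapCoeff (brR br b) (dirac d br θ E a c) := fun b => by
    have h0 : mapCoeff (brR br b) (dirac d br θ E a c) = nestedR br a b c -
        ∑ β, symComp (mapCoeff₂ (actA F V)) (tensorDer d) (nestedR br (θ β) b c)
          (srcSymbol d br θ E a β) -
        ∑ α, symComp (mapCoeffHom (actC F V)) (shiftOp (tripleDer d)) (tgtSymbol d br θ E c α)
          (nestedR br a b (θ α)) +
        ∑ γ, ∑ ε, symComp (mapCoeffHom (actC F V)) (shiftOp (tripleDer d))
          (tgtSymbol d br θ E c γ) (symComp (mapCoeff₂ (actA F V)) (tensorDer d)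
            (nestedR br (θ ε) b (θ γ)) (srcSymbol d br θ E a ε)) := by
      rw [dirac_apply]
      exact (isDiffBimodule_actA hd).invLaurent.mapCoeff_sub_sandwich hd
        (brR_bullet hb b) (brR_tensorDer hb b) hE _ _ _
    rw [h0]
    simp only [projC, projA, map_sub, map_sum, ← leftZ_swapVars, ← rightYZ_swapVars,
      expand_leftZ, expand_rightYZ, hT, Finset.sum_sub_distrib]
    abel
  have h2 : nestedR (dirac d br θ E) a b c = mapCoeff (brR br b) (dirac d br θ E a c) -
      ∑ β, mapCoeff ((symComp (actB F V) (tensorDer d)).flip (srcSymbol d br θ E b β))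
        (mapCoeff (brR br (θ β)) (dirac d br θ E a c)) := by
    refine InvLaurent.ext fun n => ?_
    rw [InvLaurent.sub_coeff, ← coeffₗ_apply n (∑ β, _), map_sum]
    exact brR_dirac b _
  rw [h2, projB, map_sub, map_sub, map_sum, map_sum, h1]
  simp only [← rightXZ_swapVars, expand_rightXZ, h1]

/-- Now the inner modification corrects `a` and `b`, and the outer one corrects `c`. Skewsymmetry
enters through `adj_tgtSymbol`, to match the correction of `b` with `projB`. -/
lemma nestedFst_dirac (hd : ∀ a b, d (a * b) = d a * b + a * d b) (hb : IsLambdaBracket d br)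
    (hs : IsSkew d br) (hE : IsInverse d (constraintMatrix br θ) E)
    {T : V → V → V → Laurent₃ F (V ⊗[F] (V ⊗[F] V))}
    (hT : ∀ a b c, expand (-1) (rotVars F (T a b c)) = nestedFst d br a b c) (a b c : V) :
    expand (-1) (rotVars F (projC d br θ E (projB d br θ E (projA d br θ E T)) a b c)) =
      nestedFst d (dirac d br θ E) a b c := by
  have hadj : ∀ (f : InvLaurent F (V ⊗[F] V)) (X : Laurent₃ F (V ⊗[F] (V ⊗[F] V))),
      expand (-1) (rotVars F (rightYZ (actB F V) (tensorDer d) (adj d f) X)) =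
        symComp ((arrow (actB F V) (tensorDer d)).flip ∘ₗ flipTensor F V) (-mulVarₗ F _) f
          (expand (-1) (rotVars F X)) :=
    expand_rotVars_rightYZ (actB F V) (tensorDer d) (flipTensor F V) (adj d)
      (fun _ _ hf => hf.adj) adj_const adj_mulVar
  have h1 : ∀ c, expand (-1) (rotVars F (projB d br θ E (projA d br θ E T) a b c)) =
      mapCoeff (brFst d br c) (dirac d br θ E a b) := fun c => by
    have h0 : mapCoeff (brFst d br c) (dirac d br θ E a b) = nestedFst d br a b c -
        ∑ β, symComp (arrow (actA F V) (tensorDer d)) (tensorDer d) (nestedFst d br (θ β) b c)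
          (srcSymbol d br θ E a β) -
        ∑ α, symComp ((arrow (actB F V) (tensorDer d)).flip ∘ₗ flipTensor F V) (-mulVarₗ F _)
          (tgtSymbol d br θ E b α) (nestedFst d br a (θ α) c) +
        ∑ γ, ∑ ε, symComp ((arrow (actB F V) (tensorDer d)).flip ∘ₗ flipTensor F V)
          (-mulVarₗ F _) (tgtSymbol d br θ E b γ) (symComp (arrow (actA F V) (tensorDer d))
            (tensorDer d) (nestedFst d br (θ ε) (θ γ) c) (srcSymbol d br θ E a ε)) := by
      rw [dirac_apply]
      exact (isDiffBimodule_arrow hd).mapCoeff_sub_sandwich hd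
        (brFst_bullet hd hb c) (brFst_tensorDer hb c) hE _ _ _
    rw [h0]
    simp only [projB, projA, map_sub, map_sum, ← adj_tgtSymbol hd hs hE b, hadj,
      expand_rotVars_rightXZ, hT, Finset.sum_sub_distrib]
    abel
  have h2 : nestedFst d (dirac d br θ E) a b c = mapCoeff (brFst d br c) (dirac d br θ E a b) -
      ∑ α, mapCoeff (symComp (actC F V) (tripleDer d) (tgtSymbol d br θ E c α))
        (mapCoeff (brFst d br (θ α)) (dirac d br θ E a b)) := by
    refine InvLaurent.ext fun n => ?_
    rw [InvLaurent.sub_coeff, ← coeffₗ_apply n (∑ β, _), map_sum]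
    exact brFst_dirac hd c _
  rw [h2, projC, map_sub, map_sub, map_sum, map_sum, h1]
  simp only [expand_rotVars_leftZ, h1]

/-- The Jacobi identity in terms of representatives in `M[[λ⁻¹, μ⁻¹, ν⁻¹]][λ, μ, ν]`. -/
lemma isJacobi_iff : IsJacobi d br ↔ ∀ a b c, ∃ X Y Z Q : Laurent₃ F (V ⊗[F] (V ⊗[F] V)),
    expand 1 X = nestedL br a b c ∧ expand 1 (swapVars F Y) = nestedR br a b c ∧
      expand (-1) (rotVars F Z) = nestedFst d br a b c ∧ X - Y - Z = mulRel F 1 Q := by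
  constructor
  · intro h a b c
    obtain ⟨X, Y, Z, hX, hY, hZ, hXYZ⟩ := h a b c
    obtain ⟨X, rfl⟩ := Submodule.Quotient.mk_surjective _ X
    obtain ⟨Y, rfl⟩ := Submodule.Quotient.mk_surjective _ Y
    obtain ⟨Z, rfl⟩ := Submodule.Quotient.mk_surjective _ Z
    rw [← Submodule.Quotient.mk_sub, Submodule.Quotient.eq] at hXYZ
    obtain ⟨Q, hQ⟩ := hXYZ
    exact ⟨X, Y, Z, Q, hX, hY, hZ, hQ.symm⟩
  · intro h a b c
    obtain ⟨X, Y, Z, Q, hX, hY, hZ, hQ⟩ := h a b c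
    refine ⟨Submodule.Quotient.mk X, Submodule.Quotient.mk Y, Submodule.Quotient.mk Z, hX, hY, hZ,
      ?_⟩
    rw [← Submodule.Quotient.mk_sub, Submodule.Quotient.eq]
    exact ⟨Q, hQ.symm⟩

/-- The Jacobi identity as formulated already supplies the element of `V^{⊗3}_{λ,μ}` representing
the first term. -/
lemma IsJacobi.isAdmissible (h : IsJacobi d br) : IsAdmissible br := fun a b c => by
  obtain ⟨X, -, -, hX, -⟩ := h a b c
  exact ⟨X, hX⟩

/-- The Dirac modification satisfies the Jacobi identity. -/
theorem IsJacobi.dirac (hd : ∀ a b, d (a * b) = d a * b + a * d b) (hb : IsLambdaBracket d br)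
    (hs : IsSkew d br) (hJ : IsJacobi d br) (hE : IsInverse d (constraintMatrix br θ) E) :
    IsJacobi d (dirac d br θ E) := by
  rw [isJacobi_iff] at hJ ⊢
  -- Representatives are fixed for all triples at once, since the corrections also evaluate them at
  -- the `θ`s. The choice need not be linear in the arguments.
  choose X Y Z Q hX hY hZ hQ using hJ
  intro a b c
  refine ⟨_, _, _, projA d br θ E (projC d br θ E (projB d br θ E Q)) a b c,
    nestedL_dirac hd hb hE hX a b c, nestedR_dirac hd hb hE hY a b c,
    nestedFst_dirac hd hb hs hE hZ a b c, ?_⟩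
  -- The three terms arise with the corrections in different orders, which commutation makes equal.
  have hY' : projB d br θ E (projC d br θ E (projA d br θ E Y)) =
      projA d br θ E (projC d br θ E (projB d br θ E Y)) := by
    rw [projC_projA hd, ← projA_projB, projC_projB hd]
  have hZ' : projC d br θ E (projB d br θ E (projA d br θ E Z)) =
      projA d br θ E (projC d br θ E (projB d br θ E Z)) := by
    rw [← projA_projB, projC_projA hd]
  have hQ' : X - Y - Z = fun a b c => mulRel F 1 (Q a b c) :=
    funext fun a => funext fun b => funext fun c => hQ a b c
  have h := congrArg (fun T => projA d br θ E (projC d br θ E (projB d br θ E T)) a b c) hQ'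
  simp only [projA_sub, projB_sub, projC_sub, projA_mulRel, projB_mulRel, projC_mulRel,
    Pi.sub_apply] at h
  rw [hY', hZ', h]

/-- The Dirac modification is again a non-local double Poisson vertex algebra. -/
theorem IsNonlocalDoublePVA.dirac (h : IsNonlocalDoublePVA d br)
    (hE : IsInverse d (constraintMatrix br θ) E) : IsNonlocalDoublePVA d (dirac d br θ E) where
  derivation := h.derivation
  bracket := h.bracket.dirac h.derivation θ E
  skew := h.skew.dirac h.derivation hE
  admissible := (h.jacobi.dirac h.derivation h.bracket h.skew hE).isAdmissible
  jacobi := h.jacobi.dirac h.derivation h.bracket h.skew hE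

end DiracJacobi

/-! ### Double PVA ideals generated by central elements -/

section Ideals

variable {F : Type*} [Field F]
variable {V : Type*} [Ring V] [Algebra F V]
variable {d : V →ₗ[F] V} {br : LambdaMap F V} {I : Ideal V}

lemma tmul_mem_idealTensor_right (v : V) {x : V} (hx : x ∈ I) : v ⊗ₜ[F] x ∈ idealTensor F I :=
  Submodule.mem_sup_left ⟨v ⊗ₜ ⟨x, hx⟩, rfl⟩

lemma tmul_mem_idealTensor_left {x : V} (hx : x ∈ I) (v : V) : x ⊗ₜ[F] v ∈ idealTensor F I :=
  Submodule.mem_sup_right ⟨(⟨x, hx⟩ : I.restrictScalars F) ⊗ₜ v, rfl⟩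

lemma idealTensor_le {S : Submodule F (V ⊗[F] V)} (hr : ∀ v, ∀ x ∈ I, v ⊗ₜ x ∈ S)
    (hl : ∀ x ∈ I, ∀ v, x ⊗ₜ v ∈ S) : idealTensor F I ≤ S := by
  refine sup_le ?_ ?_
  · rintro _ ⟨t, rfl⟩
    induction t with
    | zero => simp
    | add t t' ht ht' =>
      rw [map_add]
      exact S.add_mem ht ht'
    | tmul v x => exact hr v x x.2
  · rintro _ ⟨t, rfl⟩
    induction t with
    | zero => simp
    | add t t' ht ht' =>
      rw [map_add]
      exact S.add_mem ht ht'
    | tmul x v => exact hl x x.2 v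

lemma outerRight_mem_idealTensor {x : V} (hx : ∀ v, v * x ∈ I) (t : V ⊗[F] V) :
    outerRight x t ∈ idealTensor F I := by
  induction t with
  | zero => simp
  | add t t' ht ht' =>
    rw [map_add]
    exact Submodule.add_mem _ ht ht'
  | tmul u v => exact tmul_mem_idealTensor_right u (hx v)

lemma outerLeft_mem_idealTensor {x : V} (hx : ∀ v, x * v ∈ I) (t : V ⊗[F] V) :
    outerLeft x t ∈ idealTensor F I := by
  induction t with
  | zero => simp
  | add t t' ht ht' =>
    rw [map_add]
    exact Submodule.add_mem _ ht ht'
  | tmul u v => exact tmul_mem_idealTensor_left (hx u) v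

lemma outerRight_idealTensor [I.IsTwoSided] (b : V) {t : V ⊗[F] V} (ht : t ∈ idealTensor F I) :
    outerRight b t ∈ idealTensor F I :=
  idealTensor_le (S := (idealTensor F I).comap (outerRight b))
    (fun v _ hx => tmul_mem_idealTensor_right v (I.mul_mem_right b hx))
    (fun _ hx v => tmul_mem_idealTensor_left hx (v * b)) ht

lemma outerLeft_idealTensor (b : V) {t : V ⊗[F] V} (ht : t ∈ idealTensor F I) :
    outerLeft b t ∈ idealTensor F I :=
  idealTensor_le (S := (idealTensor F I).comap (outerLeft b))
    (fun v _ hx => tmul_mem_idealTensor_right (b * v) hx)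
    (fun _ hx v => tmul_mem_idealTensor_left (I.mul_mem_left b hx) v) ht

lemma flipTensor_idealTensor {t : V ⊗[F] V} (ht : t ∈ idealTensor F I) :
    flipTensor F V t ∈ idealTensor F I :=
  idealTensor_le (S := (idealTensor F I).comap (flipTensor F V))
    (fun v _ hx => tmul_mem_idealTensor_left hx v)
    (fun _ hx v => tmul_mem_idealTensor_right v hx) ht

lemma tensorDer_idealTensor (hI : ∀ x ∈ I, d x ∈ I) {t : V ⊗[F] V} (ht : t ∈ idealTensor F I) :
    tensorDer d t ∈ idealTensor F I := by
  refine idealTensor_le (S := (idealTensor F I).comap (tensorDer d))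
    (fun v x hx => ?_) (fun x hx v => ?_) ht
  · rw [Submodule.mem_comap, tensorDer_tmul]
    exact Submodule.add_mem _ (tmul_mem_idealTensor_right _ hx)
      (tmul_mem_idealTensor_right _ (hI x hx))
  · rw [Submodule.mem_comap, tensorDer_tmul]
    exact Submodule.add_mem _ (tmul_mem_idealTensor_left (hI x hx) _)
      (tmul_mem_idealTensor_left hx _)

lemma quotTensor_eq_zero [I.IsTwoSided] {t : V ⊗[F] V} (ht : t ∈ idealTensor F I) :
    quotTensor F I t = 0 := by
  refine idealTensor_le (S := LinearMap.ker (quotTensor F I)) (fun v x hx => ?_)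
    (fun x hx v => ?_) ht
  · have h : quotTensor F I (v ⊗ₜ x) =
        Ideal.Quotient.mk I v ⊗ₜ[F] Ideal.Quotient.mk I x := rfl
    rw [LinearMap.mem_ker, h, Ideal.Quotient.eq_zero_iff_mem.2 hx, TensorProduct.tmul_zero]
  · have h : quotTensor F I (x ⊗ₜ v) =
        Ideal.Quotient.mk I x ⊗ₜ[F] Ideal.Quotient.mk I v := rfl
    rw [LinearMap.mem_ker, h, Ideal.Quotient.eq_zero_iff_mem.2 hx, TensorProduct.zero_tmul]

lemma substNeg_coeff_mem {M : Type*} [AddCommGroup M] [Module F M] {D : M →ₗ[F] M}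
    {S : Submodule F M} (hD : ∀ x ∈ S, D x ∈ S) {f : InvLaurent F M} (hf : ∀ n, f.1 n ∈ S)
    (n : ℤ) : (substNeg D f).1 n ∈ S := by
  have hp : ∀ (j : ℕ), ∀ x ∈ S, (D ^ j) x ∈ S := fun j x hx => by
    induction j with
    | zero => exact hx
    | succ j ih =>
      rw [pow_succ', Module.End.mul_apply]
      exact hD _ ih
  rw [substNeg_coeff]
  refine finsum_induction (· ∈ S) S.zero_mem (fun _ _ => S.add_mem) fun j => ?_
  exact S.toAddSubgroup.zsmul_mem (S.toAddSubgroup.zsmul_mem (hp j _ (hf _)) _) _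

/-- If the `θᵢ` are central, the differential ideal which they generate is a double PVA ideal. -/
theorem isDoublePVAIdeal_diffIdeal (hb : IsLambdaBracket d br) (hs : IsSkew d br) {m : ℕ} {θ : Fin m → V}
    (hθ : ∀ a i, br a (θ i) = 0) : IsDoublePVAIdeal d br (diffIdeal d θ) := by
  have hdiff : ∀ x ∈ diffIdeal d θ, d x ∈ diffIdeal d θ := fun x hx =>
    Submodule.mem_sInf.2 fun J hJ => hJ.2.1 x (Submodule.mem_sInf.1 hx J hJ)
  have hgen : ∀ i, θ i ∈ diffIdeal d θ := fun i => Submodule.mem_sInf.2 fun J hJ => hJ.2.2 i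
  -- The elements whose brackets behave as required; this is a two-sided differential ideal
  -- containing the `θ i`, so by minimality it contains all of `diffIdeal d θ`.
  let J : Ideal V :=
    { carrier := {x | x ∈ diffIdeal d θ ∧
        ∀ a n, (br a x).1 n ∈ idealTensor F (diffIdeal d θ)}
      zero_mem' := ⟨zero_mem _, fun a n => by
        rw [map_zero]
        exact zero_mem _⟩
      add_mem' := fun {x y} hx hy => ⟨add_mem hx.1 hy.1, fun a n => by
        rw [map_add]
        exact add_mem (hx.2 a n) (hy.2 a n)⟩
      smul_mem' := fun c x hx => ⟨Ideal.mul_mem_left _ c hx.1, fun a n => by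
        rw [smul_eq_mul, hb.leibniz_right]
        exact add_mem (outerRight_mem_idealTensor (fun v => Ideal.mul_mem_left _ v hx.1) _)
          (outerLeft_idealTensor c (hx.2 a n))⟩ }
  have hJ : diffIdeal d θ ≤ J := by
    refine sInf_le ⟨⟨fun {x} b hx => ⟨Ideal.mul_mem_right b _ hx.1, fun a n => ?_⟩⟩,
      fun x hx => ⟨hdiff x hx.1, fun a n => ?_⟩, fun i => ⟨hgen i, fun a n => ?_⟩⟩
    · rw [hb.leibniz_right]
      exact add_mem (outerRight_idealTensor b (hx.2 a n))
        (outerLeft_mem_idealTensor (fun v => Ideal.mul_mem_right v _ hx.1) _)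
    · rw [hb.sesqui_right]
      exact add_mem (hx.2 a (n - 1)) (tensorDer_idealTensor hdiff (hx.2 a n))
    · rw [hθ]
      exact zero_mem _
  refine ⟨inferInstance, hdiff, fun a x hx n => (hJ hx).2 a n, fun x hx a n => ?_⟩
  rw [hs x a]
  exact neg_mem (flipTensor_idealTensor (substNeg_coeff_mem
    (fun t ht => tensorDer_idealTensor hdiff ht) (fun n => (hJ hx).2 a n) n))

/-- A double PVA ideal gives rise to an induced structure on the quotient. -/
theorem IsDoublePVAIdeal.exists_isInduced [I.IsTwoSided] (h : IsDoublePVAIdeal d br I) :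
    ∃ (d' : (V ⧸ I) →ₗ[F] (V ⧸ I)) (br' : LambdaMap F (V ⧸ I)), IsInduced I d br d' br' := by
  -- The structure is transported through an `F`-linear section. It is independent of
  -- representatives because `s ∘ π` changes elements only by members of `I`.
  obtain ⟨s, hs⟩ := (Ideal.Quotient.mkₐ F I).toLinearMap.exists_rightInverse_of_surjective
    (LinearMap.range_eq_top.2 Ideal.Quotient.mk_surjective)
  have hs' : ∀ a, s (Ideal.Quotient.mk I a) - a ∈ I := fun a =>
    Ideal.Quotient.eq.1 (LinearMap.congr_fun hs (Ideal.Quotient.mk I a))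
  refine ⟨(Ideal.Quotient.mkₐ F I).toLinearMap ∘ₗ d ∘ₗ s,
    (br.compl₁₂ s s).compr₂ (mapCoeff (quotTensor F I)), fun a => ?_, fun a b => ?_⟩
  · refine Ideal.Quotient.eq.2 ?_
    rw [LinearMap.comp_apply, ← map_sub]
    exact h.differential _ (hs' a)
  · refine InvLaurent.ext fun n => ?_
    have h1 := quotTensor_eq_zero (h.bracket_right (s (Ideal.Quotient.mk I a)) _ (hs' b) n)
    have h2 := quotTensor_eq_zero (h.bracket_left _ (hs' a) b n)
    rw [map_sub, InvLaurent.sub_coeff, map_sub, sub_eq_zero] at h1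
    rw [map_sub, LinearMap.sub_apply, InvLaurent.sub_coeff, map_sub, sub_eq_zero] at h2
    exact h1.trans h2

end Ideals

/-! ### Descent along surjective homomorphisms -/

section Descent

variable {F : Type*} [Field F]
variable {V : Type*} [Ring V] [Algebra F V] {W : Type*} [Ring W] [Algebra F W]

/-- `π ⊗ π`. -/
def mapTensor (π : V →ₐ[F] W) : V ⊗[F] V →ₗ[F] W ⊗[F] W :=
  TensorProduct.map π.toLinearMap π.toLinearMap

/-- `π ⊗ π ⊗ π`. -/
def mapTriple (π : V →ₐ[F] W) : V ⊗[F] (V ⊗[F] V) →ₗ[F] W ⊗[F] (W ⊗[F] W) :=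
  TensorProduct.map π.toLinearMap (mapTensor π)

@[simp]
lemma mapTensor_tmul (π : V →ₐ[F] W) (x y : V) :
    mapTensor π (x ⊗ₜ y) = π x ⊗ₜ π y := rfl

@[simp]
lemma mapTriple_tmul (π : V →ₐ[F] W) (x y z : V) :
    mapTriple π (x ⊗ₜ (y ⊗ₜ z)) = π x ⊗ₜ (π y ⊗ₜ π z) := rfl

variable (π : V →ₐ[F] W)

lemma mapTensor_outerLeft (b : V) (t : V ⊗[F] V) :
    mapTensor π (outerLeft b t) = outerLeft (π b) (mapTensor π t) := by
  induction t with
  | zero => simp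
  | add t t' ht ht' => simp only [map_add, ht, ht']
  | tmul x y => simp

lemma mapTensor_outerRight (c : V) (t : V ⊗[F] V) :
    mapTensor π (outerRight c t) = outerRight (π c) (mapTensor π t) := by
  induction t with
  | zero => simp
  | add t t' ht ht' => simp only [map_add, ht, ht']
  | tmul x y => simp

lemma mapTensor_starRight (t : V ⊗[F] V) (b : V) :
    mapTensor π (starRight F V t b) = starRight F W (mapTensor π t) (π b) := by
  induction t with
  | zero => simp
  | add t t' ht ht' => simp only [map_add, LinearMap.add_apply, ht, ht']
  | tmul x y => simp

lemma mapTensor_starLeft (t : V ⊗[F] V) (a : V) :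
    mapTensor π (starLeft F V t a) = starLeft F W (mapTensor π t) (π a) := by
  induction t with
  | zero => simp
  | add t t' ht ht' => simp only [map_add, LinearMap.add_apply, ht, ht']
  | tmul x y => simp

lemma mapTensor_comm (t : V ⊗[F] V) :
    mapTensor π ((TensorProduct.comm F V V).toLinearMap t) =
      (TensorProduct.comm F W W).toLinearMap (mapTensor π t) := by
  induction t with
  | zero => simp
  | add t t' ht ht' => simp only [map_add, ht, ht']
  | tmul x y => rfl

lemma mapTriple_tensorRight (t : V ⊗[F] V) (c : V) :
    mapTriple π (tensorRight F V t c) = tensorRight F W (mapTensor π t) (π c) := by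
  induction t with
  | zero => simp
  | add t t' ht ht' => simp only [map_add, LinearMap.add_apply, ht, ht']
  | tmul x y => simp

lemma mapTriple_tensorLeft (t : V ⊗[F] V) (b : V) :
    mapTriple π (tensorLeft F V t b) = tensorLeft F W (mapTensor π t) (π b) := rfl

lemma mapTriple_tensorMid (t : V ⊗[F] V) (b : V) :
    mapTriple π (tensorMid F V t b) = tensorMid F W (mapTensor π t) (π b) := by
  induction t with
  | zero => simp
  | add t t' ht ht' => simp only [map_add, LinearMap.add_apply, ht, ht']
  | tmul x y => simp

variable {π} {d : V →ₗ[F] V} {d' : W →ₗ[F] W} {br : LambdaMap F V} {br' : LambdaMap F W}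

lemma mapTensor_tensorDer (hπd : ∀ a, π (d a) = d' (π a)) (t : V ⊗[F] V) :
    mapTensor π (tensorDer d t) = tensorDer d' (mapTensor π t) := by
  induction t with
  | zero => simp
  | add t t' ht ht' => simp only [map_add, ht, ht']
  | tmul x y => simp [hπd]

lemma mapCoeff_brL (hπb : ∀ a b, mapCoeff (mapTensor π) (br a b) = br' (π a) (π b)) (a : V)
    (t : V ⊗[F] V) : mapCoeff (mapTriple π) (brL br a t) = brL br' (π a) (mapTensor π t) := by
  induction t with
  | zero => simp
  | add t t' ht ht' => simp only [map_add, ht, ht']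
  | tmul x y =>
    rw [mapTensor_tmul, brL_tmul, brL_tmul, ← hπb]
    exact InvLaurent.ext fun n => mapTriple_tensorRight π _ y

lemma mapCoeff_brR (hπb : ∀ a b, mapCoeff (mapTensor π) (br a b) = br' (π a) (π b)) (a : V)
    (t : V ⊗[F] V) : mapCoeff (mapTriple π) (brR br a t) = brR br' (π a) (mapTensor π t) := by
  induction t with
  | zero => simp
  | add t t' ht ht' => simp only [map_add, ht, ht']
  | tmul x y =>
    rw [mapTensor_tmul, brR_tmul, brR_tmul, ← hπb]
    exact InvLaurent.ext fun n => mapTriple_tensorLeft π _ x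

lemma mapCoeff_brFst (hπd : ∀ a, π (d a) = d' (π a))
    (hπb : ∀ a b, mapCoeff (mapTensor π) (br a b) = br' (π a) (π b)) (c : V) (t : V ⊗[F] V) :
    mapCoeff (mapTriple π) (brFst d br c t) = brFst d' br' (π c) (mapTensor π t) := by
  induction t with
  | zero => simp
  | add t t' ht ht' => simp only [map_add, ht, ht']
  | tmul x y =>
    rw [mapTensor_tmul, brFst_tmul, brFst_tmul, ← hπb]
    exact mapCoeff_arrow _ _ _ (mapTensor π) π.toLinearMap hπd (mapTriple_tensorMid π) _ y

/-- All operations in the axioms are natural in the algebra, so the axioms hold on images, and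
surjectivity makes every element an image. -/
lemma IsLambdaBracket.of_surjective (hπ : Function.Surjective π)
    (hπd : ∀ a, π (d a) = d' (π a))
    (hπb : ∀ a b, mapCoeff (mapTensor π) (br a b) = br' (π a) (π b))
    (h : IsLambdaBracket d br) : IsLambdaBracket d' br' where
  sesqui_left a b := by
    obtain ⟨a, rfl⟩ := hπ a
    obtain ⟨b, rfl⟩ := hπ b
    rw [← hπd, ← hπb, ← hπb, h.sesqui_left, map_neg]
    rfl
  sesqui_right a b := by
    obtain ⟨a, rfl⟩ := hπ a
    obtain ⟨b, rfl⟩ := hπ b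
    rw [← hπd, ← hπb, ← hπb, h.sesqui_right, map_add]
    refine congrArg₂ (· + ·) rfl (InvLaurent.ext fun n => mapTensor_tensorDer hπd _)
  leibniz_right a b c := by
    obtain ⟨a, rfl⟩ := hπ a
    obtain ⟨b, rfl⟩ := hπ b
    obtain ⟨c, rfl⟩ := hπ c
    rw [← map_mul, ← hπb, ← hπb, ← hπb, h.leibniz_right, map_add]
    exact congrArg₂ (· + ·) (InvLaurent.ext fun n => mapTensor_outerRight π c _)
      (InvLaurent.ext fun n => mapTensor_outerLeft π b _)
  leibniz_left a b c := by
    obtain ⟨a, rfl⟩ := hπ a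
    obtain ⟨b, rfl⟩ := hπ b
    obtain ⟨c, rfl⟩ := hπ c
    rw [← map_mul, ← hπb, ← hπb, ← hπb, h.leibniz_left, map_add]
    exact congrArg₂ (· + ·)
      (mapCoeff_arrow _ _ _ (mapTensor π) π.toLinearMap hπd (mapTensor_starRight π) _ b)
      (mapCoeff_arrow _ _ _ (mapTensor π) π.toLinearMap hπd (mapTensor_starLeft π) _ a)

lemma IsSkew.of_surjective (hπ : Function.Surjective π) (hπd : ∀ a, π (d a) = d' (π a))
    (hπb : ∀ a b, mapCoeff (mapTensor π) (br a b) = br' (π a) (π b))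
    (h : IsSkew d br) : IsSkew d' br' := fun a b => by
  obtain ⟨a, rfl⟩ := hπ a
  obtain ⟨b, rfl⟩ := hπ b
  rw [← hπb, ← hπb, h, map_neg, ← mapCoeff_substNeg _ (mapTensor_tensorDer hπd)]
  exact congrArg Neg.neg (InvLaurent.ext fun n => mapTensor_comm π _)

lemma mapCoeff₃_mulRel {M N : Type*} [AddCommGroup M] [Module F M] [AddCommGroup N] [Module F N]
    (φ : M →ₗ[F] N) (ε : ℤˣ) (X : Laurent₃ F M) :
    mapCoeff₃ φ (mulRel F ε X) = mulRel F ε (mapCoeff₃ φ X) :=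
  Laurent₃.ext fun i j k => by
    simp only [mapCoeff₃_coeff, mulRel_coeff, map_sub, map_zsmul]

/-- The representatives, including the witness `Q`, are pushed forward coefficientwise; expansions
and multiplication by `ν - λ - μ` commute with this. -/
lemma IsJacobi.of_surjective (hπ : Function.Surjective π) (hπd : ∀ a, π (d a) = d' (π a))
    (hπb : ∀ a b, mapCoeff (mapTensor π) (br a b) = br' (π a) (π b))
    (h : IsJacobi d br) : IsJacobi d' br' := by
  rw [isJacobi_iff] at h ⊢
  intro a b c
  obtain ⟨a, rfl⟩ := hπ a
  obtain ⟨b, rfl⟩ := hπ b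
  obtain ⟨c, rfl⟩ := hπ c
  obtain ⟨X, Y, Z, Q, hX, hY, hZ, hQ⟩ := h a b c
  refine ⟨mapCoeff₃ (mapTriple π) X, mapCoeff₃ (mapTriple π) Y, mapCoeff₃ (mapTriple π) Z,
    mapCoeff₃ (mapTriple π) Q, ?_, ?_, ?_, ?_⟩
  · rw [expand_mapCoeff₃, hX, nestedL, nestedL, ← hπb]
    exact InvLaurent.ext fun n => mapCoeff_brL hπb a _
  · refine (expand_mapCoeff₃ 1 (mapTriple π) (swapVars F Y)).trans ?_
    rw [hY, nestedR, nestedR, ← hπb]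
    exact InvLaurent.ext fun n => mapCoeff_brR hπb b _
  · refine (expand_mapCoeff₃ (-1) (mapTriple π) (rotVars F Z)).trans ?_
    rw [hZ, nestedFst, nestedFst, ← hπb]
    exact InvLaurent.ext fun n => mapCoeff_brFst hπd hπb c _
  · rw [← map_sub, ← map_sub, hQ, mapCoeff₃_mulRel]

/-- The image of a non-local double Poisson vertex algebra under a surjective homomorphism
compatible with the derivations and the brackets. -/
theorem IsNonlocalDoublePVA.of_surjective (hπ : Function.Surjective π)
    (hπd : ∀ a, π (d a) = d' (π a))
    (hπb : ∀ a b, mapCoeff (mapTensor π) (br a b) = br' (π a) (π b))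
    (h : IsNonlocalDoublePVA d br) : IsNonlocalDoublePVA d' br' where
  derivation a b := by
    obtain ⟨a, rfl⟩ := hπ a
    obtain ⟨b, rfl⟩ := hπ b
    rw [← map_mul, ← hπd, ← hπd, ← hπd, h.derivation, map_add, map_mul, map_mul]
  bracket := h.bracket.of_surjective hπ hπd hπb
  skew := h.skew.of_surjective hπ hπd hπb
  admissible := (h.jacobi.of_surjective hπ hπd hπb).isAdmissible
  jacobi := h.jacobi.of_surjective hπ hπd hπb

end Descent

end NonlocalDoublePVA

end

theorem mainTheorem7 {F : Type*} [Field F] [CharZero F] {V : Type*} [Ring V] [Algebra F V]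
    (d : V →ₗ[F] V) (br : NonlocalDoublePVA.LambdaMap F V)
    (hV : NonlocalDoublePVA.IsNonlocalDoublePVA d br)
    (m : ℕ) (θ : Fin m → V)
    (Cinv : Matrix (Fin m) (Fin m) (NonlocalDoublePVA.InvLaurent F (TensorProduct F V V)))
    (hC : NonlocalDoublePVA.IsInverse d (NonlocalDoublePVA.constraintMatrix br θ) Cinv) :
    NonlocalDoublePVA.IsNonlocalDoublePVA d (NonlocalDoublePVA.dirac d br θ Cinv) ∧
    (∀ (i : Fin m) (a : V),
      NonlocalDoublePVA.dirac d br θ Cinv a (θ i) = 0 ∧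
      NonlocalDoublePVA.dirac d br θ Cinv (θ i) a = 0) ∧
    NonlocalDoublePVA.IsDoublePVAIdeal d (NonlocalDoublePVA.dirac d br θ Cinv)
      (NonlocalDoublePVA.diffIdeal d θ) ∧
    ∃ (d' : (V ⧸ NonlocalDoublePVA.diffIdeal d θ) →ₗ[F] (V ⧸ NonlocalDoublePVA.diffIdeal d θ))
      (br' : NonlocalDoublePVA.LambdaMap F (V ⧸ NonlocalDoublePVA.diffIdeal d θ)),
      NonlocalDoublePVA.IsInduced (NonlocalDoublePVA.diffIdeal d θ) d
        (NonlocalDoublePVA.dirac d br θ Cinv) d' br' ∧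
      NonlocalDoublePVA.IsNonlocalDoublePVA d' br' := by
  have hD := hV.dirac hC
  have hI := NonlocalDoublePVA.isDoublePVAIdeal_diffIdeal hD.bracket hD.skew
    (NonlocalDoublePVA.dirac_constraint_right hV.derivation hC)
  obtain ⟨d', br', h'⟩ := hI.exists_isInduced
  refine ⟨hD, fun i a => ⟨NonlocalDoublePVA.dirac_constraint_right hV.derivation hC a i, ?_⟩,
    hI, d', br', h', ?_⟩
  · exact NonlocalDoublePVA.dirac_constraint_left hV.derivation hC a i
  · exact hD.of_surjective (π := Ideal.Quotient.mkₐ F (NonlocalDoublePVA.diffIdeal d θ))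
      Ideal.Quotient.mk_surjective (fun a => (h'.1 a).symm) (fun a b => (h'.2 a b).symm)
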